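/- Let $n\ge 1$ and let $S\neq 0$ be a finite-dimensional complex vector space on which the Clifford algebra of $\mathbb R^n$ acts complex-linearly, with Clifford multiplication normalized by $x\cdot y+y\cdot x=-2\langle x,y\rangle$ (for example the spinor module; for even $n$, half-spinor-valued fields are fields with values in a subspace of the spinor module). Let $\slashed{D}\varphi=\sum_{k=1}^n e_k\cdot\partial_k\varphi$ be the Dirac operator and $\Delta=\sum_{k=1}^n\partial_k^2$. For $\mu\in\mathbb C$ let $\slashed{r}^{\mu}(x)=|x|^{\mu-1}\,x\cdot$, a locally integrable $\mathrm{End}(S)$-valued function for $\operatorname{Re}\mu>-n$, continued meromorphically in $\mu$ as a distribution to $\mathbb C\setminus\{-n-1-2k: k\in\mathbb N_0\}$. The spinor Knapp–Stein operator is $$(\slashed{I}_\gamma f)(x)=(\slashed{r}^{-2\gamma}\star f)(x)=\int_{\mathbb R^n}\slashed{r}^{-2\gamma}(y)\,f(x-y)\,dy ,$$ for smooth $f:\mathbb R^n\to S$ for which, for every $x$, the integral over $|y|\ge 1$ converges absolutely; the integral over $|y|<1$ is taken in the sense of the analytic continuation in the exponent. Let $(M_{x_n}f)(x)=x_nf(x)$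 and $$\slashed{D}(\lambda)=\slashed{I}_{\lambda+1}\circ M_{x_n}\circ\slashed{I}_{n-\lambda}.$$ Let $c_\mu=2^{\mu+n}\pi^{n/2}\,\Gamma(\tfrac{\mu+n}{2})\,\Gamma(-\tfrac{\mu}{2})^{-1}$, let $\slashed{c}_\mu=-i\,\frac{c_{\mu+1}}{\mu+1}$ (as a meromorphic function, so that the removable singularity at $\mu=-1$ is removed), and put $\tilde{\slashed{c}}_\lambda=\slashed{c}_{-2\lambda-2}\,\slashed{c}_{2\lambda-2n}$. Theorem. Let $\lambda\in\mathbb C$ be such that neither $-2\lambda-2$ nor $2\lambda-2n$ is one of the poles $-n-1-2k$, $k\in\mathbb N_0$. Then for every Schwartz function $\varphi:\mathbb R^n\to S$ the function $\slashed{I}_{n-\lambda}\varphi$ is defined and smooth on $\mathbb R^n$, $\slashed{I}_{\lambda+1}$ is defined on $x_n\,\slashed{I}_{n-\lambda}\varphi$ at every point, and $$\slashed{D}(\lambda)\varphi=\tilde{\slashed{c}}_\lambda\big[(2\lambda-n+1)\,\partial_n\varphi+\slashed{D}(e_n\cdot\varphi)+\Delta(x_n\varphi)\big].$$ In particular $\slashed{D}(\lambda)$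 is a linear differential operator with smooth $\mathrm{End}(S)$-valued coefficients of order at most $2$, and it is not of order at most $1$ if $\tilde{\slashed{c}}_\lambda\neq 0$. -/

import Mathlib

open scoped SchwartzMap ContDiff

noncomputable section

namespace SpinorKS

/-- Euclidean space `ℝⁿ`. -/
abbrev Euc (n : ℕ) : Type := EuclideanSpace ℝ (Fin n)

/-- The quadratic form `x ↦ -|x|²` on `ℝⁿ`. In its Clifford algebra `x · x = -|x|²`. -/
def negNormSq (n : ℕ) : QuadraticForm ℝ (Euc n) :=
  -(LinearMap.BilinMap.toQuadraticMap (innerₗ (Euc n)))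

lemma negNormSq_apply (n : ℕ) (x : Euc n) : negNormSq n x = -‖x‖ ^ 2 := by
  simp [negNormSq]

/-- A complex representation, on `S`, of the Clifford algebra of `ℝⁿ` with the form `-|x|²`. -/
abbrev CliffordRep (n : ℕ) (S : Type*) [NormedAddCommGroup S] [NormedSpace ℂ S] : Type _ :=
  CliffordAlgebra (negNormSq n) →ₐ[ℝ] (S →L[ℂ] S)

/-- The unit vector `e_k`. -/
def e {n : ℕ} (k : Fin n) : Euc n := EuclideanSpace.single k (1 : ℝ)

/-- The index of the last coordinate `x_n`. -/
def lastIdx (n : ℕ) (hn : 0 < n) : Fin n := ⟨n - 1, Nat.sub_lt hn Nat.one_pos⟩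

section Operators

variable {n : ℕ} {S : Type*} [NormedAddCommGroup S] [NormedSpace ℂ S]

/-- Clifford multiplication `s ↦ x · s` by a vector `x`. -/
def cl (ρ : CliffordRep n S) (x : Euc n) : S →L[ℂ] S := ρ (CliffordAlgebra.ι (negNormSq n) x)

lemma cl_mul_self (ρ : CliffordRep n S) (x : Euc n) (s : S) :
    cl ρ x (cl ρ x s) = -(‖x‖ ^ 2 • s) := by
  have h : cl ρ x * cl ρ x = algebraMap ℝ (S →L[ℂ] S) (-‖x‖ ^ 2) := by
    rw [cl, ← map_mul, CliffordAlgebra.ι_sq_scalar, AlgHom.commutes, negNormSq_apply]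
  have h2 := DFunLike.congr_fun h s
  rw [mul_apply_eq_comp] at h2
  rw [h2, Algebra.algebraMap_eq_smul_one]
  simp

/-- The Dirac operator `∑ₖ eₖ · ∂ₖφ`. -/
def dirac (ρ : CliffordRep n S) (φ : Euc n → S) (x : Euc n) : S :=
  ∑ k : Fin n, cl ρ (e k) (fderiv ℝ φ x (e k))

/-- The kernel `|y|^(z-1) y·`, a locally integrable function of `y` for `Re z > -n`. -/
def rieszKernel (ρ : CliffordRep n S) (z : ℂ) (y : Euc n) : S →L[ℂ] S :=
  ((‖y‖ : ℂ) ^ (z - 1)) • cl ρ y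

/-- The poles `z = -n - 1 - 2k`, `k = 0, 1, 2, …`, of the meromorphic continuation of the
distribution `|y|^(z-1) y·`. -/
def rieszPoles (n : ℕ) : Set ℂ := {z | ∃ k : ℕ, z = -(n : ℂ) - 1 - 2 * (k : ℂ)}

/-- `F` is the analytic continuation, to the complement of the poles, of
`z ↦ ∫_{|y| < 1} |y|^(z-1) y · g(y) dy`, which is given on `Re z > -n` as an absolutely
convergent integral. The values of `F` off the poles are determined by `g`. -/
structure IsInnerContinuation (ρ : CliffordRep n S) (g : Euc n → S) (F : ℂ → S) : Prop where
  differentiableOn : DifferentiableOn ℂ F (rieszPoles n)ᶜ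
  integrableOn : ∀ z : ℂ, -(n : ℝ) < z.re →
    MeasureTheory.IntegrableOn (fun y => rieszKernel ρ z y (g y)) (Metric.ball 0 1)
  eq_integral : ∀ z : ℂ, -(n : ℝ) < z.re →
    F z = ∫ y in Metric.ball (0 : Euc n) 1, rieszKernel ρ z y (g y)

/-- The regularized integral of `|y|^(z-1) y · g(y)` over `ℝⁿ` exists: the integral over the unit
ball has an analytic continuation and the integral over its complement converges absolutely. -/
def HasRegularizedIntegral (ρ : CliffordRep n S) (z : ℂ) (g : Euc n → S) : Prop :=
  (∃ F : ℂ → S, IsInnerContinuation ρ g F) ∧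
    MeasureTheory.IntegrableOn (fun y => rieszKernel ρ z y (g y)) (Metric.ball 0 1)ᶜ

open Classical in
/-- The analytic continuation in `z` of `∫_{|y| < 1} |y|^(z-1) y · g(y) dy` (zero if there is
none). -/
def innerPart (ρ : CliffordRep n S) (z : ℂ) (g : Euc n → S) : S :=
  if h : ∃ F : ℂ → S, IsInnerContinuation ρ g F then h.choose z else 0

/-- The pairing of `g` with the meromorphically continued Riesz distribution `|y|^(z-1) y·`.
For a Schwartz function `g` the integral over the complement of the ball is entire in `z`, so that
this is the meromorphic continuation in `z` of `∫ |y|^(z-1) y · g(y) dy` from the half-plane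
`Re z > -n`. It also makes sense for every smooth `g` such that the integral of
`|y|^(z-1) y · g(y)` converges absolutely at infinity. -/
def regularizedIntegral (ρ : CliffordRep n S) (z : ℂ) (g : Euc n → S) : S :=
  innerPart ρ z g + ∫ y in (Metric.ball (0 : Euc n) 1)ᶜ, rieszKernel ρ z y (g y)

/-- The value at `x` of the Knapp–Stein operator with parameter `γ` exists. -/
def KnappSteinDefinedAt (ρ : CliffordRep n S) (γ : ℂ) (f : Euc n → S) (x : Euc n) : Prop :=
  HasRegularizedIntegral ρ (-2 * γ) (fun y => f (x - y))

/-- The spinor Knapp–Stein operator: convolution of the Riesz distribution for spinors with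
exponent `-2γ` with the spinor field `f`. -/
def knappStein (ρ : CliffordRep n S) (γ : ℂ) (f : Euc n → S) (x : Euc n) : S :=
  regularizedIntegral ρ (-2 * γ) (fun y => f (x - y))

/-- Multiplication by the coordinate function `x_n`. -/
def mulLast (hn : 0 < n) (f : Euc n → S) (x : Euc n) : S := x (lastIdx n hn) • f x

/-- The composition of the Knapp–Stein operator with parameter `n - lam`, the multiplication by
`x_n`, and the Knapp–Stein operator with parameter `lam + 1`, in this order. -/
def compositeOp (hn : 0 < n) (ρ : CliffordRep n S) (lam : ℂ) (f : Euc n → S) : Euc n → S :=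
  knappStein ρ (lam + 1) (mulLast hn (knappStein ρ ((n : ℂ) - lam) f))

/-- `P` is a linear differential operator of order at most `N` with smooth `End(S)`-valued
coefficients: `(Pφ)(x) = ∑_{k ≤ N} ∑_{i₁,…,iₖ} a_{i₁…iₖ}(x) ∂_{i₁}⋯∂_{iₖ} φ(x)`. -/
def IsDiffOpOfOrderLE (N : ℕ) (P : 𝓢(Euc n, S) → Euc n → S) : Prop :=
  ∃ a : (k : ℕ) → (Fin k → Fin n) → Euc n → (S →L[ℂ] S),
    (∀ k I, ContDiff ℝ ∞ (a k I)) ∧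
    ∀ (φ : 𝓢(Euc n, S)) (x : Euc n),
      P φ x = ∑ k ∈ Finset.range (N + 1), ∑ I : Fin k → Fin n,
        a k I x (iteratedFDeriv ℝ k φ x (fun j => e (I j)))

end Operators

/-- `c_z = 2^(z+n) π^(n/2) Γ((z+n)/2) / Γ(-z/2)`. (At the poles of the denominator `Γ(-z/2)`,
Mathlib's conventions give the correct value `1/Γ = 0`.) -/
def rieszConst (n : ℕ) (z : ℂ) : ℂ :=
  (2 : ℂ) ^ (z + n) * (Real.pi : ℂ) ^ ((n : ℂ) / 2) * Complex.Gamma ((z + n) / 2) *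
    (Complex.Gamma (-z / 2))⁻¹

/-- The meromorphic function `-i c_{z+1} / (z+1)`; its singularity at `z = -1` is removable, and
its value there is the limit, as `spinorConst_eq` shows. -/
def spinorConst (n : ℕ) (z : ℂ) : ℂ :=
  if z = -1 then Complex.I * (2 : ℂ) ^ ((n : ℂ) - 1) * (Real.pi : ℂ) ^ ((n : ℂ) / 2) *
    Complex.Gamma ((n : ℂ) / 2)
  else -Complex.I * rieszConst n (z + 1) / (z + 1)

lemma spinorConst_eq (n : ℕ) (z : ℂ) :
    spinorConst n z = Complex.I * (2 : ℂ) ^ (z + n) * (Real.pi : ℂ) ^ ((n : ℂ) / 2) *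
      Complex.Gamma ((z + 1 + n) / 2) * (Complex.Gamma ((1 - z) / 2))⁻¹ := by
  unfold spinorConst
  split_ifs with h
  · subst h
    have h1 : ((1 : ℂ) - -1) / 2 = 1 := by norm_num
    have h2 : (-1 + 1 + (n : ℂ)) / 2 = n / 2 := by ring
    have h3 : (-1 : ℂ) + n = n - 1 := by ring
    rw [h1, h2, h3, Complex.Gamma_one]
    simp
  · have hz : z + 1 ≠ 0 := fun h0 => h (eq_neg_of_add_eq_zero_left h0)
    have hs : -(z + 1) / 2 ≠ 0 := div_ne_zero (neg_ne_zero.mpr hz) two_ne_zero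
    have h1 : (1 - z) / 2 = -(z + 1) / 2 + 1 := by ring
    have h2 : z + 1 + (n : ℂ) = (z + n) + 1 := by ring
    rw [h1, Complex.Gamma_add_one _ hs, rieszConst, h2, Complex.cpow_add _ _ two_ne_zero,
      Complex.cpow_one, mul_inv]
    field_simp

end SpinorKS

end

/-!
The Riesz kernel `|y|^(z-1) y·` is a superposition of Gaussians, and the first Gaussian moments of
a Schwartz field `φ` are heat flows of its Dirac derivative. Hence, on a strip of exponents, the
Riesz convolution of `φ` is a constant multiple of the Mellin transform of the heat flow of `Dφ`
(`symKS_eq_heatMellin`); here the convolution is written in terms of the odd part of `φ (x - ·)`,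
so that it converges for `Re z > -n - 1`. Integration by parts in the time of the heat flow, and
the commutation relation between coordinates and the heat operator, give two functional equations

* `(z + 1)(z + 1 + n) r^z ⋆ φ = r^(z+2) ⋆ Δφ` (`symKS_laplacian`),
* `(z + 1)(z + 1 + n) x_k (r^z ⋆ φ) = r^(z+2) ⋆ W_z φ` (`coord_smul_symKS`), where
  `W_z φ = Δ(x_k φ) + (z + n + 1) ∂_k φ + D(e_k · φ)`.

The first one defines the continuation `extKS` of the Riesz convolution to all exponents off the
poles, and by the identity theorem (`eq_off_poles`) both persist there. The continued convolution
of a Schwartz field is smooth (`contDiff_extKS`) and bounded by `(1 + |x|)^(Re z)`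
(`hasDecay_extKS`). For `z + w = -2n - 2` the product `x_k (r^z ⋆ φ)` therefore lies in the domain
of the convolution with `r^w`.

The second ingredient is the inversion formula `r^w ⋆ (r^z ⋆ φ) = c φ` for `z + w = -2n`
(`rieszConv_inversion`). Where all integrals converge, the semigroup law of the heat operators
turns the composition of two Riesz convolutions into a single Mellin transform of the heat flow of
`D²φ = -Δφ` (`symKS_symKS`). On the critical line `z + w = -2n`, reached by continuation in `w`,
that transform is the integral of `∂_p exp(pΔ/4) φ` and equals a multiple of `φ`. All other
exponents are reached by the first functional equation, which has to be known also for the outer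
convolution, acting on fields that are smooth but only of controlled growth
(`rieszConv_coordLaplacian`; proved with cutoffs).

Combining the second functional equation with the inversion formula gives the composition
`r^w ⋆ (x_k (r^z ⋆ φ))` as a multiple of `W_z φ` (`rieszConv_coord_smul_extKS`), except at `z = -1`,
where `z + 1` vanishes; there the Laplacian is moved onto `x_k (r^z ⋆ φ)` instead. The order of the
resulting operator is read off from its coefficients (`weightedOpCoeff`), and the field
`|u - x|² v` near a point `x` with `x_k ≠ 0` detects the second order part.
-/

noncomputable section

namespace SpinorKS

open scoped LineDeriv Laplacian FourierTransform InnerProductSpace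
open MeasureTheory Set Filter Topology

variable {n : ℕ} {S : Type*} [NormedAddCommGroup S] [NormedSpace ℂ S]

/-! ### Clifford multiplication and the Dirac operator on Schwartz fields -/

lemma cl_add (ρ : CliffordRep n S) (x y : Euc n) : cl ρ (x + y) = cl ρ x + cl ρ y := by
  simp [cl]

lemma cl_smul (ρ : CliffordRep n S) (c : ℝ) (x : Euc n) : cl ρ (c • x) = c • cl ρ x := by
  simp [cl]

lemma cl_neg (ρ : CliffordRep n S) (x : Euc n) : cl ρ (-x) = -cl ρ x := by
  simp [cl]

/-- Clifford multiplication as a linear map of the vector. -/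
def clₗ (ρ : CliffordRep n S) : Euc n →ₗ[ℝ] (S →L[ℂ] S) where
  toFun := cl ρ
  map_add' := cl_add ρ
  map_smul' := cl_smul ρ

lemma continuous_cl (ρ : CliffordRep n S) : Continuous (cl ρ) :=
  (clₗ ρ).continuous_of_finiteDimensional

lemma exists_norm_cl_le (ρ : CliffordRep n S) : ∃ C, 0 ≤ C ∧ ∀ x, ‖cl ρ x‖ ≤ C * ‖x‖ := by
  refine ⟨‖LinearMap.toContinuousLinearMap (clₗ ρ)‖, ContinuousLinearMap.opNorm_nonneg _,
    fun x => ?_⟩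
  exact (LinearMap.toContinuousLinearMap (clₗ ρ)).le_opNorm x

lemma cl_eq_sum (ρ : CliffordRep n S) (x : Euc n) : cl ρ x = ∑ k, x k • cl ρ (e k) := by
  have hx : x = ∑ k, x k • (e k : Euc n) := by
    have := (EuclideanSpace.basisFun (Fin n) ℝ).sum_repr x
    simpa [e] using this.symm
  conv_lhs => rw [hx]
  change clₗ ρ _ = _
  rw [map_sum]
  exact Finset.sum_congr rfl fun k _ => (clₗ ρ).map_smul _ _

/-- The polarized Clifford relation. -/
lemma cl_cl_add_cl_cl (ρ : CliffordRep n S) (x y : Euc n) (s : S) :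
    cl ρ x (cl ρ y s) + cl ρ y (cl ρ x s) = -((2 * inner ℝ x y) • s) := by
  have h := cl_mul_self ρ (x + y) s
  rw [cl_add] at h
  simp only [add_apply, map_add, cl_mul_self, norm_add_sq_real, add_smul, neg_add] at h
  have h2 : cl ρ x (cl ρ y s) + cl ρ y (cl ρ x s) + (2 * inner ℝ x y) • s = 0 := by
    have := sub_eq_zero.2 h
    rw [← this]
    abel
  exact eq_neg_of_add_eq_zero_left h2

/-- Multiplication of a Schwartz field by the `k`-th coordinate. -/
def coordS (k : Fin n) : 𝓢(Euc n, S) →L[ℝ] 𝓢(Euc n, S) :=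
  SchwartzMap.smulLeftCLM S (fun x : Euc n => x k)

lemma hasTemperateGrowth_coord (k : Fin n) :
    Function.HasTemperateGrowth (fun x : Euc n => x k) :=
  (EuclideanSpace.proj k : Euc n →L[ℝ] ℝ).hasTemperateGrowth

@[simp] lemma coordS_apply (k : Fin n) (φ : 𝓢(Euc n, S)) (x : Euc n) :
    coordS k φ x = x k • φ x :=
  SchwartzMap.smulLeftCLM_apply_apply (hasTemperateGrowth_coord k) φ x

/-- Clifford multiplication of a Schwartz field by a constant vector. -/
def clS (ρ : CliffordRep n S) (v : Euc n) : 𝓢(Euc n, S) →L[ℂ] 𝓢(Euc n, S) :=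
  SchwartzMap.postcompCLM (cl ρ v)

@[simp] lemma clS_apply (ρ : CliffordRep n S) (v : Euc n) (φ : 𝓢(Euc n, S)) (x : Euc n) :
    clS ρ v φ x = cl ρ v (φ x) := rfl

lemma lineDerivOp_clS (ρ : CliffordRep n S) (v m : Euc n) (φ : 𝓢(Euc n, S)) :
    ∂_{m} (clS ρ v φ) = clS ρ v (∂_{m} φ) := by
  ext x
  rw [clS_apply, SchwartzMap.lineDerivOp_apply_eq_fderiv, SchwartzMap.lineDerivOp_apply_eq_fderiv]
  have h : HasFDerivAt (fun y => cl ρ v (φ y))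
      (((cl ρ v).restrictScalars ℝ).comp (fderiv ℝ φ x)) x :=
    ((cl ρ v).restrictScalars ℝ).hasFDerivAt.comp x (φ.hasFDerivAt x)
  have h2 := h.fderiv
  change fderiv ℝ (fun y => cl ρ v (φ y)) x m = _
  rw [h2]
  rfl

lemma lineDerivOp_comm (v m : Euc n) (φ : 𝓢(Euc n, S)) :
    ∂_{v} (∂_{m} φ : 𝓢(Euc n, S)) = ∂_{m} (∂_{v} φ) := by
  have key : ∀ a b : Euc n, ∀ x, (∂_{a} (∂_{b} φ : 𝓢(Euc n, S))) x =
      iteratedFDeriv ℝ 2 φ x ![a, b] := by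
    intro a b x
    rw [← SchwartzMap.iteratedLineDerivOp_eq_iteratedFDeriv]
    rfl
  ext x
  rw [key, key]
  have hs : IsSymmSndFDerivAt ℝ φ x :=
    (φ.contDiffAt 2).isSymmSndFDerivAt (by simp)
  simp only [iteratedFDeriv_two_apply]
  exact hs.eq _ _

lemma laplacian_eq_sum_e (φ : 𝓢(Euc n, S)) :
    Δ φ = ∑ k, ∂_{(e k : Euc n)} (∂_{(e k : Euc n)} φ : 𝓢(Euc n, S)) := by
  rw [SchwartzMap.laplacian_eq_sum (EuclideanSpace.basisFun (Fin n) ℝ)]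
  simp [e]

lemma lineDerivOp_laplacian (m : Euc n) (φ : 𝓢(Euc n, S)) :
    ∂_{m} (Δ φ : 𝓢(Euc n, S)) = Δ (∂_{m} φ) := by
  rw [laplacian_eq_sum_e, laplacian_eq_sum_e, LineDeriv.lineDerivOp_sum]
  refine Finset.sum_congr rfl fun k _ => ?_
  rw [lineDerivOp_comm, lineDerivOp_comm m]

lemma laplacian_clS (ρ : CliffordRep n S) (v : Euc n) (φ : 𝓢(Euc n, S)) :
    Δ (clS ρ v φ) = clS ρ v (Δ φ) := by
  simp only [laplacian_eq_sum_e, map_sum, lineDerivOp_clS]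

lemma laplacian_add' (φ ψ : 𝓢(Euc n, S)) : Δ (φ + ψ) = Δ φ + Δ ψ := by
  simp only [laplacian_eq_sum_e, LineDeriv.lineDerivOp_add, Finset.sum_add_distrib]

lemma laplacian_smul' (c : ℂ) (φ : 𝓢(Euc n, S)) : Δ (c • φ) = c • Δ φ := by
  simp only [laplacian_eq_sum_e, LineDeriv.lineDerivOp_smul, Finset.smul_sum]

/-- The Dirac operator on Schwartz fields. -/
def diracS (ρ : CliffordRep n S) (φ : 𝓢(Euc n, S)) : 𝓢(Euc n, S) :=
  ∑ k, clS ρ (e k) (∂_{(e k : Euc n)} φ)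

lemma sum_apply_schwartz {ι : Type*} (s : Finset ι) (f : ι → 𝓢(Euc n, S)) (x : Euc n) :
    (∑ i ∈ s, f i) x = ∑ i ∈ s, f i x := by
  rw [_root_.sum_apply]

lemma diracS_apply (ρ : CliffordRep n S) (φ : 𝓢(Euc n, S)) (x : Euc n) :
    diracS ρ φ x = dirac ρ φ x := by
  simp [diracS, dirac, SchwartzMap.lineDerivOp_apply_eq_fderiv]

lemma diracS_add (ρ : CliffordRep n S) (φ ψ : 𝓢(Euc n, S)) :
    diracS ρ (φ + ψ) = diracS ρ φ + diracS ρ ψ := by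
  simp [diracS, LineDeriv.lineDerivOp_add, Finset.sum_add_distrib]

lemma diracS_smul (ρ : CliffordRep n S) (c : ℂ) (φ : 𝓢(Euc n, S)) :
    diracS ρ (c • φ) = c • diracS ρ φ := by
  simp [diracS, LineDeriv.lineDerivOp_smul, Finset.smul_sum]

lemma lineDerivOp_diracS (ρ : CliffordRep n S) (m : Euc n) (φ : 𝓢(Euc n, S)) :
    ∂_{m} (diracS ρ φ) = diracS ρ (∂_{m} φ) := by
  simp only [diracS, LineDeriv.lineDerivOp_sum, lineDerivOp_clS]
  exact Finset.sum_congr rfl fun k _ => by rw [lineDerivOp_comm]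

lemma laplacian_diracS (ρ : CliffordRep n S) (φ : 𝓢(Euc n, S)) :
    Δ (diracS ρ φ) = diracS ρ (Δ φ) := by
  simp only [laplacian_eq_sum_e, lineDerivOp_diracS]
  simp only [diracS, LineDeriv.lineDerivOp_sum, map_sum]
  exact Finset.sum_comm

/-- The Dirac operator is a square root of the negative Laplacian. -/
lemma diracS_diracS (ρ : CliffordRep n S) (φ : 𝓢(Euc n, S)) :
    diracS ρ (diracS ρ φ) = -Δ φ := by
  have h1 : diracS ρ (diracS ρ φ) = ∑ j, ∑ k, clS ρ (e j) (clS ρ (e k)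
      (∂_{(e j : Euc n)} (∂_{(e k : Euc n)} φ : 𝓢(Euc n, S)))) := by
    simp only [diracS, LineDeriv.lineDerivOp_sum, lineDerivOp_clS, map_sum]
  have h2 : (2 : ℝ) • diracS ρ (diracS ρ φ) = (2 : ℝ) • (-Δ φ) := by
    rw [two_smul]
    nth_rewrite 2 [h1]
    rw [Finset.sum_comm, h1, laplacian_eq_sum_e]
    ext x
    simp only [add_apply, smul_apply, neg_apply, sum_apply_schwartz, clS_apply]
    rw [← Finset.sum_add_distrib, ← Finset.sum_neg_distrib, Finset.smul_sum]
    refine Finset.sum_congr rfl fun j _ => ?_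
    rw [← Finset.sum_add_distrib, Finset.sum_eq_single j]
    · rw [cl_cl_add_cl_cl]
      simp [e]
    · intro k _ hk
      rw [lineDerivOp_comm (e k) (e j), cl_cl_add_cl_cl]
      have : inner ℝ (e j : Euc n) (e k) = 0 := by
        rw [e, e, EuclideanSpace.inner_single_left]
        simp [hk.symm]
      simp [this]
    · simp
  exact smul_right_injective _ (two_ne_zero (α := ℝ)) h2

lemma lineDerivOp_coordS (k : Fin n) (m : Euc n) (φ : 𝓢(Euc n, S)) :
    ∂_{m} (coordS k φ) = coordS k (∂_{m} φ) + m k • φ := by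
  ext x
  rw [add_apply, coordS_apply, smul_apply, SchwartzMap.lineDerivOp_apply_eq_fderiv,
    SchwartzMap.lineDerivOp_apply_eq_fderiv]
  have h : HasFDerivAt (fun y : Euc n => y k • φ y)
      (x k • fderiv ℝ φ x + (EuclideanSpace.proj k : Euc n →L[ℝ] ℝ).smulRight (φ x)) x :=
    (EuclideanSpace.proj k : Euc n →L[ℝ] ℝ).hasFDerivAt.smul (φ.hasFDerivAt x)
  have hc : (coordS k φ : Euc n → S) = fun y => y k • φ y := funext (coordS_apply k φ)
  rw [hc, h.fderiv]
  simp

lemma coordS_diracS (ρ : CliffordRep n S) (k : Fin n) (φ : 𝓢(Euc n, S)) :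
    coordS k (diracS ρ φ) = diracS ρ (coordS k φ) - clS ρ (e k) φ := by
  rw [eq_sub_iff_add_eq]
  have hcomm : ∀ j (ψ : 𝓢(Euc n, S)), coordS k (clS ρ (e j) ψ) = clS ρ (e j) (coordS k ψ) := by
    intro j ψ
    ext x
    simp
  simp only [diracS, map_sum, hcomm, lineDerivOp_coordS, map_add, Finset.sum_add_distrib]
  congr 1
  rw [Finset.sum_eq_single k]
  · congr 1
    simp [e]
  · intro j _ hj
    simp [e, hj.symm]
  · simp

lemma laplacian_coordS (k : Fin n) (φ : 𝓢(Euc n, S)) :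
    Δ (coordS k φ) = coordS k (Δ φ) + (2 : ℂ) • ∂_{(e k : Euc n)} φ := by
  simp only [laplacian_eq_sum_e, lineDerivOp_coordS, LineDeriv.lineDerivOp_add, map_sum,
    Finset.sum_add_distrib, LineDeriv.lineDerivOp_smul, add_assoc]
  congr 1
  rw [two_smul, ← Finset.sum_add_distrib, Finset.sum_eq_single k]
  · simp [e]
  · intro j _ hj
    simp [e, hj.symm]
  · simp

/-- The second order operator `φ ↦ Δ(x_k φ) + (z + n + 1) ∂_k φ + D(e_k · φ)`, which intertwines
multiplication by `x_k` with the Riesz distributions of exponents `z` and `z + 2`. -/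
def weightedOp (ρ : CliffordRep n S) (k : Fin n) (z : ℂ) (φ : 𝓢(Euc n, S)) : 𝓢(Euc n, S) :=
  Δ (coordS k φ) + (z + n + 1) • ∂_{(e k : Euc n)} φ + diracS ρ (clS ρ (e k) φ)

/-! ### The heat semigroup on Schwartz fields -/

/-- The symbol `exp(-π² p |ξ|²)` of the heat operator `exp(p Δ / 4)`. -/
def heatSymbol (n : ℕ) (p : ℝ) (ξ : Euc n) : ℂ := (Real.exp (-(Real.pi ^ 2 * p * ‖ξ‖ ^ 2)) : ℝ)

lemma hasTemperateGrowth_exp_comp {f : Euc n → ℝ} (hf : f.HasTemperateGrowth)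
    (h0 : ∀ x, f x ≤ 0) : (fun x => Real.exp (f x)).HasTemperateGrowth := by
  have hu : UniqueDiffOn ℝ (Set.Iic (0 : ℝ)) := uniqueDiffOn_Iic 0
  refine Function.HasTemperateGrowth.comp' (g := Real.exp) (f := f) (t := Set.Iic 0) ?_ hu
    Real.contDiff_exp.contDiffOn (fun N => ⟨0, 1, zero_le_one, fun m _ x hx => ?_⟩) hf
  · rintro _ ⟨x, rfl⟩
    exact h0 x
  · rw [norm_iteratedFDerivWithin_eq_norm_iteratedDerivWithin,
      iteratedDerivWithin_eq_iteratedDeriv hu Real.contDiff_exp.contDiffAt hx,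
      iteratedDeriv_eq_iterate, Real.iter_deriv_exp]
    simpa using hx

lemma hasTemperateGrowth_heatSymbol {p : ℝ} (hp : 0 ≤ p) :
    (heatSymbol n p).HasTemperateGrowth := by
  have h1 : (fun ξ : Euc n => Real.exp (-(Real.pi ^ 2 * p * ‖ξ‖ ^ 2))).HasTemperateGrowth := by
    refine hasTemperateGrowth_exp_comp ?_ fun x => ?_
    · exact ((Function.HasTemperateGrowth.const (Real.pi ^ 2 * p)).mul
        (Function.hasTemperateGrowth_norm_sq (Euc n))).neg
    · have : 0 ≤ Real.pi ^ 2 * p * ‖x‖ ^ 2 := by positivity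
      linarith
  exact Function.Complex.hasTemperateGrowth_ofReal.comp h1

lemma norm_heatSymbol_le {p : ℝ} (hp : 0 ≤ p) (ξ : Euc n) : ‖heatSymbol n p ξ‖ ≤ 1 := by
  rw [heatSymbol, Complex.norm_real, Real.norm_eq_abs, abs_of_pos (Real.exp_pos _),
    Real.exp_le_one_iff]
  have : 0 ≤ Real.pi ^ 2 * p * ‖ξ‖ ^ 2 := by positivity
  linarith

lemma continuous_heatSymbol (p : ℝ) : Continuous (heatSymbol n p) := by
  unfold heatSymbol
  fun_prop

/-- The heat operator `exp(p Δ / 4)` on Schwartz fields. -/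
def heatS (p : ℝ) : 𝓢(Euc n, S) →L[ℂ] 𝓢(Euc n, S) :=
  SchwartzMap.fourierMultiplierCLM S (heatSymbol n p)

lemma heatS_apply {p : ℝ} (hp : 0 ≤ p) (φ : 𝓢(Euc n, S)) (x : Euc n) :
    heatS p φ x = ∫ ξ, Real.fourierChar ⟪ξ, x⟫_ℝ • (heatSymbol n p ξ • 𝓕 φ ξ) := by
  rw [heatS, SchwartzMap.fourierMultiplierCLM_apply, SchwartzMap.fourierInv_coe,
    Real.fourierInv_eq]
  refine integral_congr_ae (Eventually.of_forall fun ξ => ?_)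
  simp only [SchwartzMap.smulLeftCLM_apply_apply (hasTemperateGrowth_heatSymbol hp)]

/-- The heat kernel `(π p)^(-n/2) exp(-|y|² / p)` of `exp(p Δ / 4)`. -/
def heatKernel (p : ℝ) (y : Euc n) : ℝ :=
  (Real.pi * p) ^ (-(n : ℝ) / 2) * Real.exp (-(‖y‖ ^ 2 / p))

lemma heatKernel_nonneg {p : ℝ} (hp : 0 < p) (y : Euc n) : 0 ≤ heatKernel p y := by
  unfold heatKernel
  positivity

lemma exists_norm_heatS_le (φ : 𝓢(Euc n, S)) :
    ∃ C, 0 ≤ C ∧ ∀ p, 0 ≤ p → ∀ x, ‖heatS p φ x‖ ≤ C := by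
  refine ⟨∫ ξ, ‖𝓕 φ ξ‖, integral_nonneg fun _ => norm_nonneg _, fun p hp x => ?_⟩
  rw [heatS_apply hp]
  refine norm_integral_le_of_norm_le (𝓕 φ).integrable.norm (Eventually.of_forall fun ξ => ?_)
  rw [Circle.norm_smul, norm_smul]
  exact mul_le_of_le_one_left (norm_nonneg _) (norm_heatSymbol_le hp ξ)

lemma integrable_coord_smul (j : Fin n) (φ : 𝓢(Euc n, S)) (x : Euc n) :
    Integrable fun y : Euc n => y j • φ (x - y) := by
  have h1 : Integrable fun y => x j • φ (x - y) := (φ.integrable.comp_sub_left x).smul _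
  have h2 := (coordS j φ).integrable (μ := volume).comp_sub_left x
  refine (h1.sub h2).congr (Eventually.of_forall fun y => ?_)
  simp [sub_smul]

lemma continuous_heatKernel (p : ℝ) : Continuous (heatKernel (n := n) p) := by
  unfold heatKernel
  fun_prop

lemma heatKernel_le {p : ℝ} (hp : 0 < p) (y : Euc n) :
    heatKernel p y ≤ (Real.pi * p) ^ (-(n : ℝ) / 2) := by
  unfold heatKernel
  refine mul_le_of_le_one_right (by positivity) ?_
  rw [Real.exp_le_one_iff]
  have : 0 ≤ ‖y‖ ^ 2 / p := by positivity
  linarith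

lemma integrable_heatKernel_smul {p : ℝ} (hp : 0 < p) {g : Euc n → S} (hg : Integrable g) :
    Integrable fun y => heatKernel p y • g y := by
  refine hg.bdd_smul (𝕜 := ℝ) ((Real.pi * p) ^ (-(n : ℝ) / 2))
    (continuous_heatKernel p).aestronglyMeasurable (Eventually.of_forall fun y => ?_)
  rw [Real.norm_eq_abs, abs_of_nonneg (heatKernel_nonneg hp y)]
  exact heatKernel_le hp y

section Complete

variable [CompleteSpace S]

lemma heatS_zero (φ : 𝓢(Euc n, S)) : heatS 0 φ = φ := by
  have : heatSymbol n 0 = fun _ => (1 : ℂ) := by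
    ext ξ
    simp [heatSymbol]
  rw [heatS, this]
  simp

lemma heatS_heatS {p q : ℝ} (hp : 0 ≤ p) (hq : 0 ≤ q) (φ : 𝓢(Euc n, S)) :
    heatS p (heatS q φ) = heatS (p + q) φ := by
  rw [heatS, heatS, SchwartzMap.fourierMultiplierCLM_fourierMultiplierCLM_apply
    (hasTemperateGrowth_heatSymbol hp) (hasTemperateGrowth_heatSymbol hq), heatS]
  congr 2
  ext ξ
  simp only [heatSymbol, Pi.mul_apply]
  rw [← Complex.ofReal_mul, ← Real.exp_add]
  congr 2
  ring

lemma lineDerivOp_heatS {p : ℝ} (hp : 0 ≤ p) (m : Euc n) (φ : 𝓢(Euc n, S)) :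
    ∂_{m} (heatS p φ) = heatS p (∂_{m} φ) := by
  have hm : (fun ξ : Euc n => inner ℝ ξ m).HasTemperateGrowth := by fun_prop
  have hm' : (fun ξ : Euc n => ((inner ℝ ξ m : ℝ) : ℂ)).HasTemperateGrowth :=
    Function.Complex.hasTemperateGrowth_ofReal.comp hm
  have key : ∀ ψ : 𝓢(Euc n, S), ∂_{m} ψ = (2 * Real.pi * Complex.I : ℂ) •
      SchwartzMap.fourierMultiplierCLM S (fun ξ : Euc n => ((inner ℝ ξ m : ℝ) : ℂ)) ψ := by
    intro ψ
    rw [SchwartzMap.lineDeriv_eq_fourierMultiplierCLM]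
    congr 1
    exact (SchwartzMap.fourierMultiplierCLM_ofReal ℂ hm ψ).symm
  rw [key, key, map_smul, heatS,
    SchwartzMap.fourierMultiplierCLM_fourierMultiplierCLM_apply hm'
      (hasTemperateGrowth_heatSymbol hp),
    SchwartzMap.fourierMultiplierCLM_fourierMultiplierCLM_apply
      (hasTemperateGrowth_heatSymbol hp) hm', mul_comm (heatSymbol n p)]

lemma fourier_laplacian_apply (φ : 𝓢(Euc n, S)) (ξ : Euc n) :
    𝓕 (Δ φ) ξ = (-(4 * Real.pi ^ 2 * ‖ξ‖ ^ 2) : ℝ) • 𝓕 φ ξ := by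
  have hg' : ((‖·‖ ^ 2 : Euc n → ℝ)).HasTemperateGrowth :=
    Function.hasTemperateGrowth_norm_sq (Euc n)
  rw [SchwartzMap.laplacian_eq_fourierMultiplierCLM, SchwartzMap.fourierMultiplierCLM_apply]
  have : 𝓕 (-(2 * Real.pi) ^ 2 • 𝓕⁻ (SchwartzMap.smulLeftCLM S (‖·‖ ^ 2 : Euc n → ℝ) (𝓕 φ))) =
      -(2 * Real.pi) ^ 2 • SchwartzMap.smulLeftCLM S (‖·‖ ^ 2 : Euc n → ℝ) (𝓕 φ) := by
    rw [FourierTransform.fourier_smul, FourierTransform.fourier_fourierInv_eq]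
  rw [this, smul_apply, SchwartzMap.smulLeftCLM_apply_apply hg', smul_smul]
  congr 1
  ring

/-- The heat equation `∂_p exp(p Δ / 4) φ = (1/4) exp(p Δ / 4) Δφ`, on the Fourier side. -/
lemma hasDerivAt_heatS (φ : 𝓢(Euc n, S)) (x : Euc n) {p : ℝ} (hp : 0 < p) :
    HasDerivAt (fun q => heatS q φ x) ((1 / 4 : ℝ) • heatS p (Δ φ) x) p := by
  have hcont : ∀ q, ∀ ψ : 𝓢(Euc n, S), AEStronglyMeasurable
      (fun ξ => Real.fourierChar ⟪ξ, x⟫_ℝ • (heatSymbol n q ξ • ψ ξ)) volume := by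
    intro q ψ
    refine Continuous.aestronglyMeasurable ?_
    have h1 : Continuous fun ξ : Euc n => Real.fourierChar ⟪ξ, x⟫_ℝ :=
      Real.continuous_fourierChar.comp (by fun_prop)
    exact h1.smul ((continuous_heatSymbol q).smul ψ.continuous)
  have hint : ∀ ψ : 𝓢(Euc n, S), Integrable
      (fun ξ => Real.fourierChar ⟪ξ, x⟫_ℝ • (heatSymbol n p ξ • ψ ξ)) volume := by
    intro ψ
    refine ψ.integrable.norm.mono' (hcont p ψ) (Eventually.of_forall fun ξ => ?_)
    rw [Circle.norm_smul, norm_smul]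
    exact mul_le_of_le_one_left (norm_nonneg _) (norm_heatSymbol_le hp.le ξ)
  have hnhds : Ioi (0 : ℝ) ∈ 𝓝 p := Ioi_mem_nhds hp
  have key := (hasDerivAt_integral_of_dominated_loc_of_deriv_le (μ := (volume : Measure (Euc n)))
    (F := fun q ξ => Real.fourierChar ⟪ξ, x⟫_ℝ • (heatSymbol n q ξ • 𝓕 φ ξ))
    (F' := fun q ξ => (1 / 4 : ℝ) •
      (Real.fourierChar ⟪ξ, x⟫_ℝ • (heatSymbol n q ξ • 𝓕 (Δ φ) ξ)))
    (bound := fun ξ => ‖𝓕 (Δ φ) ξ‖) hnhds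
    (Eventually.of_forall fun q => hcont q _) (hint _) ((hcont p _).const_smul _)
    (Eventually.of_forall fun ξ q hq => ?_) (𝓕 (Δ φ)).integrable.norm
    (Eventually.of_forall fun ξ q hq => ?_)).2
  · rw [integral_smul] at key
    rw [heatS_apply hp.le]
    refine key.congr_of_eventuallyEq ?_
    filter_upwards [hnhds] with q hq
    exact heatS_apply (le_of_lt hq) φ x
  · rw [norm_smul, Circle.norm_smul, norm_smul]
    have h1 := norm_heatSymbol_le (n := n) (le_of_lt (show 0 < q from hq)) ξ
    have h2 := mul_le_of_le_one_left (norm_nonneg (𝓕 (Δ φ) ξ)) h1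
    have h3 : ‖(1 / 4 : ℝ)‖ ≤ 1 := by norm_num
    exact (mul_le_of_le_one_left (by positivity) h3).trans h2
  · have h1 : HasDerivAt (fun q : ℝ => heatSymbol n q ξ)
        ((Real.exp (-(Real.pi ^ 2 * q * ‖ξ‖ ^ 2)) * (-(Real.pi ^ 2 * 1 * ‖ξ‖ ^ 2)) : ℝ) : ℂ) q := by
      refine HasDerivAt.ofReal_comp ?_
      exact (((hasDerivAt_id q).const_mul _).mul_const _).neg.exp
    have h2 := (h1.smul_const (𝓕 φ ξ)).const_smul (Real.fourierChar ⟪ξ, x⟫_ℝ)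
    convert! h2 using 1
    rw [smul_comm]
    congr 1
    rw [fourier_laplacian_apply, ← Complex.coe_smul, ← Complex.coe_smul, smul_smul, smul_smul,
      heatSymbol]
    congr 1
    push_cast
    ring

lemma tendsto_heatS_zero (φ : 𝓢(Euc n, S)) (x : Euc n) :
    Tendsto (fun p => heatS p φ x) (𝓝[>] 0) (𝓝 (φ x)) := by
  have h0 : φ x = heatS 0 φ x := by rw [heatS_zero]
  rw [h0, heatS_apply le_rfl]
  have : Tendsto (fun p => ∫ ξ, Real.fourierChar ⟪ξ, x⟫_ℝ • (heatSymbol n p ξ • 𝓕 φ ξ)) (𝓝[>] 0)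
      (𝓝 (∫ ξ, Real.fourierChar ⟪ξ, x⟫_ℝ • (heatSymbol n 0 ξ • 𝓕 φ ξ))) := by
    refine tendsto_integral_filter_of_dominated_convergence (fun ξ => ‖𝓕 φ ξ‖) ?_ ?_
      (𝓕 φ).integrable.norm ?_
    · refine Eventually.of_forall fun q => Continuous.aestronglyMeasurable ?_
      have h1 : Continuous fun ξ : Euc n => Real.fourierChar ⟪ξ, x⟫_ℝ :=
        Real.continuous_fourierChar.comp (by fun_prop)
      exact h1.smul ((continuous_heatSymbol q).smul (𝓕 φ).continuous)
    · filter_upwards [self_mem_nhdsWithin] with q hq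
      refine Eventually.of_forall fun ξ => ?_
      rw [Circle.norm_smul, norm_smul]
      exact mul_le_of_le_one_left (norm_nonneg _) (norm_heatSymbol_le (le_of_lt hq) ξ)
    · refine Eventually.of_forall fun ξ => ?_
      have hc : Continuous fun q : ℝ => Real.fourierChar ⟪ξ, x⟫_ℝ • (heatSymbol n q ξ • 𝓕 φ ξ) := by
        refine Continuous.const_smul ?_ _
        refine Continuous.smul ?_ continuous_const
        unfold heatSymbol
        fun_prop
      exact (hc.tendsto 0).mono_left nhdsWithin_le_nhds
  refine this.congr' ?_
  filter_upwards [self_mem_nhdsWithin] with q hq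
  exact (heatS_apply (le_of_lt hq) φ x).symm

/-- The heat operator is the convolution with the heat kernel. -/
lemma heatS_eq_integral {p : ℝ} (hp : 0 < p) (φ : 𝓢(Euc n, S)) (x : Euc n) :
    heatS p φ x = ∫ y, heatKernel p y • φ (x - y) := by
  have hpc : (0 : ℝ) < ((Real.pi ^ 2 * p : ℝ) : ℂ).re := by
    rw [Complex.ofReal_re]
    positivity
  -- `f` is the heat symbol times the character `ξ ↦ exp(2πi ⟨x, ξ⟩)`; its Fourier transform is the
  -- heat kernel centred at `x`, and the claim is the self-adjointness of the Fourier transform.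
  set f : Euc n → ℂ := fun v => Complex.exp (-((Real.pi ^ 2 * p : ℝ) : ℂ) * ‖v‖ ^ 2 +
    2 * Real.pi * Complex.I * ⟪x, v⟫_ℝ) with hf
  have hfi : Integrable f := by
    have := GaussianFourier.integrable_cexp_neg_mul_sq_norm_add hpc (2 * Real.pi * Complex.I) x
    exact this
  have hft : ∀ w, 𝓕 f w = ((heatKernel p (x - w) : ℝ) : ℂ) := by
    intro w
    rw [hf, fourier_gaussian_innerProductSpace' hpc]
    have hp0 : (p : ℂ) ≠ 0 := by exact_mod_cast hp.ne'
    have hpi : (Real.pi : ℂ) ≠ 0 := by exact_mod_cast Real.pi_ne_zero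
    rw [heatKernel, Complex.ofReal_mul ((Real.pi * p) ^ _), Complex.ofReal_cpow (by positivity),
      Complex.ofReal_exp,
      finrank_euclideanSpace_fin]
    congr 1
    · have : (Real.pi : ℂ) / ((Real.pi ^ 2 * p : ℝ) : ℂ) = ((Real.pi * p : ℝ) : ℂ)⁻¹ := by
        push_cast
        field_simp
      have harg : ((Real.pi * p : ℝ) : ℂ).arg ≠ Real.pi := by
        rw [Complex.arg_ofReal_of_nonneg (by positivity)]
        exact Real.pi_ne_zero.symm
      rw [this, Complex.inv_cpow _ _ harg, ← Complex.cpow_neg]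
      congr 1
      push_cast
      ring
    · congr 1
      push_cast
      field_simp
  have h1 : ∫ w, 𝓕 f w • φ w = ∫ ξ, f ξ • 𝓕 (φ : Euc n → S) ξ := by
    have := VectorFourier.integral_fourierIntegral_smul_eq_flip (μ := (volume : Measure (Euc n)))
      (ν := (volume : Measure (Euc n))) (L := innerₗ (Euc n)) Real.continuous_fourierChar
      (continuous_inner (𝕜 := ℝ)) hfi φ.integrable
    rw [flip_innerₗ] at this
    exact this
  have h2 : heatS p φ x = ∫ ξ, f ξ • 𝓕 (φ : Euc n → S) ξ := by
    rw [heatS_apply hp.le]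
    refine integral_congr_ae (Eventually.of_forall fun ξ => ?_)
    simp only [SchwartzMap.fourier_coe]
    rw [Circle.smul_def, smul_smul]
    congr 1
    rw [Real.fourierChar_apply, heatSymbol, Complex.ofReal_exp, ← Complex.exp_add, hf]
    congr 1
    rw [real_inner_comm]
    push_cast
    ring
  rw [h2, ← h1, ← integral_sub_left_eq_self _ volume x]
  refine integral_congr_ae (Eventually.of_forall fun y => ?_)
  simp only [hft, Complex.coe_smul]
  simp

lemma heatS_clS (ρ : CliffordRep n S) {p : ℝ} (hp : 0 < p) (v : Euc n) (φ : 𝓢(Euc n, S)) :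
    heatS p (clS ρ v φ) = clS ρ v (heatS p φ) := by
  ext x
  rw [heatS_eq_integral hp, clS_apply, heatS_eq_integral hp]
  have hi : Integrable fun y => heatKernel p y • φ (x - y) := by
    exact integrable_heatKernel_smul hp (φ.integrable.comp_sub_left x)
  change _ = (cl ρ v).restrictScalars ℝ _
  rw [← ((cl ρ v).restrictScalars ℝ).integral_comp_comm hi]
  refine integral_congr_ae (Eventually.of_forall fun y => ?_)
  simp

lemma heatS_diracS (ρ : CliffordRep n S) {p : ℝ} (hp : 0 < p) (φ : 𝓢(Euc n, S)) :
    heatS p (diracS ρ φ) = diracS ρ (heatS p φ) := by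
  simp only [diracS, map_sum, heatS_clS ρ hp, lineDerivOp_heatS hp.le]

/-- Integration by parts against the Gaussian: `y_j k_p = -(p/2) ∂_j k_p`. -/
lemma integral_heatKernel_coord {p : ℝ} (hp : 0 < p) (j : Fin n) (φ : 𝓢(Euc n, S)) (x : Euc n) :
    ∫ y, heatKernel p y • (y j • φ (x - y)) =
      (-(p / 2) : ℝ) • heatS p (∂_{(e j : Euc n)} φ) x := by
  have hd : ∀ y : Euc n, HasLineDerivAt ℝ (heatKernel p) ((-(2 / p) * y j) * heatKernel p y) y
      (e j) := by
    intro y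
    have h1 : HasFDerivAt (fun y : Euc n => ‖y‖ ^ 2) (2 • innerSL ℝ y) y :=
      (hasStrictFDerivAt_norm_sq y).hasFDerivAt
    have h2 : HasFDerivAt (heatKernel (n := n) p) _ y :=
      (((h1.mul_const p⁻¹).neg.exp).const_mul ((Real.pi * p) ^ (-(n : ℝ) / 2)))
    convert! h2.hasLineDerivAt (e j) using 1
    simp [heatKernel, e, div_eq_mul_inv, EuclideanSpace.inner_single_right]
    ring
  have hd2 : ∀ y : Euc n, HasLineDerivAt ℝ (fun y => φ (x - y)) (-(∂_{(e j : Euc n)} φ) (x - y)) y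
      (e j) := by
    intro y
    have h1 : HasFDerivAt (fun y => φ (x - y)) ((fderiv ℝ φ (x - y)).comp (-.id ℝ (Euc n))) y :=
      (φ.hasFDerivAt (x - y)).comp y ((hasFDerivAt_id y).const_sub x)
    convert! h1.hasLineDerivAt (e j) using 1
    simp [SchwartzMap.lineDerivOp_apply_eq_fderiv]
  have hφ := φ.integrable (μ := volume).comp_sub_left x
  have hdφ := (∂_{(e j : Euc n)} φ).integrable (μ := volume).comp_sub_left x
  have key := integral_bilinear_hasLineDerivAt_right_eq_neg_left_of_integrable
    (μ := (volume : Measure (Euc n))) (f := heatKernel p)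
    (f' := fun y => (-(2 / p) * y j) * heatKernel p y) (g := fun y => φ (x - y))
    (g' := fun y => -(∂_{(e j : Euc n)} φ) (x - y)) (v := e j)
    (B := ContinuousLinearMap.lsmul ℝ ℝ)
    (by
      refine ((integrable_heatKernel_smul hp (integrable_coord_smul j φ x)).smul
        (-(2 / p))).congr (Eventually.of_forall fun y => ?_)
      simp only [ContinuousLinearMap.lsmul_apply, smul_smul, Pi.smul_apply]
      congr 1
      ring)
    (integrable_heatKernel_smul hp hdφ.neg) (integrable_heatKernel_smul hp hφ) (fun y _ => hd y)
    (fun y _ => hd2 y)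
  simp only [ContinuousLinearMap.lsmul_apply, smul_neg, integral_neg, neg_inj] at key
  rw [heatS_eq_integral hp, key, ← integral_smul]
  refine integral_congr_ae (Eventually.of_forall fun y => ?_)
  simp only [smul_smul]
  congr 1
  field_simp

/-- Commutation of a coordinate with the heat operator. -/
lemma coord_smul_heatS {p : ℝ} (hp : 0 < p) (j : Fin n) (φ : 𝓢(Euc n, S)) (x : Euc n) :
    x j • heatS p φ x = heatS p (coordS j φ) x - (p / 2) • heatS p (∂_{(e j : Euc n)} φ) x := by
  have h := integral_heatKernel_coord hp j φ x
  rw [neg_smul] at h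
  rw [sub_eq_add_neg, ← h, heatS_eq_integral hp, heatS_eq_integral hp, ← integral_smul,
    ← integral_add (integrable_heatKernel_smul hp ((coordS j φ).integrable.comp_sub_left x))
      (integrable_heatKernel_smul hp (integrable_coord_smul j φ x))]
  refine integral_congr_ae (Eventually.of_forall fun y => ?_)
  simp only [coordS_apply, ← smul_add, ← add_smul, PiLp.sub_apply, sub_add_cancel]
  rw [smul_comm]

lemma exists_norm_heatS_le_rpow (φ : 𝓢(Euc n, S)) :
    ∃ C, 0 ≤ C ∧ ∀ p, 0 < p → ∀ x, ‖heatS p φ x‖ ≤ C * p ^ (-(n : ℝ) / 2) := by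
  refine ⟨Real.pi ^ (-(n : ℝ) / 2) * ∫ y, ‖φ y‖, by positivity, fun p hp x => ?_⟩
  rw [heatS_eq_integral hp]
  have h : ∫ y, ‖φ y‖ = ∫ y, ‖φ (x - y)‖ :=
    (integral_sub_left_eq_self (fun y => ‖φ y‖) volume x).symm
  have h2 : Real.pi ^ (-(n : ℝ) / 2) * (∫ y, ‖φ y‖) * p ^ (-(n : ℝ) / 2) =
      ∫ y, (Real.pi * p) ^ (-(n : ℝ) / 2) * ‖φ (x - y)‖ := by
    rw [integral_const_mul, Real.mul_rpow Real.pi_pos.le hp.le, h]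
    ring
  rw [h2]
  refine norm_integral_le_of_norm_le ((φ.integrable.comp_sub_left x).norm.const_mul _)
    (Eventually.of_forall fun y => ?_)
  rw [norm_smul, Real.norm_eq_abs, abs_of_nonneg (heatKernel_nonneg hp y)]
  gcongr
  exact heatKernel_le hp y

/-- First derivatives of a heat flow gain the factor `1 / p`, at the cost of linear growth
in `x`. -/
lemma exists_norm_heatS_lineDeriv_le (j : Fin n) (φ : 𝓢(Euc n, S)) :
    ∃ C, 0 ≤ C ∧ ∀ p, 0 < p → ∀ x, ‖heatS p (∂_{(e j : Euc n)} φ) x‖ ≤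
      C * (1 + ‖x‖) * p ^ (-(n : ℝ) / 2 - 1) := by
  obtain ⟨C₁, h₁, H₁⟩ := exists_norm_heatS_le_rpow φ
  obtain ⟨C₂, h₂, H₂⟩ := exists_norm_heatS_le_rpow (coordS j φ)
  refine ⟨2 * (C₁ + C₂), by positivity, fun p hp x => ?_⟩
  have h := coord_smul_heatS hp j φ x
  have h' : (p / 2) • heatS p (∂_{(e j : Euc n)} φ) x =
      heatS p (coordS j φ) x - x j • heatS p φ x := by
    rw [h]
    abel
  have h3 : heatS p (∂_{(e j : Euc n)} φ) x =
      (2 / p) • (heatS p (coordS j φ) x - x j • heatS p φ x) := by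
    rw [← h', smul_smul]
    have : 2 / p * (p / 2) = 1 := by field_simp
    rw [this, one_smul]
  rw [h3, norm_smul, Real.norm_eq_abs, abs_of_pos (by positivity)]
  have hx : |x j| ≤ ‖x‖ := PiLp.norm_apply_le x j
  have h4 : ‖heatS p (coordS j φ) x - x j • heatS p φ x‖ ≤
      (C₁ + C₂) * (1 + ‖x‖) * p ^ (-(n : ℝ) / 2) := by
    refine (norm_sub_le _ _).trans ?_
    rw [norm_smul, Real.norm_eq_abs]
    have e1 := H₂ p hp x
    have e2 : |x j| * ‖heatS p φ x‖ ≤ ‖x‖ * (C₁ * p ^ (-(n : ℝ) / 2)) :=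
      mul_le_mul hx (H₁ p hp x) (norm_nonneg _) (norm_nonneg _)
    have e3 : 0 ≤ p ^ (-(n : ℝ) / 2) := by positivity
    have e4 : 0 ≤ C₁ * p ^ (-(n : ℝ) / 2) := by positivity
    have e5 : 0 ≤ ‖x‖ * (C₂ * p ^ (-(n : ℝ) / 2)) := by positivity
    nlinarith
  have h5 : p ^ (-(n : ℝ) / 2 - 1) = p ^ (-(n : ℝ) / 2) / p := by
    rw [Real.rpow_sub_one hp.ne']
  rw [h5]
  calc _ ≤ 2 / p * ((C₁ + C₂) * (1 + ‖x‖) * p ^ (-(n : ℝ) / 2)) := by gcongr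
    _ = _ := by ring

end Complete

/-! ### Integrals against the Riesz kernel -/

lemma integrableOn_ball_norm_rpow (hn : 0 < n) {s : ℝ} (hs : -(n : ℝ) < s) :
    IntegrableOn (fun y : Euc n => ‖y‖ ^ s) (Metric.ball 0 1) := by
  have : Nonempty (Fin n) := ⟨⟨0, hn⟩⟩
  rw [integrableOn_fun_norm_addHaar volume (f := fun r : ℝ => r ^ s)]
  have h : IntegrableOn (fun r : ℝ => r ^ ((n : ℝ) - 1 + s)) (Ioo 0 1) := by
    rw [intervalIntegral.integrableOn_Ioo_rpow_iff one_pos]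
    linarith
  refine h.congr_fun (fun r hr => ?_) measurableSet_Ioo
  have hr0 : 0 < r := hr.1
  simp only [finrank_euclideanSpace_fin, smul_eq_mul]
  rw [Real.rpow_add hr0, ← Real.rpow_natCast, Nat.cast_sub hn, Nat.cast_one]

lemma one_add_rpow_le_of_one_le {r : ℝ} (hr : 1 ≤ r) (t : ℝ) :
    (1 + r) ^ t ≤ 2 ^ |t| * r ^ t := by
  have hr0 : 0 < r := by linarith
  have h1 : (1 + r) = (1 + r) / r * r := by field_simp
  have h2 : (1 + r) / r ≤ 2 := by
    rw [div_le_iff₀ hr0]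
    linarith
  have h3 : 1 ≤ (1 + r) / r := by
    rw [le_div_iff₀ hr0]
    linarith
  rw [h1, Real.mul_rpow (by positivity) hr0.le]
  gcongr
  calc ((1 + r) / r) ^ t ≤ ((1 + r) / r) ^ |t| :=
        Real.rpow_le_rpow_of_exponent_le h3 (le_abs_self t)
    _ ≤ 2 ^ |t| := Real.rpow_le_rpow (by positivity) h2 (abs_nonneg t)

lemma rpow_le_one_add_rpow_of_one_le {r : ℝ} (hr : 1 ≤ r) (t : ℝ) :
    r ^ t ≤ 2 ^ |t| * (1 + r) ^ t := by
  have hr0 : 0 < r := by linarith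
  have h := one_add_rpow_le_of_one_le hr (-t)
  rw [abs_neg, Real.rpow_neg hr0.le, Real.rpow_neg (by linarith)] at h
  have h1 : 0 < r ^ t := by positivity
  have h2 : 0 < (1 + r) ^ t := by positivity
  rw [← div_eq_mul_inv, inv_eq_one_div, div_le_div_iff₀ h2 h1] at h
  linarith

/-- Peetre's inequality. -/
lemma one_add_norm_rpow_sub_le (x y : Euc n) (t : ℝ) :
    (1 + ‖x - y‖) ^ t ≤ (1 + ‖x‖) ^ |t| * (1 + ‖y‖) ^ t := by
  rcases le_total 0 t with ht | ht
  · rw [abs_of_nonneg ht, ← Real.mul_rpow (by positivity) (by positivity)]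
    refine Real.rpow_le_rpow (by positivity) ?_ ht
    nlinarith [norm_sub_le x y, norm_nonneg x, norm_nonneg y,
      mul_nonneg (norm_nonneg x) (norm_nonneg y)]
  · rw [abs_of_nonpos ht]
    have h1 : (1 + ‖y‖) ^ (-t) ≤ (1 + ‖x‖) ^ (-t) * (1 + ‖x - y‖) ^ (-t) := by
      rw [← Real.mul_rpow (by positivity) (by positivity)]
      refine Real.rpow_le_rpow (by positivity) ?_ (by linarith)
      have : ‖y‖ ≤ ‖x‖ + ‖x - y‖ := by
        have := norm_sub_le x (x - y)
        rwa [sub_sub_cancel] at this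
      nlinarith [norm_nonneg x, norm_nonneg (x - y),
        mul_nonneg (norm_nonneg x) (norm_nonneg (x - y))]
    have hy : 0 < (1 + ‖y‖) ^ t := by positivity
    have hxy : 0 < (1 + ‖x - y‖) ^ t := by positivity
    rw [Real.rpow_neg (by positivity), Real.rpow_neg (x := 1 + ‖x - y‖) (by positivity),
      ← div_eq_mul_inv, inv_eq_one_div, div_le_div_iff₀ hy hxy] at h1
    linarith

lemma continuous_one_add_norm_rpow (t : ℝ) : Continuous fun y : Euc n => (1 + ‖y‖) ^ t := by
  refine Continuous.rpow_const (by fun_prop) fun y => Or.inl ?_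
  positivity

/-- The weight `|y|^s (1 + |y|)^t` is integrable when `s > -n` and `s + t < -n`. -/
lemma integrable_norm_rpow_mul (hn : 0 < n) {s t : ℝ} (hs : -(n : ℝ) < s) (hst : s + t < -n) :
    Integrable fun y : Euc n => ‖y‖ ^ s * (1 + ‖y‖) ^ t := by
  have hmeas : AEStronglyMeasurable (fun y : Euc n => ‖y‖ ^ s * (1 + ‖y‖) ^ t) volume := by
    refine AEStronglyMeasurable.mul ?_ (continuous_one_add_norm_rpow t).aestronglyMeasurable
    exact (measurable_norm.pow_const s).aestronglyMeasurable
  rw [← integrableOn_univ, ← union_compl_self (Metric.ball (0 : Euc n) 1)]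
  refine IntegrableOn.union ?_ ?_
  · refine Integrable.mono' (g := fun y : Euc n => 2 ^ |t| * ‖y‖ ^ s)
      ((integrableOn_ball_norm_rpow hn hs).const_mul _)
      hmeas.restrict ?_
    refine (ae_restrict_iff' measurableSet_ball).2 (Eventually.of_forall fun y hy => ?_)
    rw [Metric.mem_ball, dist_zero_right] at hy
    rw [Real.norm_of_nonneg (by positivity), mul_comm]
    gcongr
    calc (1 + ‖y‖) ^ t ≤ (1 + ‖y‖) ^ |t| :=
          Real.rpow_le_rpow_of_exponent_le (by linarith [norm_nonneg y]) (le_abs_self t)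
      _ ≤ 2 ^ |t| := Real.rpow_le_rpow (by positivity) (by linarith) (abs_nonneg t)
  · have h := integrable_one_add_norm (E := Euc n) (μ := volume) (r := -(s + t))
      (by rw [finrank_euclideanSpace_fin]; linarith)
    refine Integrable.mono' (g := fun y : Euc n => 2 ^ |s| * (1 + ‖y‖) ^ (- -(s + t)))
      (h.integrableOn.const_mul _) hmeas.restrict ?_
    refine (ae_restrict_iff' measurableSet_ball.compl).2 (Eventually.of_forall fun y hy => ?_)
    rw [mem_compl_iff, Metric.mem_ball, dist_zero_right, not_lt] at hy
    rw [Real.norm_of_nonneg (by positivity), neg_neg, Real.rpow_add (by positivity), ← mul_assoc]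
    gcongr
    exact rpow_le_one_add_rpow_of_one_le hy s

lemma rieszKernel_zero (ρ : CliffordRep n S) (z : ℂ) : rieszKernel ρ z 0 = 0 := by
  simp [rieszKernel, cl]

lemma rieszKernel_neg (ρ : CliffordRep n S) (z : ℂ) (y : Euc n) :
    rieszKernel ρ z (-y) = -rieszKernel ρ z y := by
  simp [rieszKernel, cl_neg]

lemma rieszKernel_apply (ρ : CliffordRep n S) (z : ℂ) (y : Euc n) (s : S) :
    rieszKernel ρ z y s = ((‖y‖ : ℂ) ^ (z - 1)) • cl ρ y s := rfl

lemma exists_norm_rieszKernel_le (ρ : CliffordRep n S) : ∃ C, 0 ≤ C ∧ ∀ z y (s : S),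
    ‖rieszKernel ρ z y s‖ ≤ C * (‖y‖ ^ z.re * ‖s‖) := by
  obtain ⟨C, hC, h⟩ := exists_norm_cl_le ρ
  refine ⟨C, hC, fun z y s => ?_⟩
  rcases eq_or_ne y 0 with rfl | hy
  · rw [rieszKernel_zero]
    simp only [zero_apply, norm_zero]
    positivity
  · have hy0 : 0 < ‖y‖ := norm_pos_iff.2 hy
    rw [rieszKernel_apply, norm_smul, Complex.norm_cpow_eq_rpow_re_of_pos hy0]
    have h1 : ‖y‖ ^ z.re = ‖y‖ ^ (z - 1).re * ‖y‖ := by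
      rw [← Real.rpow_add_one hy0.ne']
      simp
    calc _ ≤ ‖y‖ ^ (z - 1).re * (C * ‖y‖ * ‖s‖) := by
          gcongr
          exact (cl ρ y).le_of_opNorm_le (h y) s
      _ = _ := by rw [h1]; ring

lemma aestronglyMeasurable_cl_apply (ρ : CliffordRep n S) {μ : Measure (Euc n)} {g : Euc n → S}
    (hg : AEStronglyMeasurable g μ) : AEStronglyMeasurable (fun y => cl ρ y (g y)) μ :=
  ((continuous_fst.clm_apply continuous_snd :
    Continuous fun p : (S →L[ℂ] S) × S => p.1 p.2)).comp_aestronglyMeasurable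
    ((continuous_cl ρ).aestronglyMeasurable.prodMk hg)

lemma aestronglyMeasurable_rieszKernel (ρ : CliffordRep n S) (z : ℂ) {μ : Measure (Euc n)}
    {g : Euc n → S} (hg : AEStronglyMeasurable g μ) :
    AEStronglyMeasurable (fun y => rieszKernel ρ z y (g y)) μ := by
  have h1 : Measurable fun y : Euc n => (‖y‖ : ℂ) ^ (z - 1) :=
    (Complex.measurable_ofReal.comp measurable_norm).pow_const _
  exact h1.aestronglyMeasurable.smul (aestronglyMeasurable_cl_apply ρ hg)

lemma integrable_rieszKernel (ρ : CliffordRep n S) (z : ℂ) {μ : Measure (Euc n)}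
    {g : Euc n → S} (hg : AEStronglyMeasurable g μ)
    (hi : Integrable (fun y => ‖y‖ ^ z.re * ‖g y‖) μ) :
    Integrable (fun y => rieszKernel ρ z y (g y)) μ := by
  obtain ⟨C, hC, h⟩ := exists_norm_rieszKernel_le ρ
  exact (hi.const_mul C).mono' (aestronglyMeasurable_rieszKernel ρ z hg)
    (Eventually.of_forall fun y => h z y (g y))

/-- A locally dominated integral of holomorphic functions is holomorphic. -/
lemma differentiableAt_integral_of_dominated [CompleteSpace S] {α : Type*} [MeasurableSpace α]
    {μ : Measure α} {F : ℂ → α → S} {z₀ : ℂ} {ε : ℝ} (hε : 0 < ε) {bound : α → ℝ}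
    (hF : ∀ a, DifferentiableOn ℂ (fun z => F z a) (Metric.ball z₀ ε))
    (hm : ∀ z ∈ Metric.ball z₀ ε, AEStronglyMeasurable (F z) μ)
    (hb : ∀ a, ∀ z ∈ Metric.ball z₀ ε, ‖F z a‖ ≤ bound a) (hbi : Integrable bound μ) :
    DifferentiableAt ℂ (fun z => ∫ a, F z a ∂μ) z₀ := by
  have hz₀ : z₀ ∈ Metric.ball z₀ ε := Metric.mem_ball_self hε
  have hd : ∀ a, ∀ z ∈ Metric.ball z₀ ε, HasDerivAt (fun w => F w a) (deriv (fun w => F w a) z) z :=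
    fun a z hz => ((hF a).differentiableAt (Metric.isOpen_ball.mem_nhds hz)).hasDerivAt
  -- Cauchy's estimate bounds the derivative on the smaller ball.
  refine (hasDerivAt_integral_of_dominated_loc_of_deriv_le (μ := μ) (F := F)
    (F' := fun z a => deriv (fun w => F w a) z) (bound := fun a => bound a / (ε / 3))
    (Metric.ball_mem_nhds z₀ (half_pos hε))
    (by filter_upwards [Metric.ball_mem_nhds z₀ hε] with z hz using hm z hz)
    (hbi.mono' (hm z₀ hz₀) (Eventually.of_forall fun a => hb a z₀ hz₀)) ?_
    (Eventually.of_forall fun a z hz => ?_) (hbi.div_const _)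
    (Eventually.of_forall fun a z hz => hd a z
      (Metric.ball_subset_ball (by linarith) hz))).2.differentiableAt
  · -- the derivative is a pointwise limit of difference quotients
    set u : ℕ → ℂ := fun k => ((ε / 2 / (k + 1) : ℝ) : ℂ) with hu
    have hu0 : Tendsto u atTop (𝓝 0) := by
      have h1 : Tendsto (fun k : ℕ => ε / 2 / ((k : ℝ) + 1)) atTop (𝓝 0) :=
        tendsto_const_nhds.div_atTop (tendsto_atTop_add_const_right _ _ tendsto_natCast_atTop_atTop)
      have := (Complex.continuous_ofReal.tendsto 0).comp h1
      rw [Complex.ofReal_zero] at this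
      exact this
    have hune : ∀ k, u k ≠ 0 := fun k => by
      rw [hu]
      simp only [ne_eq, Complex.ofReal_eq_zero]
      positivity
    have hu1 : ∀ k, z₀ + u k ∈ Metric.ball z₀ ε := fun k => by
      rw [Metric.mem_ball, dist_eq_norm, add_sub_cancel_left, hu, Complex.norm_real,
        Real.norm_of_nonneg (by positivity)]
      have : ε / 2 / ((k : ℝ) + 1) ≤ ε / 2 :=
        div_le_self (by positivity) (by linarith [k.cast_nonneg (α := ℝ)])
      linarith
    refine aestronglyMeasurable_of_tendsto_ae atTop
      (f := fun k a => (u k)⁻¹ • (F (z₀ + u k) a - F z₀ a))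
      (fun k => ((hm _ (hu1 k)).sub (hm _ hz₀)).const_smul _) (Eventually.of_forall fun a => ?_)
    have h1 := (hasDerivAt_iff_tendsto_slope_zero.1 (hd a z₀ hz₀))
    refine h1.comp (tendsto_nhdsWithin_iff.2 ⟨hu0, Eventually.of_forall fun k => hune k⟩)
  · have hsub : Metric.closedBall z (ε / 3) ⊆ Metric.ball z₀ ε := by
      intro w hw
      rw [Metric.mem_closedBall] at hw
      rw [Metric.mem_ball] at hz ⊢
      have := dist_triangle w z z₀
      linarith
    refine Complex.norm_deriv_le_of_forall_mem_sphere_norm_le (by positivity) ?_ fun w hw =>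
      hb a w (hsub (Metric.sphere_subset_closedBall hw))
    refine ((hF a).mono ?_).diffContOnCl
    rw [closure_ball _ (by positivity)]
    exact hsub

/-- Integrals against the Riesz kernel are holomorphic in the exponent on the strip of
convergence. -/
lemma differentiableAt_integral_rieszKernel [CompleteSpace S] (ρ : CliffordRep n S)
    {μ : Measure (Euc n)} {g : Euc n → S} (hg : AEStronglyMeasurable g μ) {s₁ s₂ : ℝ} {z₀ : ℂ}
    (h₁ : s₁ < z₀.re) (h₂ : z₀.re < s₂) (hi₁ : Integrable (fun y => ‖y‖ ^ s₁ * ‖g y‖) μ)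
    (hi₂ : Integrable (fun y => ‖y‖ ^ s₂ * ‖g y‖) μ) :
    DifferentiableAt ℂ (fun z => ∫ y, rieszKernel ρ z y (g y) ∂μ) z₀ := by
  obtain ⟨C, hC, h⟩ := exists_norm_rieszKernel_le ρ
  refine differentiableAt_integral_of_dominated (ε := min (z₀.re - s₁) (s₂ - z₀.re))
    (bound := fun y => C * (‖y‖ ^ s₁ * ‖g y‖ + ‖y‖ ^ s₂ * ‖g y‖)) ?_ ?_ ?_ ?_ ?_
  · exact lt_min (by linarith) (by linarith)
  · intro y
    rcases eq_or_ne y 0 with rfl | hy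
    · simp only [rieszKernel_zero, zero_apply]
      exact differentiableOn_const _
    · have hy0 : (‖y‖ : ℂ) ≠ 0 := by simpa using hy
      simp only [rieszKernel_apply]
      refine DifferentiableOn.smul_const ?_ _
      exact ((differentiable_id.sub_const 1).const_cpow (Or.inl hy0)).differentiableOn
  · exact fun z _ => aestronglyMeasurable_rieszKernel ρ z hg
  · intro y z hz
    rcases eq_or_ne y 0 with rfl | hy
    · rw [rieszKernel_zero, zero_apply, norm_zero]
      positivity
    · have hy0 : 0 < ‖y‖ := norm_pos_iff.2 hy
      refine (h z y (g y)).trans ?_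
      rw [Metric.mem_ball, dist_eq_norm, lt_min_iff] at hz
      have h3 := (Complex.abs_re_le_norm (z - z₀))
      rw [Complex.sub_re, abs_le] at h3
      gcongr
      rw [← add_mul]
      gcongr
      -- `r^(Re z)` is at most `r^(s₁)` for `r ≤ 1` and at most `r^(s₂)` for `r ≥ 1`.
      rcases le_total ‖y‖ 1 with h1 | h1
      · have := Real.rpow_le_rpow_of_exponent_ge hy0 h1 (show s₁ ≤ z.re by linarith [hz.1])
        have h5 : 0 ≤ ‖y‖ ^ s₂ := by positivity
        linarith
      · have := Real.rpow_le_rpow_of_exponent_le h1 (show z.re ≤ s₂ by linarith [hz.2])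
        have h5 : 0 ≤ ‖y‖ ^ s₁ := by positivity
        linarith
  · exact (hi₁.add hi₂).const_mul C

/-! ### The symmetrized Riesz convolution -/

/-- `f` is bounded by a multiple of `(1 + |x|)^t`. -/
def HasDecay {F : Type*} [NormedAddCommGroup F] (f : Euc n → F) (t : ℝ) : Prop :=
  ∃ C, 0 ≤ C ∧ ∀ x, ‖f x‖ ≤ C * (1 + ‖x‖) ^ t

lemma HasDecay.mono {F : Type*} [NormedAddCommGroup F] {f : Euc n → F} {s t : ℝ}
    (h : HasDecay f s) (hst : s ≤ t) : HasDecay f t := by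
  obtain ⟨C, hC, h⟩ := h
  refine ⟨C, hC, fun x => (h x).trans ?_⟩
  gcongr
  linarith [norm_nonneg x]

lemma HasDecay.add {F : Type*} [NormedAddCommGroup F] {f g : Euc n → F} {t : ℝ}
    (hf : HasDecay f t) (hg : HasDecay g t) : HasDecay (fun x => f x + g x) t := by
  obtain ⟨C, hC, hf⟩ := hf
  obtain ⟨D, hD, hg⟩ := hg
  refine ⟨C + D, by positivity, fun x => (norm_add_le _ _).trans ?_⟩
  rw [add_mul]
  exact add_le_add (hf x) (hg x)

lemma HasDecay.const_smul {f : Euc n → S} {t : ℝ} (hf : HasDecay f t) (c : ℂ) :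
    HasDecay (fun x => c • f x) t := by
  obtain ⟨C, hC, hf⟩ := hf
  refine ⟨‖c‖ * C, by positivity, fun x => ?_⟩
  rw [norm_smul, mul_assoc]
  exact mul_le_mul_of_nonneg_left (hf x) (norm_nonneg c)

lemma HasDecay.coord_smul {f : Euc n → S} {t : ℝ} (hf : HasDecay f t) (j : Fin n) :
    HasDecay (fun x => x j • f x) (t + 1) := by
  obtain ⟨C, hC, hf⟩ := hf
  refine ⟨C, hC, fun x => ?_⟩
  rw [norm_smul, Real.rpow_add_one (by positivity)]
  have h1 : ‖x j‖ ≤ 1 + ‖x‖ := (PiLp.norm_apply_le x j).trans (by linarith)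
  calc _ ≤ (1 + ‖x‖) * (C * (1 + ‖x‖) ^ t) := mul_le_mul h1 (hf x) (norm_nonneg _) (by positivity)
    _ = _ := by ring

lemma hasDecay_schwartz {F : Type*} [NormedAddCommGroup F] [NormedSpace ℝ F] (φ : 𝓢(Euc n, F))
    (t : ℝ) : HasDecay φ t := by
  set k : ℕ := ⌈-t⌉₊
  have h := fun x => SchwartzMap.one_add_le_sup_seminorm_apply (𝕜 := ℝ) (m := (k, 0)) (k := k)
    (n := 0) le_rfl le_rfl φ x
  refine ⟨2 ^ k * ((Finset.Iic (k, 0)).sup fun m => SchwartzMap.seminorm ℝ m.1 m.2) φ,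
    mul_nonneg (by positivity) (apply_nonneg _ _), fun x => ?_⟩
  have h1 := h x
  rw [norm_iteratedFDeriv_zero] at h1
  have hk : -t ≤ k := Nat.le_ceil _
  have h2 : (1 + ‖x‖) ^ (-t) ≤ (1 + ‖x‖) ^ k := by
    rw [← Real.rpow_natCast]
    exact Real.rpow_le_rpow_of_exponent_le (by linarith [norm_nonneg x]) hk
  have h3 : 0 < (1 + ‖x‖) ^ t := by positivity
  rw [Real.rpow_neg (by positivity)] at h2
  have h4 := (mul_le_mul_of_nonneg_right h2 (norm_nonneg (φ x))).trans h1
  rwa [inv_mul_le_iff₀ h3, mul_comm] at h4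

/-- The odd part of `f (x - ·)` is `O(|y|)` at the origin, by the mean value inequality, and decays
like `f`; both bounds are expressed by the weight `|y| (1 + |y|)^(t-1)`. -/
lemma norm_sub_le_of_decay {F : Type*} [NormedAddCommGroup F] [NormedSpace ℝ F] {f : Euc n → F}
    (hf : Differentiable ℝ f) {t A B : ℝ} (hA0 : 0 ≤ A) (hB0 : 0 ≤ B)
    (hA : ∀ u, ‖f u‖ ≤ A * (1 + ‖u‖) ^ t)
    {x : Euc n} (hB : ∀ u ∈ Metric.closedBall x 1, ‖fderiv ℝ f u‖ ≤ B) (y : Euc n) :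
    ‖f (x - y) - f (x + y)‖ ≤ (2 * B * 2 ^ |t - 1| + 4 * A * (1 + ‖x‖) ^ |t|) *
      (‖y‖ * (1 + ‖y‖) ^ (t - 1)) := by
  have hy := norm_nonneg y
  rcases le_total ‖y‖ 1 with h1 | h1
  · have hm : ‖f (x - y) - f (x + y)‖ ≤ B * ‖(x - y) - (x + y)‖ :=
      (convex_closedBall x 1).norm_image_sub_le_of_norm_fderiv_le (fun u _ => hf u) hB
        (by simpa [Metric.mem_closedBall, dist_eq_norm] using h1)
        (by simpa [Metric.mem_closedBall, dist_eq_norm] using h1)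
    have h2 : (x - y) - (x + y) = (-2 : ℝ) • y := by module
    rw [h2, norm_smul] at hm
    have h3 : 1 ≤ 2 ^ |t - 1| * (1 + ‖y‖) ^ (t - 1) := by
      have : (2 : ℝ) ^ (-|t - 1|) ≤ (1 + ‖y‖) ^ (t - 1) := by
        calc (2 : ℝ) ^ (-|t - 1|) ≤ (1 + ‖y‖) ^ (-|t - 1|) :=
              Real.rpow_le_rpow_of_nonpos (by positivity) (by linarith) (by simp)
          _ ≤ _ := Real.rpow_le_rpow_of_exponent_le (by linarith) (neg_abs_le _)
      rw [Real.rpow_neg (by norm_num), inv_le_iff_one_le_mul₀ (by positivity)] at this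
      linarith
    have h4 : 0 ≤ 4 * A * (1 + ‖x‖) ^ |t| * (‖y‖ * (1 + ‖y‖) ^ (t - 1)) := by positivity
    have h5 : ‖(-2 : ℝ)‖ = 2 := by norm_num
    rw [h5] at hm
    have h6 : 2 * B * ‖y‖ * 1 ≤ 2 * B * ‖y‖ * (2 ^ |t - 1| * (1 + ‖y‖) ^ (t - 1)) := by gcongr
    nlinarith
  · have h2 : ‖f (x - y) - f (x + y)‖ ≤ 2 * (A * ((1 + ‖x‖) ^ |t| * (1 + ‖y‖) ^ t)) := by
      refine (norm_sub_le _ _).trans ?_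
      rw [two_mul]
      refine add_le_add ((hA _).trans ?_) ((hA _).trans ?_)
      · gcongr
        exact one_add_norm_rpow_sub_le x y t
      · gcongr
        have := one_add_norm_rpow_sub_le x (-y) t
        rwa [sub_neg_eq_add, norm_neg] at this
    have h3 : (1 + ‖y‖) ^ t ≤ 2 * (‖y‖ * (1 + ‖y‖) ^ (t - 1)) := by
      have : (1 + ‖y‖) ^ t = (1 + ‖y‖) ^ (t - 1) * (1 + ‖y‖) := by
        rw [← Real.rpow_add_one (by positivity), sub_add_cancel]
      rw [this]
      have h4 : 0 ≤ (1 + ‖y‖) ^ (t - 1) := by positivity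
      nlinarith
    have h4 : 0 ≤ 2 * B * 2 ^ |t - 1| * (‖y‖ * (1 + ‖y‖) ^ (t - 1)) := by positivity
    have h5 : 2 * (A * ((1 + ‖x‖) ^ |t| * (1 + ‖y‖) ^ t)) ≤
        2 * (A * ((1 + ‖x‖) ^ |t| * (2 * (‖y‖ * (1 + ‖y‖) ^ (t - 1))))) := by gcongr
    nlinarith

lemma norm_rpow_mul_norm_le (y : Euc n) (s : ℝ) : ‖y‖ ^ s * ‖y‖ ≤ ‖y‖ ^ (s + 1) := by
  rcases eq_or_ne y 0 with rfl | hy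
  · simp only [norm_zero, mul_zero]
    positivity
  · rw [Real.rpow_add_one (norm_pos_iff.2 hy).ne']

/-- The convolution of `|y|^(z-1) y·` with `f`, written with the odd part of `f (x - ·)` so that
it converges at the origin for `Re z > -n - 1`. -/
def symKS (ρ : CliffordRep n S) (z : ℂ) (f : Euc n → S) (x : Euc n) : S :=
  (1 / 2 : ℂ) • ∫ y, rieszKernel ρ z y (f (x - y) - f (x + y))

lemma integrable_sym {F : Type*} [NormedAddCommGroup F] [NormedSpace ℝ F] (hn : 0 < n)
    {f : Euc n → F} (hf : ContDiff ℝ 1 f) {s t : ℝ} (hd : HasDecay f t) (hs : -(n : ℝ) - 1 < s)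
    (hst : s + t < -n) (x : Euc n) :
    Integrable (fun y => ‖y‖ ^ s * ‖f (x - y) - f (x + y)‖) := by
  obtain ⟨A, hA0, hA⟩ := hd
  obtain ⟨B, hB⟩ := (isCompact_closedBall x 1).exists_bound_of_continuousOn
    (hf.continuous_fderiv (by simp)).continuousOn
  have hB' : ∀ u ∈ Metric.closedBall x 1, ‖fderiv ℝ f u‖ ≤ max B 0 := fun u hu =>
    (hB u hu).trans (le_max_left _ _)
  have hfc := hf.continuous
  have h := norm_sub_le_of_decay (hf.differentiable (by simp)) hA0 (le_max_right B 0) hA hB'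
  refine ((integrable_norm_rpow_mul hn (s := s + 1) (t := t - 1) (by linarith)
    (by linarith)).const_mul (2 * max B 0 * 2 ^ |t - 1| + 4 * A * (1 + ‖x‖) ^ |t|)).mono' ?_
    (Eventually.of_forall fun y => ?_)
  · exact ((measurable_norm.pow_const s).aestronglyMeasurable).mul
      (by fun_prop : Continuous fun y => ‖f (x - y) - f (x + y)‖).aestronglyMeasurable
  · rw [Real.norm_of_nonneg (by positivity)]
    calc _ ≤ ‖y‖ ^ s * ((2 * max B 0 * 2 ^ |t - 1| + 4 * A * (1 + ‖x‖) ^ |t|) *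
          (‖y‖ * (1 + ‖y‖) ^ (t - 1))) := by gcongr; exact h y
      _ = (2 * max B 0 * 2 ^ |t - 1| + 4 * A * (1 + ‖x‖) ^ |t|) *
          (‖y‖ ^ s * ‖y‖ * (1 + ‖y‖) ^ (t - 1)) := by ring
      _ ≤ _ := by
        gcongr
        exact norm_rpow_mul_norm_le y s

lemma continuous_sym {F : Type*} [NormedAddCommGroup F] {f : Euc n → F} (hf : Continuous f)
    (x : Euc n) : Continuous fun y => f (x - y) - f (x + y) := by
  fun_prop

lemma integrable_rieszKernel_sym (hn : 0 < n) (ρ : CliffordRep n S)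
    {f : Euc n → S} (hf : ContDiff ℝ 1 f) {z : ℂ} {t : ℝ} (hd : HasDecay f t)
    (hz : -(n : ℝ) - 1 < z.re) (hzt : z.re + t < -n) (x : Euc n) :
    Integrable (fun y => rieszKernel ρ z y (f (x - y) - f (x + y))) :=
  integrable_rieszKernel ρ z (continuous_sym hf.continuous x).aestronglyMeasurable
    (integrable_sym hn hf hd hz hzt x)

lemma differentiableAt_symKS [CompleteSpace S] (hn : 0 < n) (ρ : CliffordRep n S)
    {f : Euc n → S} (hf : ContDiff ℝ 1 f) {z : ℂ} {t : ℝ} (hd : HasDecay f t)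
    (hz : -(n : ℝ) - 1 < z.re) (hzt : z.re + t < -n) (x : Euc n) :
    DifferentiableAt ℂ (fun z => symKS ρ z f x) z := by
  obtain ⟨s₁, h1, h2⟩ := exists_between hz
  obtain ⟨s₂, h3, h4⟩ := exists_between (show z.re < -n - t by linarith)
  refine DifferentiableAt.const_smul (differentiableAt_integral_rieszKernel ρ
    (continuous_sym hf.continuous x).aestronglyMeasurable h2 h3 ?_ ?_) _
  · exact integrable_sym hn hf hd h1 (by linarith) x
  · exact integrable_sym hn hf hd (by linarith) (by linarith) x

lemma symKS_add (hn : 0 < n) (ρ : CliffordRep n S) {z : ℂ} (hz : -(n : ℝ) - 1 < z.re)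
    (φ ψ : 𝓢(Euc n, S)) (x : Euc n) :
    symKS ρ z (φ + ψ : 𝓢(Euc n, S)) x = symKS ρ z φ x + symKS ρ z ψ x := by
  have h : ∀ χ : 𝓢(Euc n, S), Integrable (fun y => rieszKernel ρ z y (χ (x - y) - χ (x + y))) :=
    fun χ => integrable_rieszKernel_sym hn ρ (χ.smooth 1) (hasDecay_schwartz χ (-n - 1 - z.re)) hz
      (by linarith) x
  rw [symKS, symKS, symKS, ← smul_add, ← integral_add (h φ) (h ψ)]
  congr 2
  ext y
  rw [← map_add]
  congr 1
  simp only [add_apply]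
  abel

lemma symKS_smul (ρ : CliffordRep n S) (z c : ℂ) (φ : 𝓢(Euc n, S)) (x : Euc n) :
    symKS ρ z (c • φ : 𝓢(Euc n, S)) x = c • symKS ρ z φ x := by
  rw [symKS, symKS, smul_comm c, ← integral_smul c]
  congr 2
  ext y
  rw [← map_smul, smul_sub]
  rfl

lemma exists_decay_sym {F : Type*} [NormedAddCommGroup F] [NormedSpace ℝ F] (φ : 𝓢(Euc n, F))
    (t : ℝ) : ∃ C, 0 ≤ C ∧ ∀ x y, ‖φ (x - y) - φ (x + y)‖ ≤
      C * (1 + ‖x‖) ^ |t| * (‖y‖ * (1 + ‖y‖) ^ (t - 1)) := by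
  obtain ⟨A, hA0, hA⟩ := hasDecay_schwartz φ t
  obtain ⟨B, hB0, hB⟩ := hasDecay_schwartz (SchwartzMap.fderivCLM ℝ (Euc n) F φ) 0
  refine ⟨2 * B * 2 ^ |t - 1| + 4 * A, by positivity, fun x y => ?_⟩
  refine (norm_sub_le_of_decay φ.differentiable hA0 hB0 hA (x := x) (fun u _ => ?_) y).trans ?_
  · simpa using hB u
  · have h1 : 1 ≤ (1 + ‖x‖) ^ |t| :=
      Real.one_le_rpow (by linarith [norm_nonneg x]) (abs_nonneg t)
    gcongr
    have : 0 ≤ 2 * B * 2 ^ |t - 1| := by positivity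
    nlinarith

/-- The symmetrized convolution commutes with derivatives of a Schwartz field. -/
lemma hasFDerivAt_symKS [CompleteSpace S] (hn : 0 < n) (ρ : CliffordRep n S) {z : ℂ}
    (hz : -(n : ℝ) - 1 < z.re) (φ : 𝓢(Euc n, S)) (x : Euc n) :
    ∃ L : Euc n →L[ℝ] S, HasFDerivAt (symKS ρ z φ) L x ∧
      ∀ v, L v = symKS ρ z (∂_{v} φ : 𝓢(Euc n, S)) x := by
  set Φ := SchwartzMap.fderivCLM ℝ (Euc n) S φ with hΦ
  obtain ⟨C, hC, hK⟩ := exists_norm_rieszKernel_le ρ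
  set t : ℝ := -n - 1 - z.re with ht
  obtain ⟨A, hA0, hA⟩ := exists_decay_sym Φ t
  have hop : ∀ y (T : Euc n →L[ℝ] S), ‖((rieszKernel ρ z y).restrictScalars ℝ).comp T‖ ≤
      C * (‖y‖ ^ z.re * ‖T‖) := by
    intro y T
    refine ContinuousLinearMap.opNorm_le_bound _ (by positivity) fun v => ?_
    calc _ ≤ C * (‖y‖ ^ z.re * ‖T v‖) := hK z y (T v)
      _ ≤ C * (‖y‖ ^ z.re * (‖T‖ * ‖v‖)) := by gcongr; exact T.le_opNorm v
      _ = _ := by ring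
  have hmeas : ∀ x', AEStronglyMeasurable (fun y =>
      ((rieszKernel ρ z y).restrictScalars ℝ).comp (Φ (x' - y) - Φ (x' + y))) volume := by
    intro x'
    have h1 : Measurable fun y : Euc n => (‖y‖ : ℂ) ^ (z - 1) :=
      (Complex.measurable_ofReal.comp measurable_norm).pow_const _
    have h2 : Continuous fun y : Euc n =>
        ((cl ρ y).restrictScalars ℝ).comp (Φ (x' - y) - Φ (x' + y)) := by
      refine Continuous.clm_comp ?_ (continuous_sym Φ.continuous x')
      exact (ContinuousLinearMap.continuous_restrictScalars ℝ).comp (continuous_cl ρ)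
    exact h1.aestronglyMeasurable.smul h2.aestronglyMeasurable
  have hbound : Integrable (fun y : Euc n => C * (A * (2 + ‖x‖) ^ |t| *
      (‖y‖ ^ (z.re + 1) * (1 + ‖y‖) ^ (t - 1)))) :=
    ((integrable_norm_rpow_mul hn (by linarith) (by linarith)).const_mul _).const_mul _
  have hle : ∀ y, ∀ x' ∈ Metric.ball x 1,
      ‖((rieszKernel ρ z y).restrictScalars ℝ).comp (Φ (x' - y) - Φ (x' + y))‖ ≤
      C * (A * (2 + ‖x‖) ^ |t| * (‖y‖ ^ (z.re + 1) * (1 + ‖y‖) ^ (t - 1))) := by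
    intro y x' hx'
    refine (hop y _).trans (mul_le_mul_of_nonneg_left ?_ hC)
    have hx2 : 1 + ‖x'‖ ≤ 2 + ‖x‖ := by
      rw [Metric.mem_ball, dist_eq_norm] at hx'
      have := norm_le_norm_add_norm_sub' x' x
      linarith
    calc _ ≤ ‖y‖ ^ z.re * (A * (2 + ‖x‖) ^ |t| * (‖y‖ * (1 + ‖y‖) ^ (t - 1))) := by
          gcongr
          refine (hA x' y).trans ?_
          gcongr
      _ = A * (2 + ‖x‖) ^ |t| * (‖y‖ ^ z.re * ‖y‖ * (1 + ‖y‖) ^ (t - 1)) := by ring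
      _ ≤ _ := by
        gcongr
        exact norm_rpow_mul_norm_le y z.re
  have hint : Integrable (fun y =>
      ((rieszKernel ρ z y).restrictScalars ℝ).comp (Φ (x - y) - Φ (x + y))) :=
    hbound.mono' (hmeas x) (Eventually.of_forall fun y => hle y x (Metric.mem_ball_self one_pos))
  have hsym : ∀ (χ : 𝓢(Euc n, S)) x',
      Integrable (fun y => rieszKernel ρ z y (χ (x' - y) - χ (x' + y))) :=
    fun χ x' => integrable_rieszKernel_sym hn ρ (χ.smooth 1)
      (hasDecay_schwartz χ (-n - 1 - z.re)) hz (by linarith) x'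
  -- Differentiation under the integral sign; `Φ` is the derivative of `φ`.
  have key := hasFDerivAt_integral_of_dominated_of_fderiv_le (μ := (volume : Measure (Euc n)))
    (F := fun x' y => rieszKernel ρ z y (φ (x' - y) - φ (x' + y)))
    (F' := fun x' y => ((rieszKernel ρ z y).restrictScalars ℝ).comp (Φ (x' - y) - Φ (x' + y)))
    (Metric.ball_mem_nhds x one_pos)
    (Eventually.of_forall fun x' => (hsym φ x').aestronglyMeasurable) (hsym φ x) (hmeas x)
    (Eventually.of_forall hle) hbound (Eventually.of_forall fun y x' _ => by
      refine ((rieszKernel ρ z y).restrictScalars ℝ).hasFDerivAt.comp x' ?_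
      have h1 : HasFDerivAt (fun x' => φ (x' - y)) (Φ (x' - y)) x' := by
        have h : HasFDerivAt (fun x' => φ (x' - y)) ((fderiv ℝ φ (x' - y)).comp (.id ℝ _)) x' :=
          (φ.hasFDerivAt (x' - y)).comp x' ((hasFDerivAt_id x').sub_const y)
        simpa [hΦ] using h
      have h2 : HasFDerivAt (fun x' => φ (x' + y)) (Φ (x' + y)) x' := by
        have h : HasFDerivAt (fun x' => φ (x' + y)) ((fderiv ℝ φ (x' + y)).comp (.id ℝ _)) x' :=
          (φ.hasFDerivAt (x' + y)).comp x' ((hasFDerivAt_id x').add_const y)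
        simpa [hΦ] using h
      exact h1.sub h2)
  refine ⟨_, key.const_smul (1 / 2 : ℂ), fun v => ?_⟩
  rw [smul_apply, ContinuousLinearMap.integral_apply hint, symKS]
  congr 2

/-- The symmetrized convolution of a Schwartz field is bounded by `(1 + |x|)^(Re z)`. -/
lemma hasDecay_symKS (hn : 0 < n) (ρ : CliffordRep n S) {z : ℂ}
    (hz : -(n : ℝ) - 1 < z.re) (φ : 𝓢(Euc n, S)) : HasDecay (symKS ρ z φ) z.re := by
  set s := z.re with hs
  obtain ⟨C, hC, hK⟩ := exists_norm_rieszKernel_le ρ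
  obtain ⟨B, hB0, hB⟩ := hasDecay_schwartz (SchwartzMap.fderivCLM ℝ (Euc n) S φ) s
  obtain ⟨D, hD0, hD⟩ := hasDecay_schwartz φ (-n - 1 - |s|)
  have hφi : Integrable fun u : Euc n => (1 + ‖u‖) ^ |s| * ‖φ u‖ := by
    have h1 := integrable_one_add_norm (E := Euc n) (μ := volume) (r := n + 1)
      (by rw [finrank_euclideanSpace_fin]; linarith)
    refine (h1.const_mul D).mono' ((continuous_one_add_norm_rpow _).mul
      φ.continuous.norm).aestronglyMeasurable (Eventually.of_forall fun u => ?_)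
    rw [Real.norm_of_nonneg (by positivity)]
    calc _ ≤ (1 + ‖u‖) ^ |s| * (D * (1 + ‖u‖) ^ (-n - 1 - |s|)) := by gcongr; exact hD u
      _ = D * ((1 + ‖u‖) ^ |s| * (1 + ‖u‖) ^ (-n - 1 - |s|)) := by ring
      _ = _ := by
        rw [← Real.rpow_add (by positivity)]
        congr 2
        ring
  set I₁ := ∫ y in Metric.ball (0 : Euc n) 1, ‖y‖ ^ (s + 1) with hI₁
  set I₂ := ∫ u : Euc n, (1 + ‖u‖) ^ |s| * ‖φ u‖ with hI₂
  have hI₁i : IntegrableOn (fun y : Euc n => ‖y‖ ^ (s + 1)) (Metric.ball 0 1) :=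
    integrableOn_ball_norm_rpow hn (by linarith)
  have hI₁0 : 0 ≤ I₁ := integral_nonneg fun y => by positivity
  have hI₂0 : 0 ≤ I₂ := integral_nonneg fun y => by positivity
  refine ⟨C * (2 * B * 2 ^ |s| * I₁ + 2 * 2 ^ |s| * I₂), by positivity, fun x => ?_⟩
  -- Each term of the bound below contains the weight `w`, pulled out by Peetre's inequality.
  set w := (1 + ‖x‖) ^ s with hw
  have hw0 : 0 ≤ w := by positivity
  -- the integrand is controlled by the derivative on the unit ball, by the values outside
  have hpt : ∀ y, ‖rieszKernel ρ z y (φ (x - y) - φ (x + y))‖ ≤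
      C * ((Metric.ball (0 : Euc n) 1).indicator (fun y => 2 * B * 2 ^ |s| * w * ‖y‖ ^ (s + 1)) y +
        (2 ^ |s| * w * ((1 + ‖x - y‖) ^ |s| * ‖φ (x - y)‖) +
          2 ^ |s| * w * ((1 + ‖x + y‖) ^ |s| * ‖φ (x + y)‖))) := by
    intro y
    refine (hK z y _).trans ?_
    gcongr
    by_cases hy : y ∈ Metric.ball (0 : Euc n) 1
    · rw [indicator_of_mem hy]
      rw [Metric.mem_ball, dist_zero_right] at hy
      have hm : ‖φ (x - y) - φ (x + y)‖ ≤ (B * (2 ^ |s| * w)) * ‖(x - y) - (x + y)‖ := by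
        refine (convex_closedBall x 1).norm_image_sub_le_of_norm_fderiv_le (𝕜 := ℝ)
          (fun u _ => φ.differentiableAt) (fun u hu => ?_)
          (by simpa [Metric.mem_closedBall, dist_eq_norm] using hy.le)
          (by simpa [Metric.mem_closedBall, dist_eq_norm] using hy.le)
        have h1 := hB u
        rw [SchwartzMap.fderivCLM_apply] at h1
        refine h1.trans ?_
        gcongr
        rw [Metric.mem_closedBall, dist_eq_norm] at hu
        have h2 := one_add_norm_rpow_sub_le (u - x) (-x) s
        rw [sub_neg_eq_add, sub_add_cancel, norm_neg] at h2
        refine h2.trans ?_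
        gcongr
        linarith
      have h2 : (x - y) - (x + y) = (-2 : ℝ) • y := by module
      have h5 : ‖(-2 : ℝ)‖ = 2 := by norm_num
      rw [h2, norm_smul, h5] at hm
      have h3 : 0 ≤ 2 ^ |s| * w * ((1 + ‖x - y‖) ^ |s| * ‖φ (x - y)‖) +
          2 ^ |s| * w * ((1 + ‖x + y‖) ^ |s| * ‖φ (x + y)‖) := by positivity
      have h4 : ‖y‖ ^ s * ‖φ (x - y) - φ (x + y)‖ ≤ 2 * B * 2 ^ |s| * w * ‖y‖ ^ (s + 1) := by
        calc _ ≤ ‖y‖ ^ s * ((B * (2 ^ |s| * w)) * (2 * ‖y‖)) := by gcongr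
          _ = 2 * B * 2 ^ |s| * w * (‖y‖ ^ s * ‖y‖) := by ring
          _ ≤ _ := by
            gcongr
            exact norm_rpow_mul_norm_le y s
      linarith
    · rw [indicator_of_notMem hy, zero_add]
      rw [Metric.mem_ball, dist_zero_right, not_lt] at hy
      have h1 := rpow_le_one_add_rpow_of_one_le hy s
      have h2 : (1 + ‖y‖) ^ s ≤ (1 + ‖x - y‖) ^ |s| * w := by
        have := one_add_norm_rpow_sub_le (x - y) x s
        rwa [sub_sub_cancel_left, norm_neg] at this
      have h3 : (1 + ‖y‖) ^ s ≤ (1 + ‖x + y‖) ^ |s| * w := by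
        have := one_add_norm_rpow_sub_le (x + y) x s
        rwa [add_sub_cancel_left] at this
      calc _ ≤ ‖y‖ ^ s * (‖φ (x - y)‖ + ‖φ (x + y)‖) := by gcongr; exact norm_sub_le _ _
        _ = ‖y‖ ^ s * ‖φ (x - y)‖ + ‖y‖ ^ s * ‖φ (x + y)‖ := by ring
        _ ≤ 2 ^ |s| * ((1 + ‖x - y‖) ^ |s| * w) * ‖φ (x - y)‖ +
            2 ^ |s| * ((1 + ‖x + y‖) ^ |s| * w) * ‖φ (x + y)‖ := by
          gcongr
          · exact h1.trans (by gcongr)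
          · exact h1.trans (by gcongr)
        _ = _ := by ring
  have hi1 : Integrable ((Metric.ball (0 : Euc n) 1).indicator
      (fun y => 2 * B * 2 ^ |s| * w * ‖y‖ ^ (s + 1))) :=
    (integrable_indicator_iff measurableSet_ball).2 (hI₁i.const_mul _)
  have hi2 : Integrable fun y => 2 ^ |s| * w * ((1 + ‖x - y‖) ^ |s| * ‖φ (x - y)‖) :=
    (hφi.comp_sub_left x).const_mul _
  have hi3 : Integrable fun y => 2 ^ |s| * w * ((1 + ‖x + y‖) ^ |s| * ‖φ (x + y)‖) :=
    (hφi.comp_add_left x).const_mul _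
  have hi23 : Integrable fun y => 2 ^ |s| * w * ((1 + ‖x - y‖) ^ |s| * ‖φ (x - y)‖) +
      2 ^ |s| * w * ((1 + ‖x + y‖) ^ |s| * ‖φ (x + y)‖) := hi2.add hi3
  have hfin := norm_integral_le_of_norm_le ((hi1.add hi23).const_mul C)
    (Eventually.of_forall hpt)
  have hval : ∫ y, C * ((Metric.ball (0 : Euc n) 1).indicator
        (fun y => 2 * B * 2 ^ |s| * w * ‖y‖ ^ (s + 1)) y +
        (2 ^ |s| * w * ((1 + ‖x - y‖) ^ |s| * ‖φ (x - y)‖) +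
          2 ^ |s| * w * ((1 + ‖x + y‖) ^ |s| * ‖φ (x + y)‖))) =
      C * (2 * B * 2 ^ |s| * I₁ + 2 * 2 ^ |s| * I₂) * w := by
    rw [integral_const_mul, integral_add hi1 hi23, integral_add hi2 hi3,
      integral_indicator measurableSet_ball, integral_const_mul, integral_const_mul,
      integral_const_mul, integral_sub_left_eq_self (fun u => (1 + ‖u‖) ^ |s| * ‖φ u‖) volume x,
      integral_add_left_eq_self (fun u => (1 + ‖u‖) ^ |s| * ‖φ u‖) x]
    ring
  rw [symKS, norm_smul]
  have hhalf : ‖(1 / 2 : ℂ)‖ ≤ 1 := by norm_num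
  refine (mul_le_of_le_one_left (norm_nonneg _) hhalf).trans ?_
  rw [← hval]
  exact hfin

/-! ### The Riesz kernel as a superposition of Gaussians -/

lemma one_div_norm_sq_cpow {r : ℝ} (hr : 0 < r) (z : ℂ) :
    (1 / ((r ^ 2 : ℝ) : ℂ)) ^ ((1 - z) / 2) = (r : ℂ) ^ (z - 1) := by
  have hr0 : (r : ℂ) ≠ 0 := by exact_mod_cast hr.ne'
  have h1 : (1 / ((r ^ 2 : ℝ) : ℂ)) = (((r ^ 2)⁻¹ : ℝ) : ℂ) := by push_cast; ring
  have h2 : (((r ^ 2)⁻¹ : ℝ) : ℂ) ≠ 0 := by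
    rw [Complex.ofReal_ne_zero]
    positivity
  rw [h1, Complex.cpow_def_of_ne_zero h2, Complex.cpow_def_of_ne_zero hr0,
    ← Complex.ofReal_log (by positivity), ← Complex.ofReal_log hr.le, Real.log_inv, Real.log_pow]
  congr 1
  push_cast
  ring

lemma integrable_gaussian_cl (ρ : CliffordRep n S) {p : ℝ} (hp : 0 < p) (φ : 𝓢(Euc n, S))
    (x : Euc n) : Integrable fun y => Real.exp (-(p⁻¹ * ‖y‖ ^ 2)) • cl ρ y (φ (x - y)) := by
  have h1 : ∀ y : Euc n, cl ρ y (φ (x - y)) =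
      ∑ j, (cl ρ (e j)).restrictScalars ℝ (y j • φ (x - y)) := by
    intro y
    rw [cl_eq_sum ρ y, sum_apply]
    simp
  have h2 : Integrable fun y : Euc n => cl ρ y (φ (x - y)) := by
    simp only [h1]
    exact integrable_finsetSum _ fun j _ =>
      ((cl ρ (e j)).restrictScalars ℝ).integrable_comp (integrable_coord_smul j φ x)
  refine h2.bdd_smul (𝕜 := ℝ) 1 (by fun_prop : Continuous fun y : Euc n =>
    Real.exp (-(p⁻¹ * ‖y‖ ^ 2))).aestronglyMeasurable (Eventually.of_forall fun y => ?_)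
  rw [Real.norm_eq_abs, abs_of_pos (Real.exp_pos _), Real.exp_le_one_iff]
  have : 0 ≤ p⁻¹ * ‖y‖ ^ 2 := by positivity
  linarith

/-- The Gaussian weight is even and `y ↦ y·` is odd, so only the odd part of `f (x - ·)` matters. -/
lemma half_integral_sym {f : Euc n → S} (ρ : CliffordRep n S) (t : ℝ) (x : Euc n)
    (hi : Integrable fun y => Real.exp (-(t * ‖y‖ ^ 2)) • cl ρ y (f (x - y))) :
    (1 / 2 : ℂ) • ∫ y, Real.exp (-(t * ‖y‖ ^ 2)) • cl ρ y (f (x - y) - f (x + y)) =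
      ∫ y, Real.exp (-(t * ‖y‖ ^ 2)) • cl ρ y (f (x - y)) := by
  have h1 : ∀ y, Real.exp (-(t * ‖y‖ ^ 2)) • cl ρ y (f (x + y)) =
      -(fun y => Real.exp (-(t * ‖y‖ ^ 2)) • cl ρ y (f (x - y))) (-y) := by
    intro y
    simp [cl_neg]
  have h2 : ∀ y, Real.exp (-(t * ‖y‖ ^ 2)) • cl ρ y (f (x - y) - f (x + y)) =
      Real.exp (-(t * ‖y‖ ^ 2)) • cl ρ y (f (x - y)) +
        (fun y => Real.exp (-(t * ‖y‖ ^ 2)) • cl ρ y (f (x - y))) (-y) := by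
    intro y
    rw [map_sub, smul_sub, h1, sub_neg_eq_add]
  simp only [h2]
  rw [integral_add hi hi.comp_neg,
    integral_neg_eq_self (fun y => Real.exp (-(t * ‖y‖ ^ 2)) • cl ρ y (f (x - y))), ← two_smul ℂ,
    smul_smul]
  norm_num

/-- The constant relating the Riesz distribution of exponent `z` to the heat semigroup. -/
def heatConst (n : ℕ) (z : ℂ) : ℂ :=
  -(1 / 2) * (Real.pi : ℂ) ^ ((n : ℂ) / 2) * (Complex.Gamma ((1 - z) / 2))⁻¹

/-- The substitution `t = 1 / p` in the Mellin transform of Gaussian moments that have the form of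
`gaussian_moment`. -/
lemma heatMellin_of_gaussian_moment {M : ℝ → S} {U : ℝ → S} {n : ℕ}
    (h : ∀ p, 0 < p → M p = (-(1 / 2) * Real.pi ^ ((n : ℝ) / 2) * p ^ ((n : ℝ) / 2 + 1) : ℝ) • U p)
    (z : ℂ) : (Complex.Gamma ((1 - z) / 2))⁻¹ • mellin (fun t => M t⁻¹) ((1 - z) / 2) =
      heatConst n z • mellin U ((z + n + 1) / 2) := by
  rw [mellin_comp_inv]
  have h1 : mellin M (-((1 - z) / 2)) = mellin (fun p : ℝ =>
      (-(1 / 2) * (Real.pi : ℂ) ^ ((n : ℂ) / 2)) • ((p : ℂ) ^ ((n : ℂ) / 2 + 1) • U p))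
      (-((1 - z) / 2)) := by
    refine setIntegral_congr_fun measurableSet_Ioi fun p hp => ?_
    have hp' : 0 < p := hp
    simp only
    rw [h p hp, smul_smul _ _ (U p), ← Complex.coe_smul]
    congr 2
    push_cast
    rw [Complex.ofReal_cpow Real.pi_pos.le, Complex.ofReal_cpow hp'.le]
    push_cast
    ring
  rw [h1, mellin_const_smul, mellin_cpow_smul, smul_smul, heatConst]
  congr 1
  · ring
  · congr 1
    ring

section Complete

variable [CompleteSpace S]

/-- For `Re z < 1` the Riesz kernel is a superposition of Gaussians, so the symmetrized convolution
is the Mellin transform of Gaussian moments. -/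
lemma symKS_eq_mellin_gaussian (ρ : CliffordRep n S) {f : Euc n → S} (hf : Continuous f) {z : ℂ}
    (hz : z.re < 1) (x : Euc n)
    (hI : Integrable fun y => ‖y‖ ^ z.re * ‖f (x - y) - f (x + y)‖) :
    symKS ρ z f x = (Complex.Gamma ((1 - z) / 2))⁻¹ • mellin (fun t => (1 / 2 : ℂ) •
      ∫ y, Real.exp (-(t * ‖y‖ ^ 2)) • cl ρ y (f (x - y) - f (x + y))) ((1 - z) / 2) := by
  set c : ℂ := (1 - z) / 2 with hc
  have hcre : c.re = (1 - z.re) / 2 := by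
    rw [hc, show (1 - z) / 2 = (1 - z) / ((2 : ℝ) : ℂ) by norm_num, Complex.div_ofReal_re]
    simp
  have hc0 : 0 < c.re := by rw [hcre]; linarith
  set g : Euc n → S := fun y => f (x - y) - f (x + y) with hg
  have hgc : Continuous g := continuous_sym hf x
  have hvc : Continuous fun y => cl ρ y (g y) := (continuous_cl ρ).clm_apply hgc
  -- The two orders of integration of `F` give the two sides, since
  -- `∫₀^∞ t^(c-1) exp(-t |y|²) dt = Γ(c) |y|^(-2c)` and `-2c = z - 1`.
  set F : ℝ × Euc n → S := fun p =>
    (p.1 : ℂ) ^ (c - 1) • (Real.exp (-(p.1 * ‖p.2‖ ^ 2)) • cl ρ p.2 (g p.2)) with hF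
  have hFm : AEStronglyMeasurable F ((volume.restrict (Ioi 0)).prod volume) := by
    refine AEStronglyMeasurable.smul ?_ ?_
    · exact ((Complex.measurable_ofReal.comp measurable_fst).pow_const _).aestronglyMeasurable
    · refine Continuous.aestronglyMeasurable ?_
      exact (by fun_prop : Continuous fun p : ℝ × Euc n => Real.exp (-(p.1 * ‖p.2‖ ^ 2))).smul
        (hvc.comp continuous_snd)
  have hnorm : ∀ y : Euc n, ∀ t ∈ Ioi (0 : ℝ), ‖F (t, y)‖ =
      t ^ (c.re - 1) * Real.exp (-(‖y‖ ^ 2 * t)) * ‖cl ρ y (g y)‖ := by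
    intro y t ht
    rw [hF]
    simp only
    rw [norm_smul, norm_smul, Complex.norm_cpow_eq_rpow_re_of_pos ht, Real.norm_eq_abs,
      abs_of_pos (Real.exp_pos _), mul_comm t, mul_assoc]
    simp
  have hexp : ∀ y : Euc n, y ≠ 0 →
      IntegrableOn (fun t : ℝ => t ^ (c.re - 1) * Real.exp (-(‖y‖ ^ 2 * t))) (Ioi 0) := by
    intro y hy
    have hy0 : 0 < ‖y‖ := norm_pos_iff.2 hy
    have := integrableOn_rpow_mul_exp_neg_mul_rpow (p := 1) (s := c.re - 1) (b := ‖y‖ ^ 2)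
      (by linarith) one_pos (by positivity)
    simpa using this
  have hFi : ∀ y, Integrable (fun t => F (t, y)) (volume.restrict (Ioi 0)) := by
    intro y
    rcases eq_or_ne y 0 with rfl | hy
    · have : (fun t => F (t, (0 : Euc n))) = fun _ => 0 := by
        ext t
        simp [hF, cl]
      rw [this]
      exact integrable_zero _ _ _
    · refine ((hexp y hy).mul_const ‖cl ρ y (g y)‖).mono' ?_ ?_
      · refine AEStronglyMeasurable.smul ?_ ?_
        · exact (Complex.measurable_ofReal.pow_const _).aestronglyMeasurable
        · exact (by fun_prop : Continuous fun t : ℝ =>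
            Real.exp (-(t * ‖y‖ ^ 2)) • cl ρ y (g y)).aestronglyMeasurable
      · exact (ae_restrict_iff' measurableSet_Ioi).2
          (Eventually.of_forall fun t ht => (hnorm y t ht).le)
  obtain ⟨C, hC, hK⟩ := exists_norm_cl_le ρ
  have hFint : Integrable F ((volume.restrict (Ioi 0)).prod volume) := by
    rw [integrable_prod_iff' hFm]
    refine ⟨Eventually.of_forall hFi, ?_⟩
    refine (hI.const_mul (Real.Gamma c.re * C)).mono'
      (hFm.norm.prod_swap.integral_prod_right') (Eventually.of_forall fun y => ?_)
    rw [Real.norm_of_nonneg (integral_nonneg fun t => norm_nonneg _)]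
    rcases eq_or_ne y 0 with rfl | hy
    · have : ∀ t, ‖F (t, (0 : Euc n))‖ = 0 := fun t => by simp [hF, cl]
      simp only [this, integral_zero]
      have := Real.Gamma_pos_of_pos hc0
      positivity
    · have hy0 : 0 < ‖y‖ := norm_pos_iff.2 hy
      rw [setIntegral_congr_fun measurableSet_Ioi (hnorm y), integral_mul_const,
        Real.integral_rpow_mul_exp_neg_mul_Ioi hc0 (by positivity)]
      have h1 : (1 / ‖y‖ ^ 2) ^ c.re = ‖y‖ ^ (z.re - 1) := by
        rw [one_div, ← Real.rpow_natCast, ← Real.rpow_neg hy0.le, ← Real.rpow_mul hy0.le, hcre]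
        congr 1
        push_cast
        ring
      have h2 : ‖y‖ ^ z.re = ‖y‖ ^ (z.re - 1) * ‖y‖ := by
        rw [← Real.rpow_add_one hy0.ne', sub_add_cancel]
      have hG := (Real.Gamma_pos_of_pos hc0).le
      rw [h1, h2]
      calc _ ≤ ‖y‖ ^ (z.re - 1) * Real.Gamma c.re * (C * ‖y‖ * ‖g y‖) := by
            gcongr
            exact (cl ρ y).le_of_opNorm_le (hK y) _
        _ = _ := by ring
  have hinner : ∀ y, ∫ t in Ioi (0 : ℝ), F (t, y) = Complex.Gamma c • rieszKernel ρ z y (g y) := by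
    intro y
    rcases eq_or_ne y 0 with rfl | hy
    · simp [hF, cl, rieszKernel_zero]
    · have hy0 : 0 < ‖y‖ := norm_pos_iff.2 hy
      have h1 : ∀ t : ℝ, F (t, y) = ((t : ℂ) ^ (c - 1) *
          Complex.exp (-(((‖y‖ ^ 2 : ℝ) : ℂ) * t))) • cl ρ y (g y) := by
        intro t
        rw [hF]
        simp only
        rw [← Complex.coe_smul, smul_smul, Complex.ofReal_exp, mul_comm t]
        push_cast
        rfl
      simp only [h1]
      rw [integral_smul_const, Complex.integral_cpow_mul_exp_neg_mul_Ioi hc0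
        (by simpa only [Complex.ofReal_re] using pow_pos hy0 2), one_div_norm_sq_cpow hy0,
        rieszKernel_apply, smul_smul, mul_comm]
  have hswap := integral_integral_swap (f := fun t y => F (t, y)) hFint
  have hG : Complex.Gamma c ≠ 0 := Complex.Gamma_ne_zero_of_re_pos hc0
  rw [mellin]
  have h2 : ∀ t : ℝ, (t : ℂ) ^ (c - 1) • ((1 / 2 : ℂ) •
      ∫ y, Real.exp (-(t * ‖y‖ ^ 2)) • cl ρ y (f (x - y) - f (x + y))) =
      (1 / 2 : ℂ) • ∫ y, F (t, y) := by
    intro t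
    rw [smul_comm, ← integral_smul]
  simp only [h2]
  rw [integral_smul, hswap]
  simp only [hinner]
  rw [integral_smul, smul_comm (1 / 2 : ℂ), smul_smul, inv_mul_cancel₀ hG, one_smul, symKS]

/-- The first Gaussian moments of a Schwartz field are heat flows of its Dirac derivative. -/
lemma gaussian_moment (ρ : CliffordRep n S) {p : ℝ} (hp : 0 < p) (φ : 𝓢(Euc n, S)) (x : Euc n) :
    ∫ y, Real.exp (-(p⁻¹ * ‖y‖ ^ 2)) • cl ρ y (φ (x - y)) =
      (-(1 / 2) * Real.pi ^ ((n : ℝ) / 2) * p ^ ((n : ℝ) / 2 + 1) : ℝ) •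
        heatS p (diracS ρ φ) x := by
  have hk : ∀ y : Euc n, Real.exp (-(p⁻¹ * ‖y‖ ^ 2)) =
      (Real.pi * p) ^ ((n : ℝ) / 2) * heatKernel p y := by
    intro y
    rw [heatKernel, ← mul_assoc, ← Real.rpow_add (by positivity)]
    have : (n : ℝ) / 2 + -n / 2 = 0 := by ring
    rw [this, Real.rpow_zero, one_mul, inv_mul_eq_div]
  have h1 : ∀ y : Euc n, Real.exp (-(p⁻¹ * ‖y‖ ^ 2)) • cl ρ y (φ (x - y)) =
      ∑ j, (Real.pi * p) ^ ((n : ℝ) / 2) • (cl ρ (e j)).restrictScalars ℝ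
        (heatKernel p y • (y j • φ (x - y))) := by
    intro y
    rw [hk, cl_eq_sum ρ y, sum_apply, Finset.smul_sum]
    refine Finset.sum_congr rfl fun j _ => ?_
    simp only [map_smul, smul_apply, mul_smul, ContinuousLinearMap.coe_restrictScalars']
  have hi : ∀ j, Integrable fun y : Euc n => heatKernel p y • (y j • φ (x - y)) := fun j =>
    integrable_heatKernel_smul hp (integrable_coord_smul j φ x)
  simp only [h1]
  rw [integral_finsetSum _ fun j _ =>
    Integrable.fun_smul ((Real.pi * p) ^ ((n : ℝ) / 2))
      (((cl ρ (e j)).restrictScalars ℝ).integrable_comp (hi j))]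
  have h2 : ∀ j, ∫ y, (Real.pi * p) ^ ((n : ℝ) / 2) • (cl ρ (e j)).restrictScalars ℝ
      (heatKernel p y • (y j • φ (x - y))) = (Real.pi * p) ^ ((n : ℝ) / 2) •
        ((-(p / 2) : ℝ) • heatS p (clS ρ (e j) (∂_{(e j : Euc n)} φ)) x) := by
    intro j
    rw [integral_smul, ContinuousLinearMap.integral_comp_comm _ (hi j),
      integral_heatKernel_coord hp, map_smul, heatS_clS ρ hp]
    rfl
  simp only [h2]
  rw [← Finset.smul_sum, ← Finset.smul_sum, smul_smul, diracS, map_sum, sum_apply_schwartz]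
  congr 1
  rw [Real.mul_rpow Real.pi_pos.le hp.le, Real.rpow_add_one hp.ne']
  ring

/-- Mellin transforms along the heat flow `p ↦ exp(p Δ / 4) φ` at a point. -/
def heatMellin (φ : 𝓢(Euc n, S)) (x : Euc n) (b : ℂ) : S := mellin (fun p => heatS p φ x) b

/-- The symmetrized convolution of a Schwartz field as a Mellin transform of the heat flow of its
Dirac derivative. -/
lemma symKS_eq_heatMellin (hn : 0 < n) (ρ : CliffordRep n S) {z : ℂ} (hz : -(n : ℝ) - 1 < z.re)
    (hz1 : z.re < 1) (φ : 𝓢(Euc n, S)) (x : Euc n) :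
    symKS ρ z φ x = heatConst n z • heatMellin (diracS ρ φ) x ((z + n + 1) / 2) := by
  rw [symKS_eq_mellin_gaussian ρ φ.continuous hz1 x (integrable_sym hn (φ.smooth 1)
    (hasDecay_schwartz φ (-n - 1 - z.re)) hz (by linarith) x), heatMellin,
    ← heatMellin_of_gaussian_moment (M := fun p => (1 / 2 : ℂ) •
      ∫ y, Real.exp (-(p⁻¹ * ‖y‖ ^ 2)) • cl ρ y (φ (x - y) - φ (x + y)))]
  · simp only [inv_inv]
  · intro p hp
    rw [half_integral_sym ρ p⁻¹ x (integrable_gaussian_cl ρ hp φ x), gaussian_moment ρ hp]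

end Complete

/-! ### Mellin transforms along the heat flow -/

/-- The heat flow of `φ` at the point `x` is `O(p ^ (-a))`. -/
def HeatDecay (φ : 𝓢(Euc n, S)) (x : Euc n) (a : ℝ) : Prop :=
  ∃ C, ∀ p, 0 < p → ‖heatS p φ x‖ ≤ C * p ^ (-a)

lemma HeatDecay.add {φ ψ : 𝓢(Euc n, S)} {x : Euc n} {a : ℝ} (h₁ : HeatDecay φ x a)
    (h₂ : HeatDecay ψ x a) : HeatDecay (φ + ψ) x a := by
  obtain ⟨C₁, h₁⟩ := h₁
  obtain ⟨C₂, h₂⟩ := h₂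
  refine ⟨C₁ + C₂, fun p hp => ?_⟩
  rw [map_add, add_apply, add_mul]
  exact (norm_add_le _ _).trans (add_le_add (h₁ p hp) (h₂ p hp))

lemma HeatDecay.smul {φ : 𝓢(Euc n, S)} {x : Euc n} {a : ℝ} (c : ℂ) (h : HeatDecay φ x a) :
    HeatDecay (c • φ) x a := by
  obtain ⟨C, h⟩ := h
  refine ⟨‖c‖ * C, fun p hp => ?_⟩
  rw [map_smul, smul_apply, norm_smul, mul_assoc]
  gcongr
  exact h p hp

lemma heatDecay_zero (x : Euc n) (a : ℝ) : HeatDecay (0 : 𝓢(Euc n, S)) x a :=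
  ⟨0, fun p _ => by simp⟩

lemma HeatDecay.sum {ι : Type*} {s : Finset ι} {f : ι → 𝓢(Euc n, S)} {x : Euc n} {a : ℝ}
    (h : ∀ i ∈ s, HeatDecay (f i) x a) : HeatDecay (∑ i ∈ s, f i) x a := by
  classical
  induction s using Finset.induction_on with
  | empty => simpa using heatDecay_zero x a
  | insert i s hi ih =>
    rw [Finset.sum_insert hi]
    exact (h i (Finset.mem_insert_self i s)).add
      (ih fun j hj => h j (Finset.mem_insert_of_mem hj))

section Complete

variable [CompleteSpace S]

lemma heatDecay_self (φ : 𝓢(Euc n, S)) (x : Euc n) : HeatDecay φ x (n / 2) := by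
  obtain ⟨C, _, h⟩ := exists_norm_heatS_le_rpow φ
  refine ⟨C, fun p hp => ?_⟩
  rw [← neg_div]
  exact h p hp x

lemma heatDecay_lineDeriv (j : Fin n) (φ : 𝓢(Euc n, S)) (x : Euc n) :
    HeatDecay (∂_{(e j : Euc n)} φ) x (n / 2 + 1) := by
  obtain ⟨C, _, h⟩ := exists_norm_heatS_lineDeriv_le j φ
  refine ⟨C * (1 + ‖x‖), fun p hp => ?_⟩
  have : -((n : ℝ) / 2 + 1) = -(n : ℝ) / 2 - 1 := by ring
  rw [this]
  exact h p hp x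

lemma heatDecay_diracS (ρ : CliffordRep n S) (φ : 𝓢(Euc n, S)) (x : Euc n) :
    HeatDecay (diracS ρ φ) x (n / 2 + 1) := by
  refine HeatDecay.sum fun j _ => ?_
  rw [← lineDerivOp_clS]
  exact heatDecay_lineDeriv j _ x

lemma heatDecay_laplacian (φ : 𝓢(Euc n, S)) (x : Euc n) :
    HeatDecay (Δ φ) x (n / 2 + 1) := by
  rw [laplacian_eq_sum_e]
  exact HeatDecay.sum fun j _ => heatDecay_lineDeriv j _ x

lemma continuousOn_heatS (φ : 𝓢(Euc n, S)) (x : Euc n) :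
    ContinuousOn (fun p => heatS p φ x) (Ioi 0) := fun _ hp =>
  (hasDerivAt_heatS φ x hp).continuousAt.continuousWithinAt

omit [CompleteSpace S] in
lemma heatDecay_isBigO_top {φ : 𝓢(Euc n, S)} {x : Euc n} {a : ℝ} (h : HeatDecay φ x a) :
    (fun p => heatS p φ x) =O[atTop] (fun p : ℝ => p ^ (-a)) := by
  obtain ⟨C, h⟩ := h
  refine Asymptotics.IsBigO.of_bound C ?_
  filter_upwards [eventually_gt_atTop 0] with p hp
  rw [Real.norm_of_nonneg (Real.rpow_nonneg hp.le _)]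
  exact h p hp

omit [CompleteSpace S] in
lemma heatS_isBigO_zero (φ : 𝓢(Euc n, S)) (x : Euc n) :
    (fun p => heatS p φ x) =O[𝓝[>] 0] (fun p : ℝ => p ^ (-(0 : ℝ))) := by
  obtain ⟨C, _, h⟩ := exists_norm_heatS_le φ
  refine Asymptotics.IsBigO.of_bound C ?_
  filter_upwards [self_mem_nhdsWithin] with p hp
  simpa using h p (le_of_lt hp) x

lemma mellinConvergent_heatS {φ : 𝓢(Euc n, S)} {x : Euc n} {a : ℝ} (h : HeatDecay φ x a) {b : ℂ}
    (h0 : 0 < b.re) (hb : b.re < a) : MellinConvergent (fun p => heatS p φ x) b :=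
  mellinConvergent_of_isBigO_rpow
    ((continuousOn_heatS φ x).locallyIntegrableOn measurableSet_Ioi)
    (heatDecay_isBigO_top h) hb (heatS_isBigO_zero φ x) h0

lemma differentiableAt_heatMellin {φ : 𝓢(Euc n, S)} {x : Euc n} {a : ℝ} (h : HeatDecay φ x a)
    {b : ℂ} (h0 : 0 < b.re) (hb : b.re < a) : DifferentiableAt ℂ (heatMellin φ x) b :=
  mellin_differentiableAt_of_isBigO_rpow
    ((continuousOn_heatS φ x).locallyIntegrableOn measurableSet_Ioi)
    (heatDecay_isBigO_top h) hb (heatS_isBigO_zero φ x) h0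

lemma heatMellin_add {φ ψ : 𝓢(Euc n, S)} {x : Euc n} {a : ℝ} (h₁ : HeatDecay φ x a)
    (h₂ : HeatDecay ψ x a) {b : ℂ} (h0 : 0 < b.re) (hb : b.re < a) :
    heatMellin (φ + ψ) x b = heatMellin φ x b + heatMellin ψ x b := by
  have := (hasMellin_add (mellinConvergent_heatS h₁ h0 hb) (mellinConvergent_heatS h₂ h0 hb)).2
  simpa [heatMellin] using this

omit [CompleteSpace S] in
lemma heatMellin_smul (c : ℂ) (φ : 𝓢(Euc n, S)) (x : Euc n) (b : ℂ) :
    heatMellin (c • φ) x b = c • heatMellin φ x b := by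
  have := mellin_const_smul (fun p => heatS p φ x) b c
  simpa [heatMellin] using this

omit [CompleteSpace S] in
lemma heatMellin_neg (φ : 𝓢(Euc n, S)) (x : Euc n) (b : ℂ) :
    heatMellin (-φ) x b = -heatMellin φ x b := by
  have := heatMellin_smul (-1) φ x b
  simpa using this

/-- Integration by parts along the heat flow. -/
lemma smul_heatMellin {φ : 𝓢(Euc n, S)} {x : Euc n} {a : ℝ} (h : HeatDecay φ x a)
    (h' : HeatDecay (Δ φ) x (a + 1)) {b : ℂ} (h0 : 0 < b.re) (hb : b.re < a) :
    b • heatMellin φ x b = (-(1 / 4) : ℂ) • heatMellin (Δ φ) x (b + 1) := by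
  have hb0 : b ≠ 0 := fun hb' => by simp [hb'] at h0
  have hm1 := mellinConvergent_heatS h h0 hb
  have hm2 := mellinConvergent_heatS h' (b := b + 1) (by simp; linarith) (by simpa using hb)
  -- The boundary terms of `f` at `0` and `∞` vanish because `0 < Re b < a`.
  set f : ℝ → S := fun p => (p : ℂ) ^ b • heatS p φ x with hf
  have hd : ∀ p ∈ Ioi (0 : ℝ), HasDerivAt f (b • ((p : ℂ) ^ (b - 1) • heatS p φ x) +
      (1 / 4 : ℂ) • ((p : ℂ) ^ (b + 1 - 1) • heatS p (Δ φ) x)) p := by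
    intro p hp
    have hp' : (0 : ℝ) < p := hp
    have h1 : HasDerivAt (fun p : ℝ => (p : ℂ) ^ b) (b * (p : ℂ) ^ (b - 1)) p :=
      hasDerivAt_ofReal_cpow_const hp'.ne' hb0
    have h2 := h1.smul (hasDerivAt_heatS φ x hp')
    refine h2.congr_deriv ?_
    rw [add_comm, add_sub_cancel_right, smul_smul, smul_smul, ← Complex.coe_smul, smul_smul]
    congr 2
    push_cast
    ring
  have hint : IntegrableOn (fun p : ℝ => b • ((p : ℂ) ^ (b - 1) • heatS p φ x) +
      (1 / 4 : ℂ) • ((p : ℂ) ^ (b + 1 - 1) • heatS p (Δ φ) x)) (Ioi 0) :=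
    (hm1.smul b).add (hm2.smul (1 / 4 : ℂ))
  have hnorm : ∀ p : ℝ, 0 < p → ‖f p‖ = p ^ b.re * ‖heatS p φ x‖ := by
    intro p hp
    rw [hf]
    simp only
    rw [norm_smul, Complex.norm_cpow_eq_rpow_re_of_pos hp]
  have hf0 : f 0 = 0 := by
    simp [hf, hb0]
  -- `f 0 = 0` since `b ≠ 0`, and `f` tends to `0` there because `Re b > 0`.
  have hcont : ContinuousWithinAt f (Ici 0) 0 := by
    rw [← continuousWithinAt_Ioi_iff_Ici, ContinuousWithinAt, hf0,
      tendsto_zero_iff_norm_tendsto_zero]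
    obtain ⟨C, _, hC⟩ := exists_norm_heatS_le φ
    have hlim : Tendsto (fun p : ℝ => p ^ b.re * C) (𝓝[>] 0) (𝓝 0) := by
      have := ((Real.continuousAt_rpow_const 0 b.re (Or.inr h0.le)).tendsto.mono_left
        (nhdsWithin_le_nhds (s := Ioi 0))).mul_const C
      simpa [Real.zero_rpow h0.ne'] using this
    refine squeeze_zero' (Eventually.of_forall fun _ => norm_nonneg _) ?_ hlim
    filter_upwards [self_mem_nhdsWithin] with p hp
    have hp' : (0 : ℝ) < p := hp
    rw [hnorm p hp']
    gcongr
    exact hC p hp'.le x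
  have htop : Tendsto f atTop (𝓝 0) := by
    rw [tendsto_zero_iff_norm_tendsto_zero]
    obtain ⟨C, hC⟩ := h
    have hlim : Tendsto (fun p : ℝ => C * p ^ (-(a - b.re))) atTop (𝓝 0) := by
      simpa using (tendsto_rpow_neg_atTop (sub_pos.2 hb)).const_mul C
    refine squeeze_zero' (Eventually.of_forall fun _ => norm_nonneg _) ?_ hlim
    filter_upwards [eventually_gt_atTop 0] with p hp
    rw [hnorm p hp]
    have : p ^ (-(a - b.re)) = p ^ b.re * p ^ (-a) := by
      rw [← Real.rpow_add hp]
      congr 1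
      ring
    rw [this]
    calc p ^ b.re * ‖heatS p φ x‖ ≤ p ^ b.re * (C * p ^ (-a)) := by
          gcongr
          exact hC p hp
      _ = _ := by ring
  have key := integral_Ioi_of_hasDerivAt_of_tendsto hcont hd hint htop
  rw [integral_add (Integrable.fun_smul b hm1) (Integrable.fun_smul (1 / 4 : ℂ) hm2),
    integral_smul, integral_smul, hf0, sub_zero] at key
  rw [neg_smul]
  exact eq_neg_of_add_eq_zero_left key

/-- Multiplication of the heat Mellin transform of a Dirac derivative by a coordinate. -/
lemma coord_smul_heatMellin (ρ : CliffordRep n S) (k : Fin n) (φ : 𝓢(Euc n, S)) (x : Euc n) {b : ℂ}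
    (h0 : 0 < b.re) (hb : b.re < (n : ℝ) / 2) :
    x k • heatMellin (diracS ρ φ) x b = heatMellin (diracS ρ (coordS k φ)) x b -
      heatMellin (clS ρ (e k) φ) x b -
        (1 / 2 : ℂ) • heatMellin (diracS ρ (∂_{(e k : Euc n)} φ)) x (b + 1) := by
  have c1 := mellinConvergent_heatS (heatDecay_self (diracS ρ (coordS k φ)) x) h0 hb
  have c2 := mellinConvergent_heatS (heatDecay_self (clS ρ (e k) φ) x) h0 hb
  have c3 := mellinConvergent_heatS (heatDecay_diracS ρ (∂_{(e k : Euc n)} φ) x) (b := b + 1)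
    (by simp; linarith) (by simpa using hb)
  have c12 : Integrable (fun p : ℝ => (p : ℂ) ^ (b - 1) • heatS p (diracS ρ (coordS k φ)) x -
      (p : ℂ) ^ (b - 1) • heatS p (clS ρ (e k) φ) x) (volume.restrict (Ioi 0)) := c1.sub c2
  have c4 := Integrable.fun_smul (1 / 2 : ℂ) c3
  simp only [heatMellin, mellin]
  rw [← integral_smul, ← integral_smul, ← integral_sub c1 c2, ← integral_sub c12 c4]
  refine setIntegral_congr_fun measurableSet_Ioi fun p hp => ?_
  have hp' : (0 : ℝ) < p := hp
  have hpc : (p : ℂ) ≠ 0 := by exact_mod_cast hp'.ne'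
  have h1 := coord_smul_heatS hp' k (diracS ρ φ) x
  rw [coordS_diracS, lineDerivOp_diracS, map_sub, sub_apply] at h1
  simp only
  rw [smul_comm (x k), h1, add_sub_cancel_right, smul_sub, smul_sub, ← Complex.coe_smul (p / 2),
    smul_smul, smul_smul]
  congr 2
  have : (p : ℂ) ^ b = (p : ℂ) ^ (b - 1) * p := by
    rw [Complex.cpow_sub _ _ hpc, Complex.cpow_one, div_mul_cancel₀ _ hpc]
  rw [this]
  push_cast
  ring

omit [CompleteSpace S] in
/-- The recursion `Γ(s + 1) = s Γ(s)` for the constants. -/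
lemma heatConst_add_two (n : ℕ) {z : ℂ} (hz : z ≠ -1) :
    (z + 1) * heatConst n z = -2 * heatConst n (z + 2) := by
  have h : (1 - z) / 2 = (1 - (z + 2)) / 2 + 1 := by ring
  have hz1 : z + 1 ≠ 0 := fun h => hz (eq_neg_of_add_eq_zero_left h)
  have h0 : (1 - (z + 2)) / 2 ≠ 0 := by
    intro h'
    apply hz1
    linear_combination (-2) * h'
  rw [heatConst, heatConst, h, Complex.Gamma_add_one _ h0, mul_inv]
  have h2 : ((1 - (z + 2)) / 2)⁻¹ * (z + 1) = -2 := by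
    rw [inv_mul_eq_iff_eq_mul₀ h0]
    ring
  linear_combination (-(1 / 2) * (Real.pi : ℂ) ^ ((n : ℂ) / 2) *
    (Complex.Gamma ((1 - (z + 2)) / 2))⁻¹) * h2

/-- Bernstein-type functional equation: the Laplacian raises the exponent of the Riesz kernel
by two. -/
lemma symKS_laplacian (hn : 0 < n) (ρ : CliffordRep n S) {z : ℂ} (hz : -(n : ℝ) - 1 < z.re)
    (hz1 : z.re < -1) (φ : 𝓢(Euc n, S)) (x : Euc n) :
    ((z + 1) * (z + 1 + n)) • symKS ρ z φ x = symKS ρ (z + 2) (Δ φ : 𝓢(Euc n, S)) x := by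
  have hre : ((z + n + 1) / 2).re = (z.re + n + 1) / 2 := by
    rw [show (z + n + 1) / 2 = (z + n + 1) / ((2 : ℝ) : ℂ) by norm_num, Complex.div_ofReal_re]
    simp
  have hzne : z ≠ -1 := fun h => by simp [h] at hz1
  rw [symKS_eq_heatMellin hn ρ hz (by linarith), symKS_eq_heatMellin hn ρ (by simp; linarith)
    (by simp; linarith)]
  have h1 := smul_heatMellin (b := (z + n + 1) / 2) (heatDecay_self (diracS ρ φ) x)
    (heatDecay_laplacian _ x) (by rw [hre]; linarith) (by rw [hre]; linarith)
  rw [laplacian_diracS] at h1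
  have h2 : (z + 2 + n + 1) / 2 = (z + n + 1) / 2 + 1 := by ring
  have h3 := heatConst_add_two n hzne
  rw [h2, smul_smul]
  calc _ = (-4 * heatConst n (z + 2)) • (((z + n + 1) / 2) •
        heatMellin (diracS ρ φ) x ((z + n + 1) / 2)) := by
        rw [smul_smul]
        congr 1
        linear_combination (z + n + 1) * h3
    _ = _ := by
        rw [h1, smul_smul]
        congr 1
        ring

/-- Multiplication by a coordinate, after the convolution with a Riesz kernel, is a convolution with
the Riesz kernel of exponent raised by two. -/
lemma coord_smul_symKS (hn : 0 < n) (ρ : CliffordRep n S) (k : Fin n) {z : ℂ}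
    (hz : -(n : ℝ) - 1 < z.re) (hz1 : z.re < -1) (φ : 𝓢(Euc n, S)) (x : Euc n) :
    ((z + 1) * (z + 1 + n)) • (x k • symKS ρ z φ x) =
      symKS ρ (z + 2) (weightedOp ρ k z φ) x := by
  have hre : ((z + n + 1) / 2).re = (z.re + n + 1) / 2 := by
    rw [show (z + n + 1) / 2 = (z + n + 1) / ((2 : ℝ) : ℂ) by norm_num, Complex.div_ofReal_re]
    simp
  have hzne : z ≠ -1 := fun h => by simp [h] at hz1
  rw [symKS_eq_heatMellin hn ρ hz (by linarith), symKS_eq_heatMellin hn ρ (by simp; linarith)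
    (by simp; linarith)]
  set b : ℂ := (z + n + 1) / 2 with hb
  have hb0 : 0 < b.re := by rw [hre]; linarith
  have hb1 : b.re < (n : ℝ) / 2 := by rw [hre]; linarith
  have hb' : (z + 2 + n + 1) / 2 = b + 1 := by rw [hb]; ring
  have h1 := smul_heatMellin (heatDecay_self (diracS ρ (coordS k φ)) x)
    (heatDecay_laplacian _ x) hb0 hb1
  have h2 := smul_heatMellin (heatDecay_self (clS ρ (e k) φ) x) (heatDecay_laplacian _ x) hb0 hb1
  have h3 := heatConst_add_two n hzne
  have h4 := coord_smul_heatMellin ρ k φ x hb0 hb1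
  rw [laplacian_diracS] at h1
  have hb2 : 0 < (b + 1).re := by simp; linarith
  have hb3 : (b + 1).re < (n : ℝ) / 2 + 1 := by simpa using hb1
  -- Here `D² = -Δ` enters, through the term `D(e_k · φ)` of `weightedOp`.
  have h5 : heatMellin (diracS ρ (weightedOp ρ k z φ)) x (b + 1) =
      heatMellin (diracS ρ (Δ (coordS k φ))) x (b + 1) +
      (z + n + 1) • heatMellin (diracS ρ (∂_{(e k : Euc n)} φ)) x (b + 1) -
      heatMellin (Δ (clS ρ (e k) φ)) x (b + 1) := by
    rw [weightedOp, diracS_add, diracS_add, diracS_smul, diracS_diracS, heatMellin_add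
      ((heatDecay_diracS ρ _ x).add ((heatDecay_diracS ρ _ x).smul _)) _ hb2 hb3, heatMellin_add
      (heatDecay_diracS ρ _ x) ((heatDecay_diracS ρ _ x).smul _) hb2 hb3, heatMellin_smul,
      heatMellin_neg, sub_eq_add_neg]
    rw [← neg_one_smul ℂ]
    exact (heatDecay_laplacian _ x).smul _
  rw [hb', h5, smul_comm (x k), h4]
  calc _ = (-2 * heatConst n (z + 2)) • ((2 : ℂ) • (b • heatMellin (diracS ρ (coordS k φ)) x b) -
        (2 : ℂ) • (b • heatMellin (clS ρ (e k) φ) x b) -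
        b • heatMellin (diracS ρ (∂_{(e k : Euc n)} φ)) x (b + 1)) := by
        rw [← h3]
        have : z + 1 + n = 2 * b := by rw [hb]; ring
        rw [this]
        module
    _ = _ := by
        rw [h1, h2]
        have : z + n + 1 = 2 * b := by rw [hb]; ring
        rw [this]
        module

end Complete

/-! ### Analytic continuation of the Riesz convolution of a Schwartz field -/

/-- Identity theorem on the half-strip `Re z ∈ D`, `σ Im z > 0`, which is convex. -/
lemma eq_of_eq_on_strip_of_im [CompleteSpace S] {F G : ℂ → S} {D : Set ℝ} (hDo : IsOpen D)
    (hDc : Convex ℝ D) {σ : ℝ} (hσ : σ ≠ 0)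
    (hF : ∀ z : ℂ, z.re ∈ D → 0 < σ * z.im → DifferentiableAt ℂ F z)
    (hG : ∀ z : ℂ, z.re ∈ D → 0 < σ * z.im → DifferentiableAt ℂ G z) {a b : ℝ} (hab : a < b)
    (hsub : Ioo a b ⊆ D) (heq : ∀ z : ℂ, z.re ∈ Ioo a b → 0 < σ * z.im → F z = G z) {z : ℂ}
    (hz : z.re ∈ D) (hz' : 0 < σ * z.im) : F z = G z := by
  set U : Set ℂ := {z | z.re ∈ D ∧ 0 < σ * z.im} with hU
  have hopen : ∀ E : Set ℝ, IsOpen E → IsOpen {z : ℂ | z.re ∈ E ∧ 0 < σ * z.im} := fun E hE =>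
    (hE.preimage Complex.continuous_re).inter
      (isOpen_lt continuous_const (continuous_const.mul Complex.continuous_im))
  have hconv : Convex ℝ U := by
    have h1 : Convex ℝ {z : ℂ | z.re ∈ D} := hDc.linear_preimage Complex.reLm
    have h2 : Convex ℝ {z : ℂ | 0 < σ * z.im} :=
      (convex_Ioi (0 : ℝ)).linear_preimage (σ • Complex.imLm)
    exact h1.inter h2
  have hFa : AnalyticOnNhd ℂ F U := DifferentiableOn.analyticOnNhd
    (fun z hz => (hF z hz.1 hz.2).differentiableWithinAt) (hopen D hDo)
  have hGa : AnalyticOnNhd ℂ G U := DifferentiableOn.analyticOnNhd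
    (fun z hz => (hG z hz.1 hz.2).differentiableWithinAt) (hopen D hDo)
  set z₀ : ℂ := ⟨(a + b) / 2, σ⟩ with hz₀
  have h₀ : z₀ ∈ {z : ℂ | z.re ∈ Ioo a b ∧ 0 < σ * z.im} :=
    ⟨⟨by simp only [hz₀]; linarith, by simp only [hz₀]; linarith⟩, mul_self_pos.2 hσ⟩
  refine hFa.eqOn_of_preconnected_of_eventuallyEq hGa hconv.isPreconnected
    (⟨hsub h₀.1, h₀.2⟩ : z₀ ∈ U) ?_ ⟨hz, hz'⟩
  filter_upwards [(hopen _ isOpen_Ioo).mem_nhds h₀] with w hw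
  exact heq w hw.1 hw.2

/-- Identity theorem on the part of the plane over an interval `D` of real parts, with real
exceptional points: it holds in the two half-planes, and on the real axis by continuity. -/
lemma eq_of_eq_on_strip [CompleteSpace S] {F G : ℂ → S} {P : Set ℂ} {D : Set ℝ} (hDo : IsOpen D)
    (hDc : Convex ℝ D) (hP : ∀ z ∈ P, z.im = 0)
    (hF : ∀ z : ℂ, z.re ∈ D → z ∉ P → DifferentiableAt ℂ F z)
    (hG : ∀ z : ℂ, z.re ∈ D → z ∉ P → DifferentiableAt ℂ G z) {a b : ℝ} (hab : a < b)
    (hsub : Ioo a b ⊆ D) (heq : ∀ z : ℂ, z.re ∈ Ioo a b → z ∉ P → F z = G z) {z : ℂ}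
    (hz : z.re ∈ D) (hzP : z ∉ P) : F z = G z := by
  have hnot : ∀ (w : ℂ) (σ : ℝ), 0 < σ * w.im → w ∉ P := fun w σ hw hwP => by
    rw [hP w hwP, mul_zero] at hw
    exact lt_irrefl _ hw
  have key : ∀ σ : ℝ, σ ≠ 0 → ∀ w : ℂ, w.re ∈ D → 0 < σ * w.im → F w = G w := fun σ hσ w hw hw' =>
    eq_of_eq_on_strip_of_im hDo hDc hσ (fun z hz hz' => hF z hz (hnot z σ hz'))
      (fun z hz hz' => hG z hz (hnot z σ hz')) hab hsub
      (fun z hz hz' => heq z hz (hnot z σ hz')) hw hw'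
  rcases eq_or_ne z.im 0 with h0 | h0
  · -- A point of the real axis is approached vertically.
    have hcont : Tendsto (fun t : ℝ => z + t * Complex.I) (𝓝[>] 0) (𝓝 z) := by
      have : Continuous fun t : ℝ => z + t * Complex.I := by fun_prop
      have h := this.tendsto 0
      simp only [Complex.ofReal_zero, zero_mul, add_zero] at h
      exact h.mono_left nhdsWithin_le_nhds
    refine tendsto_nhds_unique_of_eventuallyEq ((hF z hz hzP).continuousAt.tendsto.comp hcont)
      ((hG z hz hzP).continuousAt.tendsto.comp hcont) ?_
    filter_upwards [self_mem_nhdsWithin] with t ht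
    have ht' : (0 : ℝ) < t := ht
    exact key 1 one_ne_zero _ (by simpa using hz) (by simpa [h0] using ht')
  · exact key z.im h0 z hz (mul_self_pos.2 h0)

lemma im_eq_zero_of_mem_rieszPoles {z : ℂ} (h : z ∈ rieszPoles n) : z.im = 0 := by
  obtain ⟨k, rfl⟩ := h
  simp

lemma re_le_of_mem_rieszPoles {z : ℂ} (h : z ∈ rieszPoles n) : z.re ≤ -(n : ℝ) - 1 := by
  obtain ⟨k, rfl⟩ := h
  simp

lemma add_two_notMem_rieszPoles {z : ℂ} (h : z ∉ rieszPoles n) : z + 2 ∉ rieszPoles n := by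
  rintro ⟨k, hk⟩
  refine h ⟨k + 1, ?_⟩
  push_cast
  linear_combination hk

lemma factor_ne_zero {z : ℂ} (h : z ∉ rieszPoles n) (h1 : z ≠ -1) :
    (z + 1) * (z + 1 + n) ≠ 0 := by
  refine mul_ne_zero (fun h0 => h1 (eq_neg_of_add_eq_zero_left h0)) fun h0 => h ⟨0, ?_⟩
  push_cast
  linear_combination h0

/-- The `m`-fold continuation of `symKS` by the functional equation `symKS_laplacian`, to
`Re z > -n - 1 - 2m`. -/
def contKS (ρ : CliffordRep n S) : ℕ → ℂ → 𝓢(Euc n, S) → Euc n → S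
  | 0, z, φ, x => symKS ρ z φ x
  | m + 1, z, φ, x => if -(n : ℝ) - 1 < z.re then symKS ρ z φ x else
      ((z + 1) * (z + 1 + n))⁻¹ • contKS ρ m (z + 2) (Δ φ) x

lemma contKS_of_lt (ρ : CliffordRep n S) (m : ℕ) {z : ℂ} (hz : -(n : ℝ) - 1 < z.re)
    (φ : 𝓢(Euc n, S)) (x : Euc n) : contKS ρ m z φ x = symKS ρ z φ x := by
  cases m with
  | zero => rfl
  | succ m => rw [contKS, if_pos hz]

lemma contKS_add_two_succ (ρ : CliffordRep n S) (m : ℕ) {z : ℂ} (hz : z.re ≤ -(n : ℝ) - 1)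
    (φ : 𝓢(Euc n, S)) (x : Euc n) :
    contKS ρ (m + 1) z φ x = ((z + 1) * (z + 1 + n))⁻¹ • contKS ρ m (z + 2) (Δ φ) x := by
  rw [contKS, if_neg (not_lt.2 hz)]

/-- The continuations agree on their common domain. No functional equation is needed: `contKS`
uses it only where `symKS` does not converge. -/
lemma contKS_succ (ρ : CliffordRep n S) (m : ℕ) :
    ∀ {z : ℂ}, -(n : ℝ) - 1 - 2 * m < z.re → ∀ (φ : 𝓢(Euc n, S)) (x : Euc n),
      contKS ρ (m + 1) z φ x = contKS ρ m z φ x := by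
  induction m with
  | zero =>
    intro z hz φ x
    have hz' : -(n : ℝ) - 1 < z.re := by simpa using hz
    rw [contKS_of_lt ρ _ hz', contKS_of_lt ρ _ hz']
  | succ m ih =>
    intro z hz φ x
    rcases lt_or_ge (-(n : ℝ) - 1) z.re with h | h
    · rw [contKS_of_lt ρ _ h, contKS_of_lt ρ _ h]
    · rw [contKS_add_two_succ ρ _ h, contKS_add_two_succ ρ _ h, ih]
      push_cast at hz
      simp only [Complex.add_re, Complex.re_ofNat]
      linarith

lemma contKS_eq_of_le (ρ : CliffordRep n S) {m m' : ℕ} (hm : m ≤ m') {z : ℂ}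
    (hz : -(n : ℝ) - 1 - 2 * m < z.re) (φ : 𝓢(Euc n, S)) (x : Euc n) :
    contKS ρ m' z φ x = contKS ρ m z φ x := by
  induction m', hm using Nat.le_induction with
  | base => rfl
  | succ k hk ih =>
    have : (m : ℝ) ≤ k := by exact_mod_cast hk
    rw [contKS_succ ρ k (by linarith), ih]

/-- The meromorphic continuation of `symKS` in the exponent, for Schwartz fields. -/
def extKS (ρ : CliffordRep n S) (z : ℂ) (φ : 𝓢(Euc n, S)) (x : Euc n) : S :=
  contKS ρ ⌈-z.re⌉₊ z φ x

lemma extKS_eq_contKS (ρ : CliffordRep n S) (m : ℕ) {z : ℂ} (hz : -(n : ℝ) - 1 - 2 * m < z.re)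
    (φ : 𝓢(Euc n, S)) (x : Euc n) : extKS ρ z φ x = contKS ρ m z φ x := by
  have h : -(n : ℝ) - 1 - 2 * (⌈-z.re⌉₊ : ℝ) < z.re := by
    have h1 := Nat.le_ceil (-z.re)
    have h2 : (0 : ℝ) ≤ n := Nat.cast_nonneg n
    have h3 : (0 : ℝ) ≤ ⌈-z.re⌉₊ := Nat.cast_nonneg _
    linarith
  rw [extKS]
  rcases le_total m ⌈-z.re⌉₊ with hm | hm
  · exact contKS_eq_of_le ρ hm hz φ x
  · exact (contKS_eq_of_le ρ hm h φ x).symm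

lemma extKS_of_lt (ρ : CliffordRep n S) {z : ℂ} (hz : -(n : ℝ) - 1 < z.re)
    (φ : 𝓢(Euc n, S)) (x : Euc n) : extKS ρ z φ x = symKS ρ z φ x := by
  rw [extKS_eq_contKS ρ 0 (by simpa using hz)]
  rfl

lemma exists_nat_lt (n : ℕ) (s : ℝ) : ∃ m : ℕ, -(n : ℝ) - 1 - 2 * m < s := by
  obtain ⟨m, hm⟩ := exists_nat_gt (-s)
  have h2 : (0 : ℝ) ≤ n := Nat.cast_nonneg n
  have h3 : (0 : ℝ) ≤ m := Nat.cast_nonneg _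
  exact ⟨m, by linarith⟩

/-- Induction along the construction of the continuation: from `Re z > -n - 1` downwards in steps
of two. -/
lemma induction_off_poles {p : ℂ → Prop} (h0 : ∀ z : ℂ, -(n : ℝ) - 1 < z.re → p z)
    (h1 : ∀ z : ℂ, z.re ≤ -(n : ℝ) - 1 → z ∉ rieszPoles n → p (z + 2) → p z) {z : ℂ}
    (hz : z ∉ rieszPoles n) : p z := by
  have key : ∀ m : ℕ, ∀ z : ℂ, z ∉ rieszPoles n → -(n : ℝ) - 1 - 2 * m < z.re → p z := by
    intro m
    induction m with
    | zero => exact fun z _ h => h0 z (by simpa using h)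
    | succ m ih =>
      intro z hz h
      rcases lt_or_ge (-(n : ℝ) - 1) z.re with h' | h'
      · exact h0 z h'
      · refine h1 z h' hz (ih _ (add_two_notMem_rieszPoles hz) ?_)
        push_cast at h
        simp only [Complex.add_re, Complex.re_ofNat]
        linarith
  obtain ⟨m, hm⟩ := exists_nat_lt n z.re
  exact key m z hz hm

lemma extKS_of_le (ρ : CliffordRep n S) {z : ℂ} (hz : z.re ≤ -(n : ℝ) - 1)
    (φ : 𝓢(Euc n, S)) (x : Euc n) :
    extKS ρ z φ x = ((z + 1) * (z + 1 + n))⁻¹ • extKS ρ (z + 2) (Δ φ) x := by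
  obtain ⟨m, hm⟩ := exists_nat_lt n z.re
  rw [extKS_eq_contKS ρ (m + 1) (by push_cast; linarith), contKS_add_two_succ ρ m hz,
    extKS_eq_contKS ρ m]
  simp only [Complex.add_re, Complex.re_ofNat]
  linarith

section Complete

variable [CompleteSpace S]

/-- The recursion also holds where `symKS` converges, so that `extKS` is holomorphic across the line
`Re z = -n - 1`. -/
lemma extKS_of_re_lt (hn : 0 < n) (ρ : CliffordRep n S) {z : ℂ} (hz : z.re < -1)
    (φ : 𝓢(Euc n, S)) (x : Euc n) :
    extKS ρ z φ x = ((z + 1) * (z + 1 + n))⁻¹ • extKS ρ (z + 2) (Δ φ) x := by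
  rcases lt_or_ge (-(n : ℝ) - 1) z.re with h | h
  · have hne := factor_ne_zero (n := n) (z := z) (fun h' => by
      have := re_le_of_mem_rieszPoles h'
      linarith) (fun h' => by simp [h'] at hz)
    rw [extKS_of_lt ρ h, extKS_of_lt ρ (by simp; linarith), ← symKS_laplacian hn ρ h hz,
      inv_smul_smul₀ hne]
  · exact extKS_of_le ρ h φ x

lemma differentiableAt_extKS (hn : 0 < n) (ρ : CliffordRep n S) {z : ℂ} (hz : z ∉ rieszPoles n)
    (φ : 𝓢(Euc n, S)) (x : Euc n) : DifferentiableAt ℂ (fun z => extKS ρ z φ x) z := by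
  revert φ
  refine induction_off_poles (n := n) (p := fun z => ∀ φ : 𝓢(Euc n, S),
    DifferentiableAt ℂ (fun z => extKS ρ z φ x) z) ?_ ?_ hz
  · intro z hz φ
    have h1 : DifferentiableAt ℂ (fun z => symKS ρ z φ x) z :=
      differentiableAt_symKS hn ρ (φ.smooth 1) (hasDecay_schwartz φ (-n - 1 - z.re)) hz
        (by linarith) x
    refine h1.congr_of_eventuallyEq ?_
    filter_upwards [(isOpen_lt continuous_const Complex.continuous_re).mem_nhds hz] with w hw
    exact extKS_of_lt ρ hw φ x
  · intro z hz hzP ih φ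
    have h2 : DifferentiableAt ℂ (fun z => extKS ρ (z + 2) (Δ φ) x) z :=
      DifferentiableAt.fun_comp' z (g := fun z => extKS ρ z (Δ φ) x) (f := fun z => z + 2)
        (ih (Δ φ)) (by fun_prop)
    have hn0 : (0 : ℝ) < n := by exact_mod_cast hn
    have hz1 : z.re < -1 := by linarith
    have h3 : DifferentiableAt ℂ (fun z : ℂ => ((z + 1) * (z + 1 + n))⁻¹) z :=
      DifferentiableAt.inv (by fun_prop) (factor_ne_zero hzP fun h => by simp [h] at hz1)
    refine (h3.smul h2).congr_of_eventuallyEq ?_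
    filter_upwards [(isOpen_lt Complex.continuous_re continuous_const).mem_nhds hz1] with w hw
    exact extKS_of_re_lt hn ρ hw φ x

/-- Identity theorem for functions holomorphic off the poles. -/
lemma eq_off_poles {F G : ℂ → S} (hF : ∀ z ∉ rieszPoles n, DifferentiableAt ℂ F z)
    (hG : ∀ z ∉ rieszPoles n, DifferentiableAt ℂ G z) {a b : ℝ} (hab : a < b)
    (heq : ∀ z : ℂ, z.re ∈ Ioo a b → z ∉ rieszPoles n → F z = G z) {z : ℂ}
    (hz : z ∉ rieszPoles n) : F z = G z :=
  eq_of_eq_on_strip isOpen_univ convex_univ (fun _ h => im_eq_zero_of_mem_rieszPoles h)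
    (fun z _ h => hF z h) (fun z _ h => hG z h) hab (subset_univ _) heq (mem_univ _) hz

lemma differentiableAt_extKS_add_two (hn : 0 < n) (ρ : CliffordRep n S) {z : ℂ}
    (hz : z ∉ rieszPoles n) (φ : 𝓢(Euc n, S)) (x : Euc n) :
    DifferentiableAt ℂ (fun z => extKS ρ (z + 2) φ x) z :=
  DifferentiableAt.fun_comp' z (g := fun z => extKS ρ z φ x) (f := fun z => z + 2)
    (differentiableAt_extKS hn ρ (add_two_notMem_rieszPoles hz) φ x) (by fun_prop)

lemma extKS_laplacian (hn : 0 < n) (ρ : CliffordRep n S) {z : ℂ} (hz : z ∉ rieszPoles n)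
    (φ : 𝓢(Euc n, S)) (x : Euc n) :
    ((z + 1) * (z + 1 + n)) • extKS ρ z φ x = extKS ρ (z + 2) (Δ φ) x := by
  have hn0 : (0 : ℝ) < n := by exact_mod_cast hn
  refine eq_off_poles (F := fun z => ((z + 1) * (z + 1 + n)) • extKS ρ z φ x)
    (G := fun z => extKS ρ (z + 2) (Δ φ) x)
    (fun z hz => (by fun_prop : DifferentiableAt ℂ (fun z : ℂ => (z + 1) * (z + 1 + n)) z).smul
      (differentiableAt_extKS hn ρ hz φ x))
    (fun z hz => differentiableAt_extKS_add_two hn ρ hz (Δ φ) x)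
    (a := -n - 1) (b := -1) (by linarith) (fun z h _ => ?_) hz
  rw [extKS_of_lt ρ h.1, extKS_of_lt ρ (by simp; linarith [h.1]), symKS_laplacian hn ρ h.1 h.2]

omit [CompleteSpace S] in
lemma extKS_add (hn : 0 < n) (ρ : CliffordRep n S) {z : ℂ} (hz : z ∉ rieszPoles n)
    (φ ψ : 𝓢(Euc n, S)) (x : Euc n) : extKS ρ z (φ + ψ) x = extKS ρ z φ x + extKS ρ z ψ x := by
  revert φ ψ
  refine induction_off_poles (n := n) (p := fun z => ∀ φ ψ : 𝓢(Euc n, S),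
    extKS ρ z (φ + ψ) x = extKS ρ z φ x + extKS ρ z ψ x) ?_ ?_ hz
  · intro z hz φ ψ
    rw [extKS_of_lt ρ hz, extKS_of_lt ρ hz, extKS_of_lt ρ hz, symKS_add hn ρ hz]
  · intro z hz _ ih φ ψ
    rw [extKS_of_le ρ hz, extKS_of_le ρ hz, extKS_of_le ρ hz, laplacian_add', ih, smul_add]

omit [CompleteSpace S] in
lemma extKS_smul (ρ : CliffordRep n S) {z : ℂ} (hz : z ∉ rieszPoles n) (c : ℂ)
    (φ : 𝓢(Euc n, S)) (x : Euc n) : extKS ρ z (c • φ) x = c • extKS ρ z φ x := by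
  revert φ
  refine induction_off_poles (n := n) (p := fun z => ∀ φ : 𝓢(Euc n, S),
    extKS ρ z (c • φ) x = c • extKS ρ z φ x) ?_ ?_ hz
  · intro z hz φ
    rw [extKS_of_lt ρ hz, extKS_of_lt ρ hz, symKS_smul]
  · intro z hz _ ih φ
    rw [extKS_of_le ρ hz, extKS_of_le ρ hz, laplacian_smul', ih, smul_comm]

omit [CompleteSpace S] in
lemma extKS_weightedOp (hn : 0 < n) (ρ : CliffordRep n S) {w : ℂ} (hw : w ∉ rieszPoles n)
    (k : Fin n) (z : ℂ) (φ : 𝓢(Euc n, S)) (x : Euc n) :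
    extKS ρ w (weightedOp ρ k z φ) x = extKS ρ w (Δ (coordS k φ)) x +
      (z + n + 1) • extKS ρ w (∂_{(e k : Euc n)} φ) x + extKS ρ w (diracS ρ (clS ρ (e k) φ)) x := by
  rw [weightedOp, extKS_add hn ρ hw, extKS_add hn ρ hw, extKS_smul ρ hw]

/-- Second functional equation: the product with a coordinate is a Riesz convolution of exponent
raised by two. -/
lemma coord_smul_extKS (hn : 0 < n) (ρ : CliffordRep n S) (k : Fin n) {z : ℂ}
    (hz : z ∉ rieszPoles n) (φ : 𝓢(Euc n, S)) (x : Euc n) :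
    ((z + 1) * (z + 1 + n)) • (x k • extKS ρ z φ x) = extKS ρ (z + 2) (weightedOp ρ k z φ) x := by
  have hn0 : (0 : ℝ) < n := by exact_mod_cast hn
  rw [extKS_weightedOp hn ρ (add_two_notMem_rieszPoles hz)]
  refine eq_off_poles (F := fun z => ((z + 1) * (z + 1 + n)) • (x k • extKS ρ z φ x))
    (G := fun z => extKS ρ (z + 2) (Δ (coordS k φ)) x +
      (z + n + 1) • extKS ρ (z + 2) (∂_{(e k : Euc n)} φ) x +
      extKS ρ (z + 2) (diracS ρ (clS ρ (e k) φ)) x)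
    (fun z hz => (by fun_prop : DifferentiableAt ℂ (fun z : ℂ => (z + 1) * (z + 1 + n)) z).smul
      ((differentiableAt_extKS hn ρ hz φ x).const_smul (x k)))
    (fun z hz => ((differentiableAt_extKS_add_two hn ρ hz _ x).add
      ((by fun_prop : DifferentiableAt ℂ (fun z : ℂ => z + n + 1) z).smul
        (differentiableAt_extKS_add_two hn ρ hz _ x))).add
      (differentiableAt_extKS_add_two hn ρ hz _ x))
    (a := -n - 1) (b := -1) (by linarith) (fun z h hz => ?_) hz
  simp only
  rw [← extKS_weightedOp hn ρ (add_two_notMem_rieszPoles hz), extKS_of_lt ρ h.1,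
    extKS_of_lt ρ (by simp; linarith [h.1]), coord_smul_symKS hn ρ k h.1 h.2]

/-- The same identity with the exponent not raised: the Laplacian of `x_k` times the convolution. -/
lemma coord_smul_extKS_laplacian (hn : 0 < n) (ρ : CliffordRep n S) (k : Fin n) {z : ℂ}
    (hz : z ∉ rieszPoles n) (φ : 𝓢(Euc n, S)) (x : Euc n) :
    x k • extKS ρ z (Δ φ) x + (2 : ℂ) • extKS ρ z (∂_{(e k : Euc n)} φ) x =
      extKS ρ z (weightedOp ρ k z φ) x := by
  have hn0 : (0 : ℝ) < n := by exact_mod_cast hn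
  rw [extKS_weightedOp hn ρ hz]
  refine eq_off_poles (F := fun z => x k • extKS ρ z (Δ φ) x +
      (2 : ℂ) • extKS ρ z (∂_{(e k : Euc n)} φ) x)
    (G := fun z => extKS ρ z (Δ (coordS k φ)) x +
      (z + n + 1) • extKS ρ z (∂_{(e k : Euc n)} φ) x +
      extKS ρ z (diracS ρ (clS ρ (e k) φ)) x)
    (fun z hz => ((differentiableAt_extKS hn ρ hz _ x).const_smul (x k)).add
      ((differentiableAt_extKS hn ρ hz _ x).const_smul (2 : ℂ)))
    (fun z hz => ((differentiableAt_extKS hn ρ hz _ x).add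
      ((by fun_prop : DifferentiableAt ℂ (fun z : ℂ => z + n + 1) z).smul
        (differentiableAt_extKS hn ρ hz _ x))).add (differentiableAt_extKS hn ρ hz _ x))
    (a := -n - 1) (b := -1) (by linarith) (fun z h hz => ?_) hz
  simp only
  have hz2 := add_two_notMem_rieszPoles hz
  have hc := factor_ne_zero hz fun h' => by simp [h'] at h
  rw [← extKS_weightedOp hn ρ hz, ← smul_right_inj hc, smul_add, coord_smul_extKS hn ρ k hz,
    smul_comm _ (2 : ℂ), extKS_laplacian hn ρ hz, extKS_laplacian hn ρ hz, ← extKS_smul ρ hz2,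
    ← extKS_add hn ρ hz2]
  congr 1
  simp only [weightedOp, laplacian_add', laplacian_smul', laplacian_coordS, laplacian_diracS,
    laplacian_clS, lineDerivOp_laplacian]
  abel

lemma exists_hasFDerivAt_extKS (hn : 0 < n) (ρ : CliffordRep n S) {z : ℂ} (hz : z ∉ rieszPoles n)
    (φ : 𝓢(Euc n, S)) (x : Euc n) : ∃ L : Euc n →L[ℝ] S, HasFDerivAt (extKS ρ z φ) L x ∧
      ∀ v, L v = extKS ρ z (∂_{v} φ : 𝓢(Euc n, S)) x := by
  revert φ
  refine induction_off_poles (n := n) (p := fun z => ∀ φ : 𝓢(Euc n, S),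
    ∃ L : Euc n →L[ℝ] S, HasFDerivAt (extKS ρ z φ) L x ∧
      ∀ v, L v = extKS ρ z (∂_{v} φ : 𝓢(Euc n, S)) x) ?_ ?_ hz
  · intro z hz φ
    have h : ∀ ψ : 𝓢(Euc n, S), extKS ρ z ψ = symKS ρ z ψ := fun ψ => funext (extKS_of_lt ρ hz ψ)
    simp only [h]
    exact hasFDerivAt_symKS hn ρ hz φ x
  · intro z hz _ ih φ
    obtain ⟨L, hL, hLv⟩ := ih (Δ φ)
    have h : ∀ ψ : 𝓢(Euc n, S), extKS ρ z ψ =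
        fun x => ((z + 1) * (z + 1 + n))⁻¹ • extKS ρ (z + 2) (Δ ψ) x :=
      fun ψ => funext (extKS_of_le ρ hz ψ)
    simp only [h]
    refine ⟨((z + 1) * (z + 1 + n))⁻¹ • L, hL.const_smul _, fun v => ?_⟩
    rw [smul_apply, hLv, lineDerivOp_laplacian]

lemma fderiv_extKS (hn : 0 < n) (ρ : CliffordRep n S) {z : ℂ} (hz : z ∉ rieszPoles n)
    (φ : 𝓢(Euc n, S)) (x v : Euc n) :
    fderiv ℝ (extKS ρ z φ) x v = extKS ρ z (∂_{v} φ : 𝓢(Euc n, S)) x := by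
  obtain ⟨L, hL, hLv⟩ := exists_hasFDerivAt_extKS hn ρ hz φ x
  rw [hL.fderiv, hLv]

lemma contDiff_extKS (hn : 0 < n) (ρ : CliffordRep n S) {z : ℂ} (hz : z ∉ rieszPoles n)
    (φ : 𝓢(Euc n, S)) : ContDiff ℝ ∞ (extKS ρ z φ) := by
  rw [contDiff_infty]
  intro m
  induction m generalizing φ with
  | zero =>
    rw [Nat.cast_zero, contDiff_zero, continuous_iff_continuousAt]
    intro x
    obtain ⟨L, hL, -⟩ := exists_hasFDerivAt_extKS hn ρ hz φ x
    exact hL.continuousAt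
  | succ m ih =>
    rw [Nat.cast_add, Nat.cast_one, contDiff_succ_iff_fderiv_apply]
    refine ⟨fun x => ?_, fun h => by simp at h, fun v => ?_⟩
    · obtain ⟨L, hL, -⟩ := exists_hasFDerivAt_extKS hn ρ hz φ x
      exact hL.differentiableAt
    · have : (fun x => fderiv ℝ (extKS ρ z φ) x v) = extKS ρ z (∂_{v} φ : 𝓢(Euc n, S)) :=
        funext fun x => fderiv_extKS hn ρ hz φ x v
      rw [this]
      exact ih _

/-- The Schwartz field `|x|² φ`. -/
def normSqS (φ : 𝓢(Euc n, S)) : 𝓢(Euc n, S) := ∑ j, coordS j (coordS j φ)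

omit [CompleteSpace S] in
lemma normSqS_apply (φ : 𝓢(Euc n, S)) (x : Euc n) : normSqS φ x = ‖x‖ ^ 2 • φ x := by
  rw [normSqS, sum_apply_schwartz, EuclideanSpace.real_norm_sq_eq, Finset.sum_smul]
  refine Finset.sum_congr rfl fun j _ => ?_
  rw [coordS_apply, coordS_apply, smul_smul, sq]

omit [CompleteSpace S] in
/-- Multiplication of the kernel by `|y|² = |x|² - 2 ⟨x, x - y⟩ + |x - y|²`. -/
lemma symKS_add_two (hn : 0 < n) (ρ : CliffordRep n S) {z : ℂ} (hz : -(n : ℝ) - 1 < z.re)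
    (φ : 𝓢(Euc n, S)) (x : Euc n) :
    symKS ρ (z + 2) φ x = (‖x‖ ^ 2) • symKS ρ z φ x -
      (2 : ℝ) • ∑ j, x j • symKS ρ z (coordS j φ) x + symKS ρ z (normSqS φ) x := by
  have hi : ∀ ψ : 𝓢(Euc n, S), Integrable (fun y => rieszKernel ρ z y (ψ (x - y) - ψ (x + y))) :=
    fun ψ => integrable_rieszKernel_sym hn ρ (ψ.smooth 1) (hasDecay_schwartz ψ (-n - 1 - z.re)) hz
      (by linarith) x
  have hpt : ∀ y, rieszKernel ρ (z + 2) y (φ (x - y) - φ (x + y)) =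
      ‖x‖ ^ 2 • rieszKernel ρ z y (φ (x - y) - φ (x + y)) -
      (2 : ℝ) • ∑ j, x j • rieszKernel ρ z y (coordS j φ (x - y) - coordS j φ (x + y)) +
      rieszKernel ρ z y (normSqS φ (x - y) - normSqS φ (x + y)) := by
    intro y
    have h1 : rieszKernel ρ (z + 2) y (φ (x - y) - φ (x + y)) =
        rieszKernel ρ z y (‖y‖ ^ 2 • (φ (x - y) - φ (x + y))) := by
      rcases eq_or_ne y 0 with rfl | hy
      · simp [rieszKernel_zero]
      · have hy0 : (‖y‖ : ℂ) ≠ 0 := by simpa using hy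
        rw [rieszKernel_apply, rieszKernel_apply, ContinuousLinearMap.map_smul_of_tower,
          ← Complex.coe_smul, smul_smul, show z + 2 - 1 = z - 1 + (2 : ℕ) by push_cast; ring,
          Complex.cpow_add _ _ hy0, Complex.cpow_natCast]
        push_cast
        rfl
    have h2 : ‖y‖ ^ 2 • (φ (x - y) - φ (x + y)) = ‖x‖ ^ 2 • (φ (x - y) - φ (x + y)) -
        (2 : ℝ) • ∑ j, x j • (coordS j φ (x - y) - coordS j φ (x + y)) +
        (normSqS φ (x - y) - normSqS φ (x + y)) := by
      -- The terms with `j` add up to the inner products `⟨x, x ∓ y⟩`.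
      have h3 : ∑ j, x j • (coordS j φ (x - y) - coordS j φ (x + y)) =
          inner ℝ x (x - y) • φ (x - y) - inner ℝ x (x + y) • φ (x + y) := by
        simp only [coordS_apply, smul_sub, smul_smul, Finset.sum_sub_distrib, ← Finset.sum_smul]
        congr 2 <;>
        · rw [PiLp.inner_apply]
          exact Finset.sum_congr rfl fun j _ => by simp [mul_comm]
      rw [h3, normSqS_apply, normSqS_apply, inner_sub_right, inner_add_right,
        real_inner_self_eq_norm_sq, norm_sub_sq_real, norm_add_sq_real]
      module
    rw [h1, h2, map_add, map_sub, ContinuousLinearMap.map_smul_of_tower,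
      ContinuousLinearMap.map_smul_of_tower, map_sum]
    simp only [ContinuousLinearMap.map_smul_of_tower]
  simp only [symKS]
  simp only [hpt]
  have hsum : Integrable fun y => ∑ j, x j •
      rieszKernel ρ z y (coordS j φ (x - y) - coordS j φ (x + y)) :=
    integrable_finsetSum _ fun j _ => Integrable.fun_smul (x j) (hi _)
  have hA := Integrable.fun_smul (‖x‖ ^ 2) (hi φ)
  have hB := Integrable.fun_smul (2 : ℝ) hsum
  have hAB : Integrable fun y => ‖x‖ ^ 2 • rieszKernel ρ z y (φ (x - y) - φ (x + y)) -
      (2 : ℝ) • ∑ j, x j • rieszKernel ρ z y (coordS j φ (x - y) - coordS j φ (x + y)) :=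
    hA.sub hB
  rw [integral_add hAB (hi _), integral_sub hA hB, integral_smul, integral_smul,
    integral_finsetSum _ fun j _ => Integrable.fun_smul (x j) (hi _)]
  simp only [integral_smul]
  rw [smul_add, smul_sub, smul_comm (1 / 2 : ℂ), smul_comm (1 / 2 : ℂ), Finset.smul_sum]
  simp only [smul_comm (1 / 2 : ℂ)]

lemma extKS_add_two (hn : 0 < n) (ρ : CliffordRep n S) {z : ℂ} (hz : z ∉ rieszPoles n)
    (φ : 𝓢(Euc n, S)) (x : Euc n) :
    extKS ρ (z + 2) φ x = (‖x‖ ^ 2) • extKS ρ z φ x -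
      (2 : ℝ) • ∑ j, x j • extKS ρ z (coordS j φ) x + extKS ρ z (normSqS φ) x := by
  refine eq_off_poles (F := fun z => extKS ρ (z + 2) φ x) (G := fun z => (‖x‖ ^ 2) • extKS ρ z φ x -
      (2 : ℝ) • ∑ j, x j • extKS ρ z (coordS j φ) x + extKS ρ z (normSqS φ) x)
    (fun z hz => differentiableAt_extKS_add_two hn ρ hz φ x)
    (fun z hz => (((differentiableAt_extKS hn ρ hz φ x).const_smul _).sub
      ((DifferentiableAt.fun_sum fun j _ =>
        (differentiableAt_extKS hn ρ hz (coordS j φ) x).const_smul (x j)).const_smul _)).add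
      (differentiableAt_extKS hn ρ hz _ x))
    (a := -n - 1) (b := -n) (by linarith) (fun z h hz => ?_) hz
  simp only [extKS_of_lt ρ h.1]
  rw [extKS_of_lt ρ (by simp; linarith [h.1]), symKS_add_two hn ρ h.1]

omit [NormedSpace ℂ S] [CompleteSpace S] in
lemma HasDecay.sum {ι : Type*} {s : Finset ι} {f : ι → Euc n → S} {t : ℝ}
    (h : ∀ i ∈ s, HasDecay (f i) t) : HasDecay (fun x => ∑ i ∈ s, f i x) t := by
  classical
  induction s using Finset.induction_on with
  | empty =>
    refine ⟨0, le_rfl, fun x => by simp⟩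
  | insert i s hi ih =>
    simp only [Finset.sum_insert hi]
    exact (h i (Finset.mem_insert_self i s)).add
      (ih fun j hj => h j (Finset.mem_insert_of_mem hj))

omit [CompleteSpace S] in
/-- Multiplication by `1 + |x|²` shifts the rate of growth by two. -/
lemma hasDecay_of_norm_sq_smul {f : Euc n → S} {t : ℝ} (h : HasDecay f (t + 2))
    (h2 : HasDecay (fun x => (‖x‖ ^ 2) • f x) (t + 2)) : HasDecay f t := by
  obtain ⟨A, hA, h⟩ := h
  obtain ⟨B, hB, h2⟩ := h2
  refine ⟨2 * (A + B), by positivity, fun x => ?_⟩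
  have hx : 0 < 1 + ‖x‖ := by positivity
  have h1 := h x
  have h3 := h2 x
  rw [norm_smul, Real.norm_of_nonneg (by positivity)] at h3
  have e1 : (1 + ‖x‖) ^ (t + 2) = (1 + ‖x‖) ^ t * (1 + ‖x‖) ^ 2 := by
    rw [Real.rpow_add hx, Real.rpow_ofNat]
  rw [e1] at h1 h3
  refine le_of_mul_le_mul_right ?_ (pow_pos hx 2)
  nlinarith [mul_nonneg (sq_nonneg (1 - ‖x‖)) (norm_nonneg (f x))]

/-- Off the poles, the convolution of the Riesz distribution of exponent `z` with a Schwartz field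
grows at most like the Riesz kernel. -/
lemma hasDecay_extKS (hn : 0 < n) (ρ : CliffordRep n S) {z : ℂ} (hz : z ∉ rieszPoles n)
    (φ : 𝓢(Euc n, S)) : HasDecay (extKS ρ z φ) z.re := by
  have hn0 : (0 : ℝ) < n := by exact_mod_cast hn
  revert φ
  refine induction_off_poles (n := n) (p := fun z => ∀ φ : 𝓢(Euc n, S),
    HasDecay (extKS ρ z φ) z.re) ?_ ?_ hz
  · intro z hz φ
    have h : extKS ρ z φ = symKS ρ z φ := funext (extKS_of_lt ρ hz φ)
    rw [h]
    exact hasDecay_symKS hn ρ hz φ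
  · intro z hz hzP ih φ
    have hc := factor_ne_zero hzP fun h' => by
      simp only [h', Complex.neg_re, Complex.one_re] at hz
      linarith
    have ih' : ∀ ψ : 𝓢(Euc n, S), HasDecay (extKS ρ (z + 2) ψ) (z.re + 2) := by simpa using ih
    -- With the exponent raised by two, the recursion bounds the convolution, and the second
    -- functional equation its products with the coordinates; `extKS_add_two` then bounds the
    -- product with `|x|²`.
    have h1 : ∀ ψ : 𝓢(Euc n, S), HasDecay (extKS ρ z ψ) (z.re + 2) := by
      intro ψ
      have : extKS ρ z ψ = fun x => ((z + 1) * (z + 1 + n))⁻¹ • extKS ρ (z + 2) (Δ ψ) x :=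
        funext (extKS_of_le ρ hz ψ)
      rw [this]
      exact (ih' _).const_smul _
    have h2 : ∀ j (ψ : 𝓢(Euc n, S)), HasDecay (fun x => x j • extKS ρ z ψ x) (z.re + 2) := by
      intro j ψ
      have : (fun x => x j • extKS ρ z ψ x) =
          fun x => ((z + 1) * (z + 1 + n))⁻¹ • extKS ρ (z + 2) (weightedOp ρ j z ψ) x :=
        funext fun x => by rw [← coord_smul_extKS hn ρ j hzP, inv_smul_smul₀ hc]
      rw [this]
      exact (ih' _).const_smul _
    refine hasDecay_of_norm_sq_smul (h1 φ) ?_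
    have h3 : (fun x => (‖x‖ ^ 2) • extKS ρ z φ x) = fun x => extKS ρ (z + 2) φ x +
        ((2 : ℂ) • (∑ j, x j • extKS ρ z (coordS j φ) x) + (-1 : ℂ) • extKS ρ z (normSqS φ) x) := by
      ext x
      rw [extKS_add_two hn ρ hzP, two_smul ℝ]
      module
    rw [h3]
    exact (ih' φ).add (((HasDecay.sum fun j _ => h2 j _).const_smul _).add ((h1 _).const_smul _))

end Complete

/-! ### The regularized convolution of smooth fields -/

/-- The regularized convolution at `x` of the Riesz distribution of exponent `z` with `f`. -/
def rieszConv (ρ : CliffordRep n S) (z : ℂ) (f : Euc n → S) (x : Euc n) : S :=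
  regularizedIntegral ρ z (fun y => f (x - y))

/-- The part of the convolution over `|y| ≥ 1`. -/
def outerConv (ρ : CliffordRep n S) (z : ℂ) (f : Euc n → S) (x : Euc n) : S :=
  ∫ y in (Metric.ball (0 : Euc n) 1)ᶜ, rieszKernel ρ z y (f (x - y))

lemma isClosed_rieszPoles (n : ℕ) : IsClosed (rieszPoles n) := by
  refine Metric.isClosed_of_pairwise_le_dist two_pos ?_
  rintro _ ⟨k, rfl⟩ _ ⟨l, rfl⟩ hkl
  have hne : (k : ℤ) - l ≠ 0 := fun h => hkl (by
    have : k = l := by omega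
    rw [this])
  have h1 : (1 : ℝ) ≤ |((k - l : ℤ) : ℝ)| := by exact_mod_cast Int.one_le_abs hne
  have h2 : -(n : ℂ) - 1 - 2 * (k : ℂ) - (-(n : ℂ) - 1 - 2 * (l : ℂ)) =
      ((-2 * ((k - l : ℤ) : ℝ) : ℝ) : ℂ) := by
    push_cast
    ring
  rw [dist_eq_norm, h2, Complex.norm_real, Real.norm_eq_abs, abs_mul, abs_neg, abs_two]
  linarith

lemma symKS_eq_integral (ρ : CliffordRep n S) (z : ℂ) {f : Euc n → S} {x : Euc n}
    (hi : Integrable fun y => rieszKernel ρ z y (f (x - y))) :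
    symKS ρ z f x = ∫ y, rieszKernel ρ z y (f (x - y)) := by
  have h1 : ∀ y, rieszKernel ρ z y (f (x - y) - f (x + y)) = rieszKernel ρ z y (f (x - y)) +
      (fun y => rieszKernel ρ z y (f (x - y))) (-y) := by
    intro y
    simp only [map_sub, rieszKernel_neg, neg_apply, sub_neg_eq_add]
    rw [sub_eq_add_neg]
  rw [symKS]
  simp only [h1]
  rw [integral_add hi hi.comp_neg,
    integral_neg_eq_self (fun y => rieszKernel ρ z y (f (x - y))), ← two_smul ℂ, smul_smul]
  norm_num

omit [NormedSpace ℂ S] in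
lemma integrableOn_outer (hn : 0 < n) {f : Euc n → S} (hf : Continuous f) {s t : ℝ}
    (hd : HasDecay f t) (hst : s + t < -n) (x : Euc n) :
    IntegrableOn (fun y => ‖y‖ ^ s * ‖f (x - y)‖) (Metric.ball 0 1)ᶜ := by
  obtain ⟨A, hA0, hA⟩ := hd
  have hn0 : (0 : ℝ) < n := by exact_mod_cast hn
  have h := (integrable_norm_rpow_mul hn (s := 0) (t := s + t) (by linarith)
    (by linarith)).const_mul (2 ^ |s| * (A * (1 + ‖x‖) ^ |t|))
  refine (h.integrableOn (s := (Metric.ball 0 1)ᶜ)).mono' ?_ ?_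
  · exact ((measurable_norm.pow_const s).aestronglyMeasurable).mul
      (by fun_prop : Continuous fun y => ‖f (x - y)‖).aestronglyMeasurable
  · refine (ae_restrict_iff' Metric.isOpen_ball.measurableSet.compl).2
      (Eventually.of_forall fun y hy => ?_)
    have hy1 : 1 ≤ ‖y‖ := by simpa using hy
    have hy0 : 0 < 1 + ‖y‖ := by positivity
    rw [Real.norm_of_nonneg (by positivity), Real.rpow_zero, one_mul, Real.rpow_add hy0]
    calc _ ≤ (2 ^ |s| * (1 + ‖y‖) ^ s) * (A * ((1 + ‖x‖) ^ |t| * (1 + ‖y‖) ^ t)) := by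
          gcongr
          · exact rpow_le_one_add_rpow_of_one_le hy1 s
          · exact (hA _).trans (by gcongr; exact one_add_norm_rpow_sub_le x y t)
      _ = _ := by ring

lemma integrableOn_rieszKernel_outer (hn : 0 < n) (ρ : CliffordRep n S) {f : Euc n → S}
    (hf : Continuous f) {z : ℂ} {t : ℝ} (hd : HasDecay f t) (hzt : z.re + t < -n) (x : Euc n) :
    IntegrableOn (fun y => rieszKernel ρ z y (f (x - y))) (Metric.ball 0 1)ᶜ :=
  integrable_rieszKernel ρ z (by fun_prop : Continuous fun y => f (x - y)).aestronglyMeasurable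
    (integrableOn_outer hn hf hd hzt x)

lemma integrableOn_rieszKernel_inner (hn : 0 < n) (ρ : CliffordRep n S) {g : Euc n → S}
    (hg : Continuous g) {z : ℂ} (hz : -(n : ℝ) < z.re) :
    IntegrableOn (fun y => rieszKernel ρ z y (g y)) (Metric.ball 0 1) := by
  obtain ⟨B, hB⟩ := (isCompact_closedBall (0 : Euc n) 1).exists_bound_of_continuousOn
    hg.continuousOn
  refine integrable_rieszKernel ρ z hg.aestronglyMeasurable
    (((integrableOn_ball_norm_rpow hn hz).mul_const B).mono' ?_ ?_)
  · exact ((measurable_norm.pow_const z.re).aestronglyMeasurable).mul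
      hg.norm.aestronglyMeasurable
  · refine (ae_restrict_iff' Metric.isOpen_ball.measurableSet).2
      (Eventually.of_forall fun y hy => ?_)
    rw [Real.norm_of_nonneg (by positivity)]
    gcongr
    exact hB y (Metric.ball_subset_closedBall hy)

/-- A smooth field agrees with a Schwartz field near a given point. -/
lemma exists_schwartz_eq_on_ball {f : Euc n → S} (hf : ContDiff ℝ ∞ f) (x : Euc n) :
    ∃ φ : 𝓢(Euc n, S), ∀ u ∈ Metric.ball x 2, φ u = f u := by
  let χ : ContDiffBump x := ⟨2, 3, two_pos, by norm_num⟩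
  have h1 : HasCompactSupport fun u => χ u • f u := χ.hasCompactSupport.smul_right
  have h2 : ContDiff ℝ ∞ fun u => χ u • f u := χ.contDiff.smul hf
  refine ⟨h1.toSchwartzMap h2, fun u hu => ?_⟩
  change χ u • f u = f u
  rw [χ.one_of_mem_closedBall (Metric.ball_subset_closedBall hu), one_smul]

lemma IsInnerContinuation.congr {ρ : CliffordRep n S} {g g' : Euc n → S} {F : ℂ → S}
    (h : IsInnerContinuation ρ g F) (hg : ∀ y ∈ Metric.ball (0 : Euc n) 1, g y = g' y) :
    IsInnerContinuation ρ g' F := by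
  refine ⟨h.differentiableOn, fun z hz => ?_, fun z hz => ?_⟩
  · refine (h.integrableOn z hz).congr_fun (fun y hy => ?_) Metric.isOpen_ball.measurableSet
    simp only [hg y hy]
  · rw [h.eq_integral z hz]
    refine setIntegral_congr_fun Metric.isOpen_ball.measurableSet fun y hy => ?_
    simp only [hg y hy]

section Complete

variable [CompleteSpace S]

omit [CompleteSpace S] in
lemma IsInnerContinuation.differentiableAt {ρ : CliffordRep n S} {g : Euc n → S} {F : ℂ → S}
    (h : IsInnerContinuation ρ g F) {z : ℂ} (hz : z ∉ rieszPoles n) : DifferentiableAt ℂ F z :=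
  h.differentiableOn.differentiableAt ((isClosed_rieszPoles n).isOpen_compl.mem_nhds hz)

lemma IsInnerContinuation.unique {ρ : CliffordRep n S} {g : Euc n → S} {F G : ℂ → S}
    (hF : IsInnerContinuation ρ g F) (hG : IsInnerContinuation ρ g G) {z : ℂ}
    (hz : z ∉ rieszPoles n) : F z = G z :=
  eq_off_poles (fun _ h => hF.differentiableAt h) (fun _ h => hG.differentiableAt h)
    (a := -n) (b := -n + 1) (by linarith)
    (fun w hw _ => by rw [hF.eq_integral w hw.1, hG.eq_integral w hw.1]) hz

lemma innerPart_eq {ρ : CliffordRep n S} {g : Euc n → S} {F : ℂ → S}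
    (hF : IsInnerContinuation ρ g F) {z : ℂ} (hz : z ∉ rieszPoles n) : innerPart ρ z g = F z := by
  have h : ∃ F : ℂ → S, IsInnerContinuation ρ g F := ⟨F, hF⟩
  rw [innerPart, dif_pos h]
  exact h.choose_spec.unique hF hz

lemma differentiableAt_outerConv (hn : 0 < n) (ρ : CliffordRep n S) {f : Euc n → S}
    (hf : Continuous f) {z : ℂ} {t : ℝ} (hd : HasDecay f t) (hzt : z.re + t < -n) (x : Euc n) :
    DifferentiableAt ℂ (fun z => outerConv ρ z f x) z := by
  obtain ⟨s, h1, h2⟩ := exists_between (show z.re < -n - t by linarith)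
  exact differentiableAt_integral_rieszKernel ρ
    (by fun_prop : Continuous fun y => f (x - y)).aestronglyMeasurable (sub_one_lt z.re) h1
    (integrableOn_outer hn hf hd (by linarith) x) (integrableOn_outer hn hf hd (by linarith) x)

lemma isInnerContinuation_schwartz (hn : 0 < n) (ρ : CliffordRep n S) (φ : 𝓢(Euc n, S))
    (x : Euc n) : IsInnerContinuation ρ (fun y => φ (x - y))
      (fun z => extKS ρ z φ x - outerConv ρ z φ x) := by
  have hc : Continuous fun y => φ (x - y) := φ.continuous.comp (continuous_const.sub continuous_id)
  refine ⟨fun z hz => ?_, fun z hz => integrableOn_rieszKernel_inner hn ρ hc hz, fun z hz => ?_⟩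
  · exact ((differentiableAt_extKS hn ρ hz φ x).sub
      (differentiableAt_outerConv hn ρ φ.continuous (hasDecay_schwartz φ (-n - 1 - z.re))
        (by linarith) x)).differentiableWithinAt
  · have h1 := integrableOn_rieszKernel_inner hn ρ hc hz
    have h2 := integrableOn_rieszKernel_outer hn ρ φ.continuous (z := z)
      (hasDecay_schwartz φ (-n - 1 - z.re)) (by linarith) x
    have h3 : Integrable fun y => rieszKernel ρ z y (φ (x - y)) := by
      rw [← integrableOn_univ, ← union_compl_self (Metric.ball (0 : Euc n) 1)]
      exact h1.union h2
    rw [extKS_of_lt ρ (by linarith), symKS_eq_integral ρ z h3,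
      ← integral_add_compl (Metric.isOpen_ball (x := (0 : Euc n)) (ε := 1)).measurableSet h3,
      outerConv, add_sub_cancel_right]

lemma isInnerContinuation_of_eq_on_ball (hn : 0 < n) (ρ : CliffordRep n S) {f : Euc n → S}
    {x : Euc n} {φ : 𝓢(Euc n, S)} (h : ∀ u ∈ Metric.ball x 1, φ u = f u) :
    IsInnerContinuation ρ (fun y => f (x - y))
      (fun z => extKS ρ z φ x - outerConv ρ z φ x) := by
  refine (isInnerContinuation_schwartz hn ρ φ x).congr fun y hy => h _ ?_
  simpa [dist_eq_norm] using hy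

lemma rieszConv_eq (hn : 0 < n) (ρ : CliffordRep n S) {f : Euc n → S}
    {x : Euc n} {φ : 𝓢(Euc n, S)} (h : ∀ u ∈ Metric.ball x 1, φ u = f u) {z : ℂ}
    (hz : z ∉ rieszPoles n) :
    rieszConv ρ z f x = extKS ρ z φ x - outerConv ρ z φ x + outerConv ρ z f x := by
  rw [rieszConv, regularizedIntegral, innerPart_eq (isInnerContinuation_of_eq_on_ball hn ρ h) hz,
    ← outerConv]

lemma rieszConv_schwartz (hn : 0 < n) (ρ : CliffordRep n S) (φ : 𝓢(Euc n, S)) {z : ℂ}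
    (hz : z ∉ rieszPoles n) : rieszConv ρ z φ = extKS ρ z φ := by
  ext x
  rw [rieszConv_eq hn ρ (fun u _ => rfl) hz, sub_add_cancel]

lemma hasRegularizedIntegral_of_hasDecay (hn : 0 < n) (ρ : CliffordRep n S) {f : Euc n → S}
    (hf : ContDiff ℝ ∞ f) {z : ℂ} {t : ℝ} (hd : HasDecay f t) (hzt : z.re + t < -n) (x : Euc n) :
    HasRegularizedIntegral ρ z (fun y => f (x - y)) := by
  obtain ⟨φ, hφ⟩ := exists_schwartz_eq_on_ball hf x
  exact ⟨⟨_, isInnerContinuation_of_eq_on_ball hn ρ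
    fun u hu => hφ u (Metric.ball_subset_ball one_le_two hu)⟩,
    integrableOn_rieszKernel_outer hn ρ hf.continuous hd hzt x⟩

lemma differentiableAt_rieszConv (hn : 0 < n) (ρ : CliffordRep n S) {f : Euc n → S}
    (hf : ContDiff ℝ ∞ f) {z : ℂ} (hz : z ∉ rieszPoles n) {t : ℝ} (hd : HasDecay f t)
    (hzt : z.re + t < -n) (x : Euc n) : DifferentiableAt ℂ (fun z => rieszConv ρ z f x) z := by
  obtain ⟨φ, hφ⟩ := exists_schwartz_eq_on_ball hf x
  have h1 := (isInnerContinuation_of_eq_on_ball hn ρ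
    fun u hu => hφ u (Metric.ball_subset_ball one_le_two hu)).differentiableAt hz
  refine (h1.add (differentiableAt_outerConv hn ρ hf.continuous hd hzt x)).congr_of_eventuallyEq ?_
  filter_upwards [(isClosed_rieszPoles n).isOpen_compl.mem_nhds hz] with w hw
  exact rieszConv_eq hn ρ (fun u hu => hφ u (Metric.ball_subset_ball one_le_two hu)) hw

/-- For `Re z > -n - 1` the regularized convolution is the symmetrized one: `f` is compared with a
Schwartz field that agrees with it near `x`. -/
lemma rieszConv_eq_symKS (hn : 0 < n) (ρ : CliffordRep n S) {f : Euc n → S}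
    (hf : ContDiff ℝ ∞ f) {z : ℂ} (hz : -(n : ℝ) - 1 < z.re) {t : ℝ} (hd : HasDecay f t)
    (hzt : z.re + t < -n) (x : Euc n) : rieszConv ρ z f x = symKS ρ z f x := by
  obtain ⟨φ, hφ⟩ := exists_schwartz_eq_on_ball hf x
  have hφ1 : ∀ u ∈ Metric.ball x 1, φ u = f u :=
    fun u hu => hφ u (Metric.ball_subset_ball one_le_two hu)
  have hzP : z ∉ rieszPoles n := fun h => by
    have := re_le_of_mem_rieszPoles h
    linarith
  have hdφ := hasDecay_schwartz φ (-n - 1 - z.re)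
  rw [rieszConv_eq hn ρ hφ1 hzP, extKS_of_lt ρ hz]
  have o1 := integrableOn_rieszKernel_outer hn ρ hf.continuous hd hzt x
  have o2 := integrableOn_rieszKernel_outer hn ρ φ.continuous hdφ (z := z) (by linarith) x
  have hms := (Metric.isOpen_ball (x := (0 : Euc n)) (ε := 1)).measurableSet
  have h0 : ∀ y ∈ Metric.ball (0 : Euc n) 1,
      rieszKernel ρ z y ((fun u => f u - φ u) (x - y)) = 0 := by
    intro y hy
    have : x - y ∈ Metric.ball x 1 := by simpa [dist_eq_norm] using hy
    simp [hφ1 _ this]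
  have o3 : IntegrableOn (fun y => rieszKernel ρ z y ((fun u => f u - φ u) (x - y)))
      (Metric.ball 0 1)ᶜ := by
    simp only [map_sub]
    exact Integrable.sub o1 o2
  have hi : Integrable fun y => rieszKernel ρ z y ((fun u => f u - φ u) (x - y)) := by
    rw [← integrableOn_univ, ← union_compl_self (Metric.ball (0 : Euc n) 1)]
    exact (integrableOn_zero.congr_fun (fun y hy => (h0 y hy).symm) hms).union o3
  -- `f - φ` vanishes near `x`, so its symmetrized convolution is an integral over `|y| ≥ 1`.
  have h1 : outerConv ρ z f x - outerConv ρ z φ x = symKS ρ z (fun u => f u - φ u) x := by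
    rw [symKS_eq_integral ρ z hi, ← integral_add_compl hms hi,
      setIntegral_eq_zero_of_forall_eq_zero h0,
      zero_add, outerConv, outerConv, ← integral_sub o1 o2]
    simp only [map_sub]
  have h2 : symKS ρ z (fun u => f u - φ u) x = symKS ρ z f x - symKS ρ z φ x := by
    have i1 := integrable_rieszKernel_sym hn ρ (hf.of_le (by norm_num)) hd hz hzt x
    have i2 := integrable_rieszKernel_sym hn ρ (φ.smooth 1) hdφ hz (by linarith) x
    simp only [symKS]
    rw [← smul_sub, ← integral_sub i1 i2]
    congr 2
    ext y
    rw [← map_sub]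
    congr 1
    abel
  rw [h2] at h1
  rw [sub_add_eq_add_sub, add_sub_assoc, h1, add_sub_cancel]

end Complete

/-! ### The functional equation for smooth fields of controlled growth -/

/-- The Laplacian in coordinates, as a sum of iterated first derivatives. -/
def coordLaplacian (f : Euc n → S) (x : Euc n) : S :=
  ∑ k, fderiv ℝ (fun y => fderiv ℝ f y (e k)) x (e k)

lemma laplacian_apply_eq_coordLaplacian (φ : 𝓢(Euc n, S)) (x : Euc n) :
    (Δ φ : 𝓢(Euc n, S)) x = coordLaplacian φ x := by
  rw [laplacian_eq_sum_e, sum_apply_schwartz, coordLaplacian]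
  refine Finset.sum_congr rfl fun k _ => ?_
  rw [SchwartzMap.lineDerivOp_apply_eq_fderiv]
  congr 2

lemma contDiff_fderiv_apply {F : Type*} [NormedAddCommGroup F] [NormedSpace ℝ F]
    {f : Euc n → F} (hf : ContDiff ℝ ∞ f) (v : Euc n) :
    ContDiff ℝ ∞ fun x => fderiv ℝ f x v :=
  (hf.fderiv_right (m := ∞) (by simp)).clm_apply contDiff_const

lemma contDiff_coordLaplacian {f : Euc n → S} (hf : ContDiff ℝ ∞ f) :
    ContDiff ℝ ∞ (coordLaplacian f) :=
  ContDiff.sum fun k _ => contDiff_fderiv_apply (contDiff_fderiv_apply hf (e k)) (e k)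

lemma coordLaplacian_congr {f g : Euc n → S} {x : Euc n} (h : f =ᶠ[𝓝 x] g) :
    coordLaplacian f x = coordLaplacian g x := by
  refine Finset.sum_congr rfl fun k _ => ?_
  have h1 : (fun y => fderiv ℝ f y (e k)) =ᶠ[𝓝 x] fun y => fderiv ℝ g y (e k) := by
    filter_upwards [h.fderiv (𝕜 := ℝ)] with y hy
    rw [hy]
  rw [h1.fderiv_eq]

lemma fderiv_smul_apply' {χ : Euc n → ℝ} {f : Euc n → S} (hχ : ContDiff ℝ ∞ χ)
    (hf : ContDiff ℝ ∞ f) (x v : Euc n) : fderiv ℝ (fun u => χ u • f u) x v =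
      χ x • fderiv ℝ f x v + fderiv ℝ χ x v • f x := by
  rw [fderiv_fun_smul (hχ.differentiable (by simp) x) (hf.differentiable (by simp) x)]
  simp

/-- The Leibniz rule for the Laplacian. -/
lemma coordLaplacian_smul {χ : Euc n → ℝ} {f : Euc n → S} (hχ : ContDiff ℝ ∞ χ)
    (hf : ContDiff ℝ ∞ f) (x : Euc n) : coordLaplacian (fun u => χ u • f u) x =
      χ x • coordLaplacian f x + ∑ k, ((2 * fderiv ℝ χ x (e k)) • fderiv ℝ f x (e k) +
        fderiv ℝ (fun y => fderiv ℝ χ y (e k)) x (e k) • f x) := by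
  rw [coordLaplacian, coordLaplacian, Finset.smul_sum, ← Finset.sum_add_distrib]
  refine Finset.sum_congr rfl fun k _ => ?_
  have h1 : (fun y => fderiv ℝ (fun u => χ u • f u) y (e k)) = fun y =>
      χ y • fderiv ℝ f y (e k) + fderiv ℝ χ y (e k) • f y :=
    funext fun y => fderiv_smul_apply' hχ hf y (e k)
  have hχ' := contDiff_fderiv_apply hχ (e k)
  have hf' := contDiff_fderiv_apply hf (e k)
  have d1 : DifferentiableAt ℝ (fun y => χ y • fderiv ℝ f y (e k)) x :=
    (hχ.smul hf').differentiable (by simp) x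
  have d2 : DifferentiableAt ℝ (fun y => fderiv ℝ χ y (e k) • f y) x :=
    (hχ'.smul hf).differentiable (by simp) x
  rw [h1, fderiv_fun_add d1 d2, add_apply, fderiv_smul_apply' hχ hf',
    fderiv_smul_apply' hχ' hf]
  module

lemma fderiv_comp_const_smul {F : Type*} [NormedAddCommGroup F] [NormedSpace ℝ F]
    {χ : Euc n → F} (hχ : ContDiff ℝ ∞ χ) (r : ℝ) (x v : Euc n) :
    fderiv ℝ (fun u => χ (r • u)) x v = r • fderiv ℝ χ (r • x) v := by
  have h1 : HasFDerivAt (fun u : Euc n => r • u) (r • ContinuousLinearMap.id ℝ (Euc n)) x :=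
    (hasFDerivAt_id x).const_smul r
  have h2 : HasFDerivAt (fun u => χ (r • u))
      ((fderiv ℝ χ (r • x)).comp (r • ContinuousLinearMap.id ℝ (Euc n))) x :=
    (hχ.differentiable (by simp) (r • x)).hasFDerivAt.comp x h1
  rw [h2.fderiv]
  simp

/-- An exhausting sequence of cutoffs with uniformly bounded derivatives. -/
lemma exists_cutoffs (n : ℕ) : ∃ (B : ℝ) (χ : ℕ → Euc n → ℝ), 0 ≤ B ∧ ∀ m, ContDiff ℝ ∞ (χ m) ∧
    HasCompactSupport (χ m) ∧ (∀ u, ‖u‖ < m + 1 → χ m u = 1) ∧ (∀ u, |χ m u| ≤ 1) ∧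
    (∀ u k, |fderiv ℝ (χ m) u (e k)| ≤ B) ∧
    ∀ u k, |fderiv ℝ (fun y => fderiv ℝ (χ m) y (e k)) u (e k)| ≤ B := by
  let χ : ContDiffBump (0 : Euc n) := ⟨1, 2, one_pos, by norm_num⟩
  have hχ : ContDiff ℝ ∞ χ := χ.contDiff
  have hcs : ∀ (g : Euc n → ℝ) (v : Euc n), HasCompactSupport g →
      HasCompactSupport fun u => fderiv ℝ g u v := fun g v hg => hg.fderiv_apply ℝ v
  have hb1 : ∀ k, ∃ C, ∀ u, ‖fderiv ℝ χ u (e k)‖ ≤ C := fun k =>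
    (contDiff_fderiv_apply hχ (e k)).continuous.bounded_above_of_compact_support
      (hcs _ _ χ.hasCompactSupport)
  have hb2 : ∀ k, ∃ C, ∀ u, ‖fderiv ℝ (fun y => fderiv ℝ χ y (e k)) u (e k)‖ ≤ C := fun k =>
    (contDiff_fderiv_apply (contDiff_fderiv_apply hχ (e k))
      (e k)).continuous.bounded_above_of_compact_support (hcs _ _ (hcs _ _ χ.hasCompactSupport))
  choose B₁ hB₁ using hb1
  choose B₂ hB₂ using hb2
  have hB₁0 : ∀ k, 0 ≤ B₁ k := fun k => (norm_nonneg _).trans (hB₁ k 0)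
  have hB₂0 : ∀ k, 0 ≤ B₂ k := fun k => (norm_nonneg _).trans (hB₂ k 0)
  have hle : ∀ k, B₁ k + B₂ k ≤ ∑ k, (B₁ k + B₂ k) := fun k =>
    Finset.single_le_sum (f := fun k => B₁ k + B₂ k)
      (fun k _ => add_nonneg (hB₁0 k) (hB₂0 k)) (Finset.mem_univ k)
  refine ⟨∑ k, (B₁ k + B₂ k), fun m u => χ (((m : ℝ) + 1)⁻¹ • u),
    Finset.sum_nonneg fun k _ => add_nonneg (hB₁0 k) (hB₂0 k), fun m => ?_⟩
  have hm : (0 : ℝ) < (m : ℝ) + 1 := by positivity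
  set r : ℝ := ((m : ℝ) + 1)⁻¹ with hr
  have hr0 : 0 < r := inv_pos.2 hm
  have hr1 : r ≤ 1 := inv_le_one_of_one_le₀ (by linarith [Nat.cast_nonneg (α := ℝ) m])
  have hd1 : ∀ u k, fderiv ℝ (fun u => χ (r • u)) u (e k) = r • fderiv ℝ χ (r • u) (e k) :=
    fun u k => fderiv_comp_const_smul hχ r u (e k)
  have hd2 : ∀ u k, fderiv ℝ (fun y => fderiv ℝ (fun u => χ (r • u)) y (e k)) u (e k) =
      r • (r • fderiv ℝ (fun y => fderiv ℝ χ y (e k)) (r • u) (e k)) := by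
    intro u k
    have d : DifferentiableAt ℝ (fun y => fderiv ℝ χ (r • y) (e k)) u :=
      ((contDiff_fderiv_apply hχ (e k)).comp (contDiff_const_smul r)).differentiable (by simp) u
    simp only [hd1]
    rw [fderiv_fun_const_smul d, smul_apply]
    congr 1
    exact fderiv_comp_const_smul (contDiff_fderiv_apply hχ (e k)) r u (e k)
  have hsm : ∀ a : ℝ, |r • a| ≤ |a| := fun a => by
    rw [smul_eq_mul, abs_mul, abs_of_pos hr0]
    exact mul_le_of_le_one_left (abs_nonneg a) hr1
  refine ⟨hχ.comp (contDiff_const_smul r), ?_, fun u hu => ?_, fun u => ?_, fun u k => ?_,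
    fun u k => ?_⟩
  · exact χ.hasCompactSupport.comp_homeomorph (Homeomorph.smulOfNeZero r hr0.ne')
  · refine χ.one_of_mem_closedBall ?_
    rw [mem_closedBall_zero_iff, norm_smul, Real.norm_of_nonneg hr0.le]
    change r * ‖u‖ ≤ 1
    rw [hr, inv_mul_le_one₀ hm]
    exact hu.le
  · rw [abs_of_nonneg χ.nonneg]
    exact χ.le_one
  · rw [hd1]
    exact (hsm _).trans ((hB₁ k _).trans (by linarith [hB₂0 k, hle k]))
  · rw [hd2]
    exact (hsm _).trans ((hsm _).trans ((hB₂ k _).trans (by linarith [hB₁0 k, hle k])))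

lemma continuous_one_add_norm_rpow_smul (C t : ℝ) :
    Continuous fun u : Euc n => C * (1 + ‖u‖) ^ t :=
  continuous_const.mul (continuous_one_add_norm_rpow t)

/-- Dominated convergence for the outer part of the convolution. -/
lemma tendsto_outerConv (hn : 0 < n) (ρ : CliffordRep n S) {g : ℕ → Euc n → S}
    {g' : Euc n → S} (hg : ∀ m, Continuous (g m)) {C t : ℝ} (hC : 0 ≤ C)
    (hb : ∀ m u, ‖g m u‖ ≤ C * (1 + ‖u‖) ^ t) (hlim : ∀ u, ∀ᶠ m in atTop, g m u = g' u) {z : ℂ}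
    (hzt : z.re + t < -n) (x : Euc n) :
    Tendsto (fun m => outerConv ρ z (g m) x) atTop (𝓝 (outerConv ρ z g' x)) := by
  obtain ⟨K, hK, hker⟩ := exists_norm_rieszKernel_le ρ
  have hd : HasDecay (fun u : Euc n => C * (1 + ‖u‖) ^ t) t :=
    ⟨C, hC, fun u => (Real.norm_of_nonneg (by positivity)).le⟩
  have hi := (integrableOn_outer hn (continuous_one_add_norm_rpow_smul C t) hd hzt x).const_mul K
  refine tendsto_integral_filter_of_dominated_convergence _ (Eventually.of_forall fun m => ?_)
    (Eventually.of_forall fun m => Eventually.of_forall fun y => ?_) hi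
    (Eventually.of_forall fun y => ?_)
  · exact aestronglyMeasurable_rieszKernel ρ z
      ((hg m).comp (continuous_const.sub continuous_id)).aestronglyMeasurable
  · refine (hker _ _ _).trans ?_
    gcongr
    exact (hb m _).trans (Real.le_norm_self _)
  · refine tendsto_const_nhds.congr' ?_
    filter_upwards [hlim (x - y)] with m hm
    rw [hm]

section Complete

variable [CompleteSpace S]

/-- The functional equation for `f`, by approximation with the Schwartz fields `χ_m f`. The
additional hypothesis that `r^(w+2) ⋆ f` converges makes the terms with derivatives of the cutoffs
integrable against `r^(w+2)`. -/
lemma rieszConv_coordLaplacian_aux (hn : 0 < n) (ρ : CliffordRep n S) {f : Euc n → S}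
    (hf : ContDiff ℝ ∞ f) {α β : ℝ} (h0 : HasDecay f α)
    (h1 : ∀ k, HasDecay (fun x => fderiv ℝ f x (e k)) α) (h2 : HasDecay (coordLaplacian f) β)
    {w : ℂ} (hw : w ∉ rieszPoles n) (hα : w.re + 2 + α < -n) (hβ : w.re + 2 + β < -n)
    (x : Euc n) :
    ((w + 1) * (w + 1 + n)) • rieszConv ρ w f x = rieszConv ρ (w + 2) (coordLaplacian f) x := by
  obtain ⟨B, χ, hB, hχ⟩ := exists_cutoffs n
  obtain ⟨A₀, hA₀, h0⟩ := h0
  choose A₁ hA₁ h1 using h1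
  obtain ⟨A₂, hA₂, h2⟩ := h2
  have hsm : ∀ m, ContDiff ℝ ∞ fun u => χ m u • f u := fun m => (hχ m).1.smul hf
  have hcs : ∀ m, HasCompactSupport fun u => χ m u • f u := fun m => (hχ m).2.1.smul_right
  set φ : ℕ → 𝓢(Euc n, S) := fun m => (hcs m).toSchwartzMap (hsm m) with hφ
  have hφf : ∀ m, ⇑(φ m) = fun u => χ m u • f u := fun m => rfl
  have hφ1 : ∀ (m : ℕ) u, ‖u‖ < m + 1 → φ m u = f u := fun m u hu => by
    rw [hφf]
    simp only
    rw [(hχ m).2.2.1 u hu, one_smul]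
  have hφ2 : ∀ (m : ℕ) u, ‖u‖ < m + 1 → (Δ (φ m) : 𝓢(Euc n, S)) u = coordLaplacian f u := by
    intro m u hu
    rw [laplacian_apply_eq_coordLaplacian]
    refine coordLaplacian_congr ?_
    filter_upwards [(isOpen_lt continuous_norm continuous_const).mem_nhds hu] with v hv
    exact hφ1 m v hv
  have hev : ∀ s : ℝ, ∀ᶠ m : ℕ in atTop, s < (m : ℝ) + 1 := fun s => by
    filter_upwards [(tendsto_natCast_atTop_atTop (R := ℝ)).eventually_gt_atTop s] with m hm
    linarith
  have t1 : Tendsto (fun m => outerConv ρ w (φ m) x) atTop (𝓝 (outerConv ρ w f x)) := by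
    refine tendsto_outerConv hn ρ (fun m => (φ m).continuous) hA₀ (t := α) (fun m u => ?_)
      (fun u => ?_) (by linarith) x
    · rw [hφf]
      simp only
      rw [norm_smul]
      exact (mul_le_of_le_one_left (norm_nonneg _) ((hχ m).2.2.2.1 u)).trans (h0 u)
    · filter_upwards [hev ‖u‖] with m hm
      exact hφ1 m u hm
  have t2 : Tendsto (fun m => outerConv ρ (w + 2) (Δ (φ m) : 𝓢(Euc n, S)) x) atTop
      (𝓝 (outerConv ρ (w + 2) (coordLaplacian f) x)) := by
    refine tendsto_outerConv hn ρ (fun m => (Δ (φ m) : 𝓢(Euc n, S)).continuous)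
      (C := A₂ + ∑ k, (2 * B * A₁ k + B * A₀)) ?_ (t := max α β) (fun m u => ?_)
      (fun u => ?_) ?_ x
    · exact add_nonneg hA₂ (Finset.sum_nonneg fun k _ =>
        add_nonneg (mul_nonneg (by positivity) (hA₁ k)) (by positivity))
    · obtain ⟨-, -, -, hm1, hm2, hm3⟩ := hχ m
      have hu1 : 1 ≤ 1 + ‖u‖ := by linarith [norm_nonneg u]
      have hαle : (1 + ‖u‖) ^ α ≤ (1 + ‖u‖) ^ max α β :=
        Real.rpow_le_rpow_of_exponent_le hu1 (le_max_left _ _)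
      have hβle : (1 + ‖u‖) ^ β ≤ (1 + ‖u‖) ^ max α β :=
        Real.rpow_le_rpow_of_exponent_le hu1 (le_max_right _ _)
      rw [laplacian_apply_eq_coordLaplacian, hφf, coordLaplacian_smul (hχ m).1 hf, add_mul,
        Finset.sum_mul]
      refine (norm_add_le _ _).trans (add_le_add ?_ ((norm_sum_le _ _).trans
        (Finset.sum_le_sum fun k _ => (norm_add_le _ _).trans ?_)))
      · rw [norm_smul]
        exact (mul_le_of_le_one_left (norm_nonneg _) (hm1 u)).trans
          ((h2 u).trans (mul_le_mul_of_nonneg_left hβle hA₂))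
      · rw [add_mul, norm_smul, norm_smul, norm_mul, Real.norm_ofNat]
        refine add_le_add ?_ ?_
        · calc _ ≤ 2 * B * (A₁ k * (1 + ‖u‖) ^ max α β) := by
                refine mul_le_mul (mul_le_mul_of_nonneg_left (hm2 u k) two_pos.le)
                  ((h1 k u).trans (mul_le_mul_of_nonneg_left hαle (hA₁ k))) (norm_nonneg _)
                  (by positivity)
            _ = _ := by ring
        · calc _ ≤ B * (A₀ * (1 + ‖u‖) ^ max α β) :=
                mul_le_mul (hm3 u k) ((h0 u).trans (mul_le_mul_of_nonneg_left hαle hA₀))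
                  (norm_nonneg _) hB
            _ = _ := by ring
    · filter_upwards [hev ‖u‖] with m hm
      exact hφ2 m u hm
    · rw [Complex.add_re, Complex.re_ofNat]
      rcases max_choice α β with h | h <;> rw [h] <;> assumption
  have hw2 := add_two_notMem_rieszPoles hw
  -- The inner parts of the two sides depend only on the values near `x`, where the cutoffs are `1`;
  -- they are written as differences of `rieszConv` and `outerConv`.
  have heq : ∀ᶠ m in atTop, ((w + 1) * (w + 1 + n)) •
      (rieszConv ρ w f x - outerConv ρ w f x + outerConv ρ w (φ m) x) =
      rieszConv ρ (w + 2) (coordLaplacian f) x - outerConv ρ (w + 2) (coordLaplacian f) x +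
        outerConv ρ (w + 2) (Δ (φ m) : 𝓢(Euc n, S)) x := by
    filter_upwards [hev (‖x‖ + 1)] with m hm
    have hball : ∀ u ∈ Metric.ball x 1, ‖u‖ < m + 1 := by
      intro u hu
      have h := norm_sub_norm_le u x
      rw [mem_ball_iff_norm] at hu
      linarith
    rw [rieszConv_eq hn ρ (fun u hu => hφ1 m u (hball u hu)) hw,
      rieszConv_eq hn ρ (fun u hu => hφ2 m u (hball u hu)) hw2, add_sub_cancel_right,
      add_sub_cancel_right, sub_add_cancel, sub_add_cancel, extKS_laplacian hn ρ hw]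
  have l1 := (t1.const_add (rieszConv ρ w f x - outerConv ρ w f x)).const_smul
    ((w + 1) * (w + 1 + n))
  have l2 := t2.const_add (rieszConv ρ (w + 2) (coordLaplacian f) x -
    outerConv ρ (w + 2) (coordLaplacian f) x)
  have := tendsto_nhds_unique_of_eventuallyEq l1 l2 heq
  rwa [sub_add_cancel, sub_add_cancel] at this

/-- The functional equation `(w + 1)(w + 1 + n) r^w ⋆ f = r^(w+2) ⋆ Δf` for smooth fields such that
both sides converge. Cutoffs give it where `r^(w+2) ⋆ f` converges as well, and the rest follows by
analytic continuation in `w`. -/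
lemma rieszConv_coordLaplacian (hn : 0 < n) (ρ : CliffordRep n S) {f : Euc n → S}
    (hf : ContDiff ℝ ∞ f) {α β : ℝ} (h0 : HasDecay f α)
    (h1 : ∀ k, HasDecay (fun x => fderiv ℝ f x (e k)) α) (h2 : HasDecay (coordLaplacian f) β)
    {w : ℂ} (hw : w ∉ rieszPoles n) (hα : w.re + α < -n) (hβ : w.re + 2 + β < -n) (x : Euc n) :
    ((w + 1) * (w + 1 + n)) • rieszConv ρ w f x = rieszConv ρ (w + 2) (coordLaplacian f) x := by
  -- Both sides converge for `Re w < c`, and the additional hypothesis of the approximation argument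
  -- holds for `Re w < d`.
  set c : ℝ := min (-n - α) (-n - 2 - β) with hc
  set d : ℝ := min c (-n - 2 - α) with hd
  have hmem : ∀ {z : ℂ}, z.re ∈ Iio c → z.re + α < -n ∧ z.re + 2 + β < -n := by
    intro z hz
    have := lt_min_iff.1 (mem_Iio.1 hz)
    constructor <;> linarith [this.1, this.2]
  refine eq_of_eq_on_strip (F := fun w => ((w + 1) * (w + 1 + n)) • rieszConv ρ w f x)
    (G := fun w => rieszConv ρ (w + 2) (coordLaplacian f) x) (P := rieszPoles n)
    (D := Iio c) isOpen_Iio (convex_Iio c)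
    (fun _ h => im_eq_zero_of_mem_rieszPoles h) (fun z hz hzP => ?_) (fun z hz hzP => ?_)
    (a := d - 1) (b := d) (by linarith) (fun s hs => hs.2.trans_le (min_le_left _ _))
    (fun z hz hzP => ?_) (mem_Iio.2 (lt_min (by linarith) (by linarith))) hw
  · exact (by fun_prop : DifferentiableAt ℂ (fun z : ℂ => (z + 1) * (z + 1 + n)) z).smul
      (differentiableAt_rieszConv hn ρ hf hzP h0 (hmem hz).1 x)
  · exact DifferentiableAt.fun_comp' z (g := fun z => rieszConv ρ z (coordLaplacian f) x)
      (f := fun z => z + 2) (differentiableAt_rieszConv hn ρ (contDiff_coordLaplacian hf)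
        (add_two_notMem_rieszPoles hzP) h2 (by simpa using (hmem hz).2) x) (by fun_prop)
  · have h3 := lt_min_iff.1 hz.2
    exact rieszConv_coordLaplacian_aux hn ρ hf h0 h1 h2 hzP (by linarith [h3.2])
      (hmem h3.1).2 x

end Complete

/-! ### Iterated Mellin transforms -/

lemma intervalIntegrable_beta {a b : ℂ} (ha : 0 < a.re) (hb : 0 < b.re) {v : ℝ} (hv : 0 < v) :
    IntervalIntegrable (fun x : ℝ => (x : ℂ) ^ (a - 1) * ((v : ℂ) - x) ^ (b - 1)) volume 0 v := by
  -- The standard Beta integrand on `(0, 1)`, rescaled to `(0, v)`.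
  have h := (Complex.betaIntegral_convergent ha hb).comp_mul_left (c := v⁻¹)
  rw [zero_div, one_div, inv_inv] at h
  have h2 := h.const_mul ((v : ℂ) ^ (a + b - 2))
  refine h2.congr_ae ?_
  rw [uIoc_of_le hv.le, ← restrict_Ioo_eq_restrict_Ioc]
  refine (ae_restrict_iff' measurableSet_Ioo).2 (Eventually.of_forall fun x hx => ?_)
  have hvc : (v : ℂ) ≠ 0 := by exact_mod_cast hv.ne'
  have e1 : ((v⁻¹ * x : ℝ) : ℂ) ^ (a - 1) = ((v : ℂ) ^ (a - 1))⁻¹ * (x : ℂ) ^ (a - 1) := by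
    rw [Complex.ofReal_mul, Complex.mul_cpow_ofReal_nonneg (by positivity) hx.1.le,
      Complex.ofReal_inv, Complex.inv_cpow _ _ (by
        rw [Complex.arg_ofReal_of_nonneg hv.le]; exact Real.pi_pos.ne)]
  have e2 : (1 - ((v⁻¹ * x : ℝ) : ℂ)) ^ (b - 1) =
      ((v : ℂ) ^ (b - 1))⁻¹ * ((v : ℂ) - x) ^ (b - 1) := by
    have : (1 - ((v⁻¹ * x : ℝ) : ℂ)) = ((v⁻¹ : ℝ) : ℂ) * ((v - x : ℝ) : ℂ) := by
      push_cast
      field_simp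
    rw [this, Complex.mul_cpow_ofReal_nonneg (by positivity) (by linarith [hx.2]),
      Complex.ofReal_inv, Complex.inv_cpow _ _ (by
        rw [Complex.arg_ofReal_of_nonneg hv.le]; exact Real.pi_pos.ne)]
    push_cast
    rfl
  have e3 : (v : ℂ) ^ (a + b - 2) = (v : ℂ) ^ (a - 1) * (v : ℂ) ^ (b - 1) := by
    rw [← Complex.cpow_add _ _ hvc]
    congr 1
    ring
  have n1 : (v : ℂ) ^ (a - 1) ≠ 0 := by simp [Complex.cpow_eq_zero_iff, hvc]
  have n2 : (v : ℂ) ^ (b - 1) ≠ 0 := by simp [Complex.cpow_eq_zero_iff, hvc]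
  simp only
  rw [e1, e2, e3]
  field_simp

lemma norm_beta_integrand (a b : ℂ) {x v : ℝ} (hx : x ∈ Ioo 0 v) :
    ‖(x : ℂ) ^ (a - 1) * ((v : ℂ) - x) ^ (b - 1)‖ = x ^ (a.re - 1) * (v - x) ^ (b.re - 1) := by
  have h : (v : ℂ) - x = ((v - x : ℝ) : ℂ) := by push_cast; ring
  rw [norm_mul, h, Complex.norm_cpow_eq_rpow_re_of_pos hx.1,
    Complex.norm_cpow_eq_rpow_re_of_pos (by linarith [hx.2])]
  simp

/-- The `L¹` norm of the scaled Beta integrand. -/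
lemma integral_norm_beta (a b : ℂ) {v : ℝ} (hv : 0 < v) :
    ∫ x in Ioo 0 v, ‖(x : ℂ) ^ (a - 1) * ((v : ℂ) - x) ^ (b - 1)‖ ≤
      v ^ (a.re + b.re - 1) * ‖Complex.betaIntegral a.re b.re‖ := by
  have h1 : ((∫ x in Ioo 0 v, ‖(x : ℂ) ^ (a - 1) * ((v : ℂ) - x) ^ (b - 1)‖ : ℝ) : ℂ) =
      (v : ℂ) ^ ((a.re : ℂ) + b.re - 1) * Complex.betaIntegral a.re b.re := by
    rw [← Complex.betaIntegral_scaled _ _ hv, intervalIntegral.integral_of_le hv.le,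
      ← restrict_Ioo_eq_restrict_Ioc, ← integral_complex_ofReal]
    refine setIntegral_congr_fun measurableSet_Ioo fun x hx => ?_
    rw [norm_beta_integrand a b hx, Complex.ofReal_mul, Complex.ofReal_cpow hx.1.le,
      Complex.ofReal_cpow (by linarith [hx.2])]
    push_cast
    rfl
  have h2 := congrArg norm h1
  rw [norm_mul, Complex.norm_cpow_eq_rpow_re_of_pos hv, Complex.norm_real,
    Real.norm_of_nonneg (integral_nonneg fun _ => norm_nonneg _)] at h2
  rw [h2]
  simp

/-- The Mellin transform of `p ↦ ∫₀^∞ q^(b-1) V(p+q) dq`. -/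
lemma mellin_mellin_shift [CompleteSpace S] {a b : ℂ} (ha : 0 < a.re) (hb : 0 < b.re) {V : ℝ → S}
    (hVm : AEStronglyMeasurable V) (hV : MellinConvergent V (a + b)) :
    mellin (fun p => mellin (fun q => V (p + q)) b) a =
      Complex.betaIntegral a b • mellin V (a + b) := by
  -- With `v = p + q` the double integral extends over `0 < p < v`, and the integral over `p` is a
  -- Beta integral.
  set T : Set (ℝ × ℝ) := {p | 0 < p.1 ∧ p.1 < p.2} with hT
  have hTm : MeasurableSet T := by
    exact ((isOpen_lt continuous_const continuous_fst).inter
      (isOpen_lt continuous_fst continuous_snd)).measurableSet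
  set k : ℝ → ℝ → ℂ := fun p v => (p : ℂ) ^ (a - 1) * ((v : ℂ) - p) ^ (b - 1) with hk
  set H : ℝ × ℝ → S := T.indicator fun p => k p.1 p.2 • V p.2 with hH
  have hHv : ∀ v, (fun p => H (p, v)) = (Ioo 0 v).indicator fun p => k p v • V v := by
    intro v
    ext p
    by_cases hp : p ∈ Ioo 0 v
    · rw [indicator_of_mem hp, hH, indicator_of_mem (show (p, v) ∈ T from hp)]
    · rw [indicator_of_notMem hp, hH, indicator_of_notMem (show (p, v) ∉ T from hp)]
  have hHm : AEStronglyMeasurable H (volume.prod volume) := by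
    refine AEStronglyMeasurable.indicator (AEStronglyMeasurable.smul ?_ hVm.comp_snd) hTm
    refine Measurable.aestronglyMeasurable ?_
    exact ((Complex.measurable_ofReal.comp measurable_fst).pow_const _).mul
      (((Complex.measurable_ofReal.comp measurable_snd).sub
        (Complex.measurable_ofReal.comp measurable_fst)).pow_const _)
  have hkint : ∀ {v : ℝ}, 0 < v → IntegrableOn (fun p => k p v) (Ioo 0 v) := by
    intro v hv
    have := (intervalIntegrable_beta ha hb hv).1
    exact this.mono_set Ioo_subset_Ioc_self
  have hempty : ∀ {v : ℝ}, v ≤ 0 → Ioo 0 v = ∅ := fun hv => Ioo_eq_empty (not_lt.2 hv)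
  have hnot : ∀ {v : ℝ}, v ≤ 0 → v ∉ Ioi (0 : ℝ) := fun hv => not_lt.2 hv
  have hHi : Integrable H (volume.prod volume) := by
    rw [integrable_prod_iff' hHm]
    constructor
    · refine Eventually.of_forall fun v => ?_
      rw [hHv, integrable_indicator_iff measurableSet_Ioo]
      rcases lt_or_ge 0 v with hv | hv
      · exact (hkint hv).smul_const (V v)
      · rw [hempty hv]
        exact integrableOn_empty
    · have hn : Integrable ((Ioi (0 : ℝ)).indicator fun v : ℝ =>
          ‖(v : ℂ) ^ (a + b - 1) • V v‖ * ‖Complex.betaIntegral a.re b.re‖) := by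
        rw [integrable_indicator_iff measurableSet_Ioi]
        exact hV.norm.mul_const _
      refine hn.mono' hHm.norm.prod_swap.integral_prod_right' (Eventually.of_forall fun v => ?_)
      rw [Real.norm_of_nonneg (integral_nonneg fun _ => norm_nonneg _)]
      have e1 : (fun p => ‖H (p, v)‖) = (Ioo 0 v).indicator fun p => ‖k p v‖ * ‖V v‖ := by
        ext p
        rw [show H (p, v) = (fun p => H (p, v)) p from rfl, hHv, norm_indicator_eq_indicator_norm]
        simp only [norm_smul]
      rw [e1, integral_indicator measurableSet_Ioo]
      rcases lt_or_ge 0 v with hv | hv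
      · rw [indicator_of_mem (mem_Ioi.2 hv), integral_mul_const, norm_smul,
          Complex.norm_cpow_eq_rpow_re_of_pos hv]
        have h1 := integral_norm_beta a b hv
        have h2 : (a + b - 1).re = a.re + b.re - 1 := by simp
        rw [h2]
        calc _ ≤ v ^ (a.re + b.re - 1) * ‖Complex.betaIntegral a.re b.re‖ * ‖V v‖ := by gcongr
          _ = _ := by ring
      · rw [hempty hv, indicator_of_notMem (hnot hv)]
        simp
  have hL : ∀ p, ∫ v, H (p, v) = (Ioi (0 : ℝ)).indicator
      (fun p => (p : ℂ) ^ (a - 1) • mellin (fun q => V (p + q)) b) p := by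
    intro p
    rw [← integral_add_left_eq_self _ p]
    rcases lt_or_ge 0 p with hp | hp
    · rw [indicator_of_mem (mem_Ioi.2 hp), mellin, ← integral_smul, ← integral_indicator
        measurableSet_Ioi]
      refine integral_congr_ae (Eventually.of_forall fun q => ?_)
      simp only [hH]
      rcases lt_or_ge 0 q with hq | hq
      · rw [indicator_of_mem (mem_Ioi.2 hq), indicator_of_mem (show (p, p + q) ∈ T from
          ⟨hp, by simpa using hq⟩), hk]
        simp only
        rw [Complex.ofReal_add, add_sub_cancel_left, mul_smul]
      · rw [indicator_of_notMem (hnot hq), indicator_of_notMem]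
        exact fun h => not_lt.2 hq (by simpa using h.2)
    · rw [indicator_of_notMem (hnot hp)]
      have : ∀ v, H (p, p + v) = 0 := fun v => by
        rw [hH, indicator_of_notMem]
        exact fun h => not_lt.2 hp h.1
      simp [this]
  have hR : ∀ v, ∫ p, H (p, v) = (Ioi (0 : ℝ)).indicator
      (fun v => Complex.betaIntegral a b • ((v : ℂ) ^ (a + b - 1) • V v)) v := by
    intro v
    rw [hHv, integral_indicator measurableSet_Ioo]
    rcases lt_or_ge 0 v with hv | hv
    · rw [indicator_of_mem (mem_Ioi.2 hv), integral_smul_const, smul_smul, mul_comm,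
        ← Complex.betaIntegral_scaled _ _ hv, intervalIntegral.integral_of_le hv.le,
        ← restrict_Ioo_eq_restrict_Ioc]
    · rw [hempty hv, indicator_of_notMem (hnot hv)]
      simp
  have hswap := integral_integral_swap (f := fun p v => H (p, v)) hHi
  simp only [hL, hR] at hswap
  rw [integral_indicator measurableSet_Ioi, integral_indicator measurableSet_Ioi,
    integral_smul] at hswap
  exact hswap

/-! ### Composition of two Riesz convolutions -/

lemma integrableOn_rpow_mul_min {s a : ℝ} (hs : 0 < s) (hsa : s < a) :
    IntegrableOn (fun q : ℝ => q ^ (s - 1) * min 1 (q ^ (-a))) (Ioi 0) := by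
  have hc : ContinuousOn (fun q : ℝ => min 1 (q ^ (-a))) (Ioi 0) :=
    continuous_min.comp_continuousOn (continuousOn_const.prodMk fun q hq =>
      (Real.continuousAt_rpow_const q (-a) (Or.inl (ne_of_gt hq))).continuousWithinAt)
  refine mellin_convergent_of_isBigO_scalar (a := a) (b := 0)
    (hc.locallyIntegrableOn measurableSet_Ioi) ?_ hsa ?_ hs
  · refine Asymptotics.IsBigO.of_bound 1 ?_
    filter_upwards [eventually_gt_atTop 0] with q hq
    have h : 0 < q ^ (-a) := by positivity
    rw [Real.norm_of_nonneg (by positivity), Real.norm_of_nonneg h.le, one_mul]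
    exact min_le_right _ _
  · refine Asymptotics.IsBigO.of_bound 1 ?_
    filter_upwards [self_mem_nhdsWithin] with q hq
    have hq' : (0 : ℝ) < q := hq
    have h : 0 < q ^ (-a) := by positivity
    rw [Real.norm_of_nonneg (by positivity)]
    simp

lemma integrable_gaussian_poly {c : ℝ} (hc : 0 < c) :
    Integrable fun y : Euc n => (1 + ‖y‖) ^ 2 * Real.exp (-(c * ‖y‖ ^ 2)) := by
  have h := (GaussianFourier.integrable_cexp_neg_mul_sq_norm_add (V := Euc n)
    (b := ((c / 2 : ℝ) : ℂ)) (by rw [Complex.ofReal_re]; positivity) 0 0).norm.const_mul (2 + 4 / c)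
  refine h.mono' (by fun_prop : Continuous fun y : Euc n =>
    (1 + ‖y‖) ^ 2 * Real.exp (-(c * ‖y‖ ^ 2))).aestronglyMeasurable
    (Eventually.of_forall fun y => ?_)
  rw [Real.norm_of_nonneg (by positivity), Complex.norm_exp]
  have h1 : (-((c / 2 : ℝ) : ℂ) * (‖y‖ : ℂ) ^ 2 + 0 * ((inner ℝ (0 : Euc n) y : ℝ) : ℂ)).re =
      -(c / 2 * ‖y‖ ^ 2) := by
    rw [zero_mul, add_zero, ← Complex.ofReal_pow, ← Complex.ofReal_neg, ← Complex.ofReal_mul,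
      Complex.ofReal_re, neg_mul]
  rw [h1]
  set t : ℝ := c / 2 * ‖y‖ ^ 2 with ht
  have ht0 : 0 ≤ t := by positivity
  have h2 : -(c * ‖y‖ ^ 2) = -t + -t := by rw [ht]; ring
  have h3 : (1 + ‖y‖) ^ 2 ≤ (2 + 4 / c) * Real.exp t := by
    have e1 : 1 ≤ Real.exp t := Real.one_le_exp ht0
    have e2 : t ≤ Real.exp t := by linarith [Real.add_one_le_exp t]
    have e3 : ‖y‖ ^ 2 = 2 / c * t := by rw [ht]; field_simp
    have e4 : 2 / c * t ≤ 2 / c * Real.exp t := by gcongr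
    have e5 : 4 / c = 2 * (2 / c) := by ring
    rw [e5]
    nlinarith [sq_nonneg (1 - ‖y‖)]
  rw [h2, Real.exp_add, ← mul_assoc]
  refine mul_le_mul_of_nonneg_right ?_ (Real.exp_pos _).le
  rw [Real.exp_neg, ← div_eq_mul_inv, div_le_iff₀ (Real.exp_pos t)]
  exact h3

lemma aestronglyMeasurable_heatS (ψ : 𝓢(Euc n, S)) (x : Euc n) :
    AEStronglyMeasurable (fun p : ℝ × Euc n => heatS p.1 ψ (x - p.2))
      ((volume.restrict (Ioi 0)).prod volume) := by
  have hc : Continuous fun q : (ℝ × Euc n) × Euc n =>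
      Real.fourierChar ⟪q.2, x - q.1.2⟫_ℝ • (heatSymbol n q.1.1 q.2 • 𝓕 ψ q.2) := by
    have h1 : Continuous fun q : (ℝ × Euc n) × Euc n => Real.fourierChar ⟪q.2, x - q.1.2⟫_ℝ :=
      Real.continuous_fourierChar.comp (by fun_prop)
    have h2 : Continuous fun q : (ℝ × Euc n) × Euc n => heatSymbol n q.1.1 q.2 := by
      unfold heatSymbol
      fun_prop
    exact h1.smul (h2.smul ((𝓕 ψ).continuous.comp continuous_snd))
  have h := (hc.stronglyMeasurable.integral_prod_right' (ν := volume)).aestronglyMeasurable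
    (μ := (volume.restrict (Ioi 0)).prod volume)
  refine h.congr ?_
  have hr : (volume.restrict (Ioi (0 : ℝ))).prod (volume : Measure (Euc n)) =
      (volume.prod volume).restrict (Ioi 0 ×ˢ univ) := by
    rw [← Measure.prod_restrict, Measure.restrict_univ]
  rw [hr]
  refine (ae_restrict_iff' (measurableSet_Ioi.prod MeasurableSet.univ)).2
    (Eventually.of_forall fun p hp => ?_)
  have hp' : (0 : ℝ) < p.1 := hp.1
  exact (heatS_apply hp'.le ψ (x - p.2)).symm

lemma one_add_norm_sub_le (x y : Euc n) : 1 + ‖x - y‖ ≤ (1 + ‖x‖) * (1 + ‖y‖) := by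
  have := norm_sub_le x y
  nlinarith [mul_nonneg (norm_nonneg x) (norm_nonneg y)]

section Complete

variable [CompleteSpace S]

/-- The bounds for small and for large times, combined. -/
lemma exists_norm_heatS_diracS_le (ρ : CliffordRep n S) (φ : 𝓢(Euc n, S)) :
    ∃ C, 0 ≤ C ∧ ∀ p, 0 < p → ∀ u, ‖heatS p (diracS ρ φ) u‖ ≤
      C * (1 + ‖u‖) * min 1 (p ^ (-((n : ℝ) / 2 + 1))) := by
  choose C hC h using fun j : Fin n => exists_norm_heatS_lineDeriv_le j (clS ρ (e j) φ)
  obtain ⟨C₀, hC₀, h₀⟩ := exists_norm_heatS_le (diracS ρ φ)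
  have hsum : 0 ≤ ∑ j, C j := Finset.sum_nonneg fun j _ => hC j
  refine ⟨C₀ + ∑ j, C j, by positivity, fun p hp u => ?_⟩
  have hu : 1 ≤ 1 + ‖u‖ := by linarith [norm_nonneg u]
  have hexp : -((n : ℝ) / 2 + 1) = -(n : ℝ) / 2 - 1 := by ring
  have h1 : ‖heatS p (diracS ρ φ) u‖ ≤ (C₀ + ∑ j, C j) * (1 + ‖u‖) := by
    refine (h₀ p hp.le u).trans ?_
    nlinarith [norm_nonneg u]
  have h2 : ‖heatS p (diracS ρ φ) u‖ ≤ (C₀ + ∑ j, C j) * (1 + ‖u‖) *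
      p ^ (-((n : ℝ) / 2 + 1)) := by
    rw [diracS, map_sum, sum_apply_schwartz]
    have h3 : ∀ j ∈ (Finset.univ : Finset (Fin n)),
        ‖heatS p (clS ρ (e j) (∂_{(e j : Euc n)} φ)) u‖ ≤
        C j * (1 + ‖u‖) * p ^ (-((n : ℝ) / 2 + 1)) := fun j _ => by
      rw [← lineDerivOp_clS, hexp]
      exact h j p hp u
    refine (norm_sum_le_of_le _ h3).trans ?_
    rw [← Finset.sum_mul, ← Finset.sum_mul]
    gcongr
    linarith
  rcases min_choice 1 (p ^ (-((n : ℝ) / 2 + 1))) with hm | hm <;> rw [hm]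
  · simpa using h1
  · exact h2

/-- The Gaussian moments of the Mellin transform of the heat flow of a Dirac derivative. -/
lemma gaussian_heatMellin (ρ : CliffordRep n S) (φ : 𝓢(Euc n, S)) (x : Euc n) {b : ℂ}
    (h0 : 0 < b.re) (hb : b.re < (n : ℝ) / 2 + 1) {p : ℝ} (hp : 0 < p) :
    ∫ y, Real.exp (-(p⁻¹ * ‖y‖ ^ 2)) • cl ρ y (heatMellin (diracS ρ φ) (x - y) b) =
      (-(1 / 2) * Real.pi ^ ((n : ℝ) / 2) * p ^ ((n : ℝ) / 2 + 1) : ℝ) •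
        mellin (fun q => heatS (p + q) (-Δ φ) x) b := by
  set ψ := diracS ρ φ with hψ
  obtain ⟨C, hC, hbd⟩ := exists_norm_heatS_diracS_le ρ φ
  obtain ⟨K, hK, hcl⟩ := exists_norm_cl_le ρ
  -- The `y`-integral and the Mellin integral are exchanged; then `gaussian_moment` applies to the
  -- heat flow at time `q`, and `D² = -Δ`.
  set G : ℝ × Euc n → S := fun r => (r.1 : ℂ) ^ (b - 1) •
    (Real.exp (-(p⁻¹ * ‖r.2‖ ^ 2)) • cl ρ r.2 (heatS r.1 ψ (x - r.2))) with hG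
  have hclm : ∀ {μ : Measure (ℝ × Euc n)} {g : ℝ × Euc n → S}, AEStronglyMeasurable g μ →
      AEStronglyMeasurable (fun r => cl ρ r.2 (g r)) μ := by
    intro μ g hg
    have h1 : ∀ r : ℝ × Euc n, cl ρ r.2 (g r) = ∑ k, r.2 k • cl ρ (e k) (g r) := by
      intro r
      rw [cl_eq_sum ρ r.2, sum_apply]
      simp
    simp only [h1]
    refine Finset.aestronglyMeasurable_fun_sum _ fun k _ => ?_
    exact (by fun_prop : Continuous fun r : ℝ × Euc n => r.2 k).aestronglyMeasurable.smul
      ((cl ρ (e k)).continuous.comp_aestronglyMeasurable hg)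
  have hGm : AEStronglyMeasurable G ((volume.restrict (Ioi 0)).prod volume) := by
    have hexp : AEStronglyMeasurable (fun r : ℝ × Euc n => Real.exp (-(p⁻¹ * ‖r.2‖ ^ 2)))
        ((volume.restrict (Ioi 0)).prod volume) :=
      (by fun_prop : Continuous fun r : ℝ × Euc n =>
        Real.exp (-(p⁻¹ * ‖r.2‖ ^ 2))).aestronglyMeasurable
    exact ((Complex.measurable_ofReal.comp measurable_fst).pow_const
      (b - 1)).aestronglyMeasurable.smul (hexp.smul (hclm (aestronglyMeasurable_heatS ψ x)))
  have hGi : Integrable G ((volume.restrict (Ioi 0)).prod volume) := by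
    have hm := (integrableOn_rpow_mul_min h0 hb).mul_prod
      ((integrable_gaussian_poly (n := n) (inv_pos.2 hp)).const_mul (K * C * (1 + ‖x‖)))
    refine hm.mono' hGm ?_
    have hr : (volume.restrict (Ioi (0 : ℝ))).prod (volume : Measure (Euc n)) =
        (volume.prod volume).restrict (Ioi 0 ×ˢ univ) := by
      rw [← Measure.prod_restrict, Measure.restrict_univ]
    rw [hr]
    refine (ae_restrict_iff' (measurableSet_Ioi.prod MeasurableSet.univ)).2
      (Eventually.of_forall fun r hr => ?_)
    have hr' : (0 : ℝ) < r.1 := hr.1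
    rw [hG]
    simp only
    rw [norm_smul, norm_smul, Complex.norm_cpow_eq_rpow_re_of_pos hr',
      Real.norm_of_nonneg (Real.exp_pos _).le, Complex.sub_re, Complex.one_re]
    have e1 : ‖cl ρ r.2 (heatS r.1 ψ (x - r.2))‖ ≤ K * (1 + ‖r.2‖) *
        (C * ((1 + ‖x‖) * (1 + ‖r.2‖)) * min 1 (r.1 ^ (-((n : ℝ) / 2 + 1)))) := by
      refine ((cl ρ r.2).le_of_opNorm_le (hcl r.2) _).trans ?_
      have := hbd r.1 hr' (x - r.2)
      gcongr
      · linarith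
      · refine this.trans ?_
        gcongr
        exact one_add_norm_sub_le x r.2
    calc _ ≤ r.1 ^ (b.re - 1) * (Real.exp (-(p⁻¹ * ‖r.2‖ ^ 2)) * (K * (1 + ‖r.2‖) *
        (C * ((1 + ‖x‖) * (1 + ‖r.2‖)) * min 1 (r.1 ^ (-((n : ℝ) / 2 + 1)))))) := by gcongr
      _ = _ := by ring
  have hswap := integral_integral_swap (f := fun q y => G (q, y)) hGi
  have hR : ∀ y, ∫ q in Ioi (0 : ℝ), G (q, y) =
      Real.exp (-(p⁻¹ * ‖y‖ ^ 2)) • cl ρ y (heatMellin ψ (x - y) b) := by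
    intro y
    have hc := mellinConvergent_heatS (heatDecay_diracS ρ φ (x - y)) h0 hb
    have h2 : ∀ q : ℝ, G (q, y) = Real.exp (-(p⁻¹ * ‖y‖ ^ 2)) •
        cl ρ y ((q : ℂ) ^ (b - 1) • heatS q ψ (x - y)) := by
      intro q
      rw [hG]
      simp only
      rw [map_smul, smul_comm]
    simp only [h2]
    rw [integral_smul, ContinuousLinearMap.integral_comp_comm _ hc, heatMellin, mellin]
  simp only [hR] at hswap
  rw [← hswap, mellin, ← integral_smul]
  refine setIntegral_congr_fun measurableSet_Ioi fun q hq => ?_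
  have hq' : (0 : ℝ) < q := hq
  simp only [hG]
  rw [integral_smul, gaussian_moment ρ hp, ← heatS_diracS ρ hq', heatS_heatS hp.le hq'.le, hψ,
    diracS_diracS, smul_comm]

omit [CompleteSpace S] in
lemma integrable_gaussian_cl_of_hasDecay (ρ : CliffordRep n S) {f : Euc n → S} (hf : Continuous f)
    (hd : HasDecay f 1) {p : ℝ} (hp : 0 < p) (x : Euc n) :
    Integrable fun y => Real.exp (-(p⁻¹ * ‖y‖ ^ 2)) • cl ρ y (f (x - y)) := by
  obtain ⟨C, hC, hd⟩ := hd
  obtain ⟨K, hK, hcl⟩ := exists_norm_cl_le ρ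
  refine ((integrable_gaussian_poly (n := n) (inv_pos.2 hp)).const_mul
    (K * C * (1 + ‖x‖))).mono' ?_ (Eventually.of_forall fun y => ?_)
  · exact ((by fun_prop : Continuous fun y : Euc n => Real.exp (-(p⁻¹ * ‖y‖ ^ 2))).smul
      ((continuous_cl ρ).clm_apply
        (hf.comp (continuous_const.sub continuous_id)))).aestronglyMeasurable
  · rw [norm_smul, Real.norm_of_nonneg (Real.exp_pos _).le]
    have e1 : ‖cl ρ y (f (x - y))‖ ≤ K * (1 + ‖y‖) * (C * ((1 + ‖x‖) * (1 + ‖y‖))) := by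
      refine ((cl ρ y).le_of_opNorm_le (hcl y) _).trans ?_
      have h := hd (x - y)
      rw [Real.rpow_one] at h
      gcongr
      · linarith
      · refine h.trans ?_
        gcongr
        exact one_add_norm_sub_le x y
    calc _ ≤ Real.exp (-(p⁻¹ * ‖y‖ ^ 2)) * (K * (1 + ‖y‖) * (C * ((1 + ‖x‖) * (1 + ‖y‖)))) := by
          gcongr
      _ = _ := by ring

lemma re_half_exponent (n : ℕ) (z : ℂ) : ((z + n + 1) / 2).re = (z.re + n + 1) / 2 := by
  rw [show (z + n + 1) / 2 = (z + n + 1) / ((2 : ℝ) : ℂ) by norm_num, Complex.div_ofReal_re]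
  simp

/-- In the range where everything converges, the composition of two Riesz convolutions is computed
by the semigroup law of the heat flow. -/
lemma symKS_symKS (hn : 0 < n) (ρ : CliffordRep n S) {w z : ℂ} (hw : -(n : ℝ) - 1 < w.re)
    (hw1 : w.re < 1) (hz : -(n : ℝ) - 1 < z.re) (hz1 : z.re < 1) (hwz : w.re + z.re < -n)
    (φ : 𝓢(Euc n, S)) (x : Euc n) :
    symKS ρ w (symKS ρ z φ) x = (heatConst n w * heatConst n z *
      Complex.betaIntegral ((w + n + 1) / 2) ((z + n + 1) / 2)) •
        heatMellin (-Δ φ) x ((w + n + 1) / 2 + (z + n + 1) / 2) := by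
  have hext : extKS ρ z φ = symKS ρ z φ := funext (extKS_of_lt ρ hz φ)
  have hzP : z ∉ rieszPoles n := fun h => by
    have := re_le_of_mem_rieszPoles h
    linarith
  have hsm : ContDiff ℝ ∞ (symKS ρ z φ) := hext ▸ contDiff_extKS hn ρ hzP φ
  have hd := hasDecay_symKS hn ρ hz φ
  set a : ℂ := (w + n + 1) / 2 with ha
  set b : ℂ := (z + n + 1) / 2 with hb
  have ha' : a.re = (w.re + n + 1) / 2 := re_half_exponent n w
  have hb' : b.re = (z.re + n + 1) / 2 := re_half_exponent n z
  have ha0 : 0 < a.re := by rw [ha']; linarith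
  have hb0 : 0 < b.re := by rw [hb']; linarith
  have hb1 : b.re < (n : ℝ) / 2 + 1 := by rw [hb']; linarith
  have hab : (a + b).re < (n : ℝ) / 2 + 1 := by rw [Complex.add_re, ha', hb']; linarith
  have hdec : HasDecay (symKS ρ z φ) 1 := hd.mono hz1.le
  -- Cut off at negative times, where the heat symbol is not of temperate growth.
  set V : ℝ → S := (Ioi (0 : ℝ)).indicator fun v => heatS v (-Δ φ) x with hV
  have hVeq : ∀ v, 0 < v → V v = heatS v (-Δ φ) x := fun v hv => indicator_of_mem (mem_Ioi.2 hv) _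
  have hMel : ∀ (s : ℂ), mellin V s = heatMellin (-Δ φ) x s := fun s =>
    setIntegral_congr_fun measurableSet_Ioi fun v hv => by simp only [hVeq v hv]
  have hMel2 : ∀ p, 0 < p → mellin (fun q => V (p + q)) b =
      mellin (fun q => heatS (p + q) (-Δ φ) x) b := fun p hp =>
    setIntegral_congr_fun measurableSet_Ioi fun q hq => by
      simp only [hVeq (p + q) (add_pos hp hq)]
  have hVm : AEStronglyMeasurable V := by
    rw [aestronglyMeasurable_indicator_iff measurableSet_Ioi]
    exact (continuousOn_heatS _ x).aestronglyMeasurable measurableSet_Ioi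
  have hdecΔ : HeatDecay (-Δ φ) x ((n : ℝ) / 2 + 1) := by
    rw [← neg_one_smul ℂ]
    exact (heatDecay_laplacian φ x).smul _
  have hVc : MellinConvergent V (a + b) := by
    refine (mellinConvergent_heatS hdecΔ (b := a + b) (by simp; linarith) hab).congr_fun
      (fun v hv => ?_) measurableSet_Ioi
    simp only [hVeq v hv]
  -- The outer convolution is a Mellin transform of Gaussian moments, and these are
  -- `gaussian_heatMellin`; the heat flows at times `p` and `q` combine to time `p + q`.
  rw [symKS_eq_mellin_gaussian ρ hsm.continuous hw1 x (integrable_sym hn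
    (hsm.of_le (by norm_num)) hd hw hwz x)]
  have hkey := heatMellin_of_gaussian_moment (n := n) (M := fun p => (1 / 2 : ℂ) •
      ∫ y, Real.exp (-(p⁻¹ * ‖y‖ ^ 2)) • cl ρ y (symKS ρ z φ (x - y) - symKS ρ z φ (x + y)))
      (U := fun p => heatConst n z • mellin (fun q => V (p + q)) b) (fun p hp => by
    rw [half_integral_sym ρ p⁻¹ x (integrable_gaussian_cl_of_hasDecay ρ hsm.continuous hdec hp x)]
    have h1 : ∀ y, Real.exp (-(p⁻¹ * ‖y‖ ^ 2)) • cl ρ y (symKS ρ z φ (x - y)) =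
        heatConst n z • (Real.exp (-(p⁻¹ * ‖y‖ ^ 2)) •
          cl ρ y (heatMellin (diracS ρ φ) (x - y) b)) := by
      intro y
      rw [symKS_eq_heatMellin hn ρ hz hz1, map_smul, smul_comm]
    simp only [h1]
    rw [integral_smul, gaussian_heatMellin ρ φ x hb0 hb1 hp, hMel2 p hp, smul_comm]) w
  simp only [inv_inv] at hkey
  rw [hkey, mellin_const_smul, mellin_mellin_shift ha0 hb0 hVm hVc, hMel, smul_smul, smul_smul,
    mul_assoc]

/-- The fundamental theorem of calculus along the heat flow: `-∫₀^∞ exp(p Δ / 4) Δφ dp = 4 φ`. -/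
lemma heatMellin_laplacian_one (hn : 0 < n) (φ : 𝓢(Euc n, S)) (x : Euc n) :
    heatMellin (-Δ φ) x 1 = (4 : ℂ) • φ x := by
  have hn0 : (0 : ℝ) < n := by exact_mod_cast hn
  have hc := mellinConvergent_heatS (heatDecay_laplacian φ x) (b := 1) (by simp) (by simp; linarith)
  have hint : IntegrableOn (fun p => (1 / 4 : ℝ) • heatS p (Δ φ) x) (Ioi 0) := by
    have : IntegrableOn (fun p => heatS p (Δ φ) x) (Ioi 0) := by
      simpa [MellinConvergent] using hc
    exact this.smul _
  have hcont : ContinuousWithinAt (fun p => heatS p φ x) (Ici 0) 0 := by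
    rw [← continuousWithinAt_Ioi_iff_Ici, ContinuousWithinAt, heatS_zero]
    exact tendsto_heatS_zero φ x
  have htop : Tendsto (fun p => heatS p φ x) atTop (𝓝 0) := by
    obtain ⟨C, hC⟩ := heatDecay_self φ x
    have hlim : Tendsto (fun p : ℝ => C * p ^ (-((n : ℝ) / 2))) atTop (𝓝 0) := by
      simpa using (tendsto_rpow_neg_atTop (y := (n : ℝ) / 2) (by positivity)).const_mul C
    rw [tendsto_zero_iff_norm_tendsto_zero]
    refine squeeze_zero' (Eventually.of_forall fun _ => norm_nonneg _) ?_ hlim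
    filter_upwards [eventually_gt_atTop 0] with p hp
    exact hC p hp
  have key := integral_Ioi_of_hasDerivAt_of_tendsto hcont (fun p hp => hasDerivAt_heatS φ x hp)
    hint htop
  rw [integral_smul, heatS_zero, zero_sub] at key
  have h1 : heatMellin (Δ φ) x 1 = ∫ p in Ioi (0 : ℝ), heatS p (Δ φ) x := by
    simp [heatMellin, mellin]
  rw [heatMellin_neg, h1]
  have h2 : ∫ p in Ioi (0 : ℝ), heatS p (Δ φ) x =
      (4 : ℝ) • ((1 / 4 : ℝ) • ∫ p in Ioi (0 : ℝ), heatS p (Δ φ) x) := by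
    rw [smul_smul]
    norm_num
  rw [h2, key, smul_neg, neg_neg, ← Complex.coe_smul]
  norm_num

lemma differentiable_heatConst (n : ℕ) : Differentiable ℂ (heatConst n) := by
  have h := Complex.differentiable_one_div_Gamma
  exact (differentiable_const _).mul (h.comp (by fun_prop : Differentiable ℂ
    fun z : ℂ => (1 - z) / 2))

lemma half_exponent_ne (n : ℕ) {w : ℂ} (hw : w ∉ rieszPoles n) (m : ℕ) :
    (w + n + 1) / 2 ≠ -m := by
  intro h
  refine hw ⟨m, ?_⟩
  linear_combination 2 * h

/-- The inversion formula: on a strip of exponents `z`, the Riesz convolution of exponent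
`-2n - z` is a multiple of the inverse of the Riesz convolution of exponent `z`. -/
lemma rieszConv_inversion_strip (hn : 0 < n) (ρ : CliffordRep n S) {z : ℂ}
    (hz : -(n : ℝ) - 1 < z.re) (hz1 : z.re < 1) (hw : -2 * (n : ℂ) - z ∉ rieszPoles n)
    (φ : 𝓢(Euc n, S)) (x : Euc n) :
    rieszConv ρ (-2 * n - z) (extKS ρ z φ) x =
      (-(spinorConst n (-2 * n - z) * spinorConst n z)) • φ x := by
  have hn0 : (0 : ℝ) < n := by exact_mod_cast hn
  have hzP : z ∉ rieszPoles n := fun h => by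
    have := re_le_of_mem_rieszPoles h
    linarith
  have hext : extKS ρ z φ = symKS ρ z φ := funext (extKS_of_lt ρ hz φ)
  have hsm := contDiff_extKS hn ρ hzP φ
  have hd := hasDecay_extKS hn ρ hzP φ
  set b : ℂ := (z + n + 1) / 2 with hb
  have hb' : b.re = (z.re + n + 1) / 2 := re_half_exponent n z
  have hb0 : 0 < b.re := by rw [hb']; linarith
  have hdecΔ : HeatDecay (-Δ φ) x ((n : ℝ) / 2 + 1) := by
    rw [← neg_one_smul ℂ]
    exact (heatDecay_laplacian φ x).smul _
  have hre : ∀ w : ℂ, ((w + n + 1) / 2 + b).re = (w.re + z.re) / 2 + n + 1 := by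
    intro w
    rw [Complex.add_re, re_half_exponent, hb']
    ring
  -- Continuation in `w`, for fixed `z`, from the range of `symKS_symKS` to `w = -2n - z`. The
  -- interval `D` is where the outer convolution and the Mellin transform both converge.
  set D : Set ℝ := Ioo (-z.re - 2 * n - 2) (-n - z.re) with hD
  have key := eq_of_eq_on_strip (F := fun w => rieszConv ρ w (extKS ρ z φ) x)
    (G := fun w => (heatConst n w * heatConst n z * (Complex.Gamma ((w + n + 1) / 2) *
      Complex.Gamma b * (Complex.Gamma ((w + n + 1) / 2 + b))⁻¹)) •
        heatMellin (-Δ φ) x ((w + n + 1) / 2 + b)) (P := rieszPoles n) (D := D) isOpen_Ioo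
    (convex_Ioo _ _) (fun _ h => im_eq_zero_of_mem_rieszPoles h)
    (fun w hw hwP => differentiableAt_rieszConv hn ρ hsm hwP hd (by linarith [hw.2]) x)
    (fun w hw hwP => ?_) (a := max (-n - 1) (-z.re - 2 * n - 2)) (b := min 1 (-n - z.re))
    (max_lt (lt_min (by linarith) (by linarith)) (lt_min (by linarith) (by linarith)))
    (fun s hs => ⟨(le_max_right _ _).trans_lt hs.1, hs.2.trans_le (min_le_right _ _)⟩)
    (fun w hw hwP => ?_) (z := -2 * n - z) ?_ hw
  · rw [key]
    -- At `w = -2n - z` the Mellin exponent is `1` and `Γ(a + b) = Γ(1) = 1`.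
    have e1 : (-2 * (n : ℂ) - z + n + 1) / 2 + b = 1 := by rw [hb]; ring
    rw [e1, heatMellin_laplacian_one hn, smul_smul]
    congr 1
    rw [Complex.Gamma_one, inv_one, mul_one, spinorConst_eq, spinorConst_eq, heatConst, heatConst]
    have e2 : (2 : ℂ) ^ (-2 * (n : ℂ) - z + n) * (2 : ℂ) ^ (z + n) = 1 := by
      rw [← Complex.cpow_add _ _ two_ne_zero]
      have : -2 * (n : ℂ) - z + n + (z + n) = 0 := by ring
      rw [this, Complex.cpow_zero]
    have e3 : (-2 * (n : ℂ) - z + 1 + n) / 2 = (-2 * (n : ℂ) - z + n + 1) / 2 := by ring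
    have e4 : (z + 1 + n) / 2 = b := by rw [hb]; ring
    rw [e3, e4]
    generalize Complex.Gamma ((-2 * (n : ℂ) - z + n + 1) / 2) = A
    generalize Complex.Gamma b = B
    generalize (Complex.Gamma ((1 - (-2 * (n : ℂ) - z)) / 2))⁻¹ = A'
    generalize (Complex.Gamma ((1 - z) / 2))⁻¹ = B'
    generalize (Real.pi : ℂ) ^ ((n : ℂ) / 2) = p
    linear_combination (p * p * A * B * A' * B' * Complex.I ^ 2) * e2 +
      (p * p * A * B * A' * B') * Complex.I_sq
  · have h1 : DifferentiableAt ℂ (fun w : ℂ => Complex.Gamma ((w + n + 1) / 2)) w :=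
      DifferentiableAt.fun_comp' w (g := Complex.Gamma) (f := fun w : ℂ => (w + n + 1) / 2)
        (Complex.differentiableAt_Gamma _ (half_exponent_ne n hwP)) (by fun_prop)
    have h2 : DifferentiableAt ℂ (fun w : ℂ => (Complex.Gamma ((w + n + 1) / 2 + b))⁻¹) w :=
      DifferentiableAt.fun_comp' w (g := fun s => (Complex.Gamma s)⁻¹)
        (f := fun w : ℂ => (w + n + 1) / 2 + b)
        (Complex.differentiable_one_div_Gamma _) (by fun_prop)
    have h3 : DifferentiableAt ℂ (fun w : ℂ => heatMellin (-Δ φ) x ((w + n + 1) / 2 + b)) w :=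
      DifferentiableAt.fun_comp' w (g := heatMellin (-Δ φ) x)
        (f := fun w : ℂ => (w + n + 1) / 2 + b)
        (differentiableAt_heatMellin hdecΔ (by rw [hre]; linarith [hw.1])
          (by rw [hre]; linarith [hw.2])) (by fun_prop)
    exact (((differentiable_heatConst n w).mul_const _).mul
      ((h1.mul_const _).mul h2)).smul h3
  · have h1 := max_lt_iff.1 hw.1
    have h2 := lt_min_iff.1 hw.2
    rw [rieszConv_eq_symKS hn ρ hsm h1.1 hd (by linarith [h2.2]), hext,
      symKS_symKS hn ρ h1.1 h2.1 hz hz1 (by linarith [h2.2]),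
      Complex.betaIntegral_eq_Gamma_mul_div _ _ (by rw [re_half_exponent]; linarith [h1.1]) hb0,
      ← hb, div_eq_mul_inv]
  · simp only [hD, mem_Ioo, Complex.sub_re, Complex.mul_re, Complex.neg_re, Complex.re_ofNat,
      Complex.natCast_re, Complex.natCast_im, mul_zero, sub_zero]
    constructor <;> linarith

end Complete

/-! ### The inversion formula and the composite operator -/

/-- The constants satisfy the functional equation of the Riesz kernel up to sign. -/
lemma spinorConst_add_two {z : ℂ} (hz : z ∉ rieszPoles n) :
    spinorConst n (z + 2) = -((z + 1) * (z + 1 + n)) * spinorConst n z := by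
  have h0 : (z + 1 + n) / 2 ≠ 0 := by
    intro h
    refine hz ⟨0, ?_⟩
    push_cast
    linear_combination 2 * h
  have e1 : (z + 2 + 1 + n) / 2 = (z + 1 + n) / 2 + 1 := by ring
  have e2 : (1 - z) / 2 = (1 - (z + 2)) / 2 + 1 := by ring
  have e3 : (2 : ℂ) ^ (z + 2 + n) = 4 * (2 : ℂ) ^ (z + n) := by
    rw [show z + 2 + n = (2 : ℕ) + (z + n) by push_cast; ring, Complex.cpow_add _ _ two_ne_zero,
      Complex.cpow_natCast]
    norm_num
  rw [spinorConst_eq, spinorConst_eq, e1, Complex.Gamma_add_one _ h0, e3,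
    Complex.one_div_Gamma_eq_self_mul_one_div_Gamma_add_one, ← e2]
  ring

section Complete

variable [CompleteSpace S]

omit [CompleteSpace S] in
lemma extKS_sum (hn : 0 < n) (ρ : CliffordRep n S) {z : ℂ} (hz : z ∉ rieszPoles n) {ι : Type*}
    (s : Finset ι) (f : ι → 𝓢(Euc n, S)) (x : Euc n) :
    extKS ρ z (∑ i ∈ s, f i) x = ∑ i ∈ s, extKS ρ z (f i) x := by
  classical
  induction s using Finset.induction_on with
  | empty =>
    have := extKS_smul ρ hz 0 (0 : 𝓢(Euc n, S)) x
    simpa using this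
  | insert i s hi ih => rw [Finset.sum_insert hi, Finset.sum_insert hi, extKS_add hn ρ hz, ih]

lemma coordLaplacian_extKS (hn : 0 < n) (ρ : CliffordRep n S) {z : ℂ} (hz : z ∉ rieszPoles n)
    (φ : 𝓢(Euc n, S)) : coordLaplacian (extKS ρ z φ) = extKS ρ z (Δ φ) := by
  ext x
  rw [laplacian_eq_sum_e, extKS_sum hn ρ hz, coordLaplacian]
  refine Finset.sum_congr rfl fun k _ => ?_
  have : (fun y => fderiv ℝ (extKS ρ z φ) y (e k)) = extKS ρ z (∂_{(e k : Euc n)} φ) :=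
    funext fun y => fderiv_extKS hn ρ hz φ y (e k)
  rw [this, fderiv_extKS hn ρ hz]

lemma hasDecay_fderiv_extKS (hn : 0 < n) (ρ : CliffordRep n S) {z : ℂ} (hz : z ∉ rieszPoles n)
    (φ : 𝓢(Euc n, S)) (v : Euc n) : HasDecay (fun x => fderiv ℝ (extKS ρ z φ) x v) z.re := by
  have : (fun y => fderiv ℝ (extKS ρ z φ) y v) = extKS ρ z (∂_{v} φ : 𝓢(Euc n, S)) :=
    funext fun y => fderiv_extKS hn ρ hz φ y v
  rw [this]
  exact hasDecay_extKS hn ρ hz _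

/-- The effect on compositions of moving two units from the inner exponent to the outer one. -/
lemma rieszConv_extKS_shift (hn : 0 < n) (ρ : CliffordRep n S) {w z : ℂ} (hw : w ∉ rieszPoles n)
    (hz : z ∉ rieszPoles n) (hwz : w + 2 = -2 * n - z) (φ : 𝓢(Euc n, S)) (x : Euc n) :
    ((w + 1) * (w + 1 + n)) • rieszConv ρ w (extKS ρ (z + 2) φ) x =
      rieszConv ρ (w + 2) (extKS ρ z (((z + 1) * (z + 1 + n)) • φ)) x := by
  have hn0 : (0 : ℝ) < n := by exact_mod_cast hn
  have hz2 := add_two_notMem_rieszPoles hz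
  have hre : w.re + 2 = -2 * n - z.re := by
    have := congrArg Complex.re hwz
    simpa using this
  have hlap : coordLaplacian (extKS ρ (z + 2) φ) =
      extKS ρ z (((z + 1) * (z + 1 + n)) • φ) := by
    rw [coordLaplacian_extKS hn ρ hz2]
    ext y
    rw [extKS_smul ρ hz, extKS_laplacian hn ρ hz]
  have hre2 : (z + 2).re = z.re + 2 := by simp
  rw [rieszConv_coordLaplacian hn ρ (contDiff_extKS hn ρ hz2 φ) (hasDecay_extKS hn ρ hz2 φ)
    (fun k => hasDecay_fderiv_extKS hn ρ hz2 φ (e k)) (β := z.re)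
    (hlap ▸ hasDecay_extKS hn ρ hz _) hw (by linarith) (by linarith), hlap]

/-- The inversion formula: the Riesz convolutions with exponents `z` and `-2n - z` are inverse to
each other up to a constant. It spreads from the strip of `rieszConv_inversion_strip` to all
admissible exponents by steps of two. -/
lemma rieszConv_inversion (hn : 0 < n) (ρ : CliffordRep n S) {z : ℂ} (hz : z ∉ rieszPoles n)
    (hw : -2 * (n : ℂ) - z ∉ rieszPoles n) (φ : 𝓢(Euc n, S)) (x : Euc n) :
    rieszConv ρ (-2 * n - z) (extKS ρ z φ) x =
      (-(spinorConst n (-2 * n - z) * spinorConst n z)) • φ x := by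
  have hn0 : (0 : ℝ) < n := by exact_mod_cast hn
  -- Exponents with `Re z ≥ 1`: the step from `z - 2` to `z`.
  have hup : ∀ m : ℕ, ∀ z : ℂ, -(n : ℝ) - 1 < z.re → z.re < 1 + 2 * m →
      -2 * (n : ℂ) - z ∉ rieszPoles n → ∀ φ : 𝓢(Euc n, S),
      rieszConv ρ (-2 * n - z) (extKS ρ z φ) x =
        (-(spinorConst n (-2 * n - z) * spinorConst n z)) • φ x := by
    intro m
    induction m with
    | zero =>
      intro z h1 h2 hw φ
      exact rieszConv_inversion_strip hn ρ h1 (by simpa using h2) hw φ x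
    | succ m ih =>
      intro z h1 h2 hw φ
      rcases lt_or_ge z.re 1 with h3 | h3
      · exact rieszConv_inversion_strip hn ρ h1 h3 hw φ x
      · obtain ⟨z', rfl⟩ : ∃ z', z = z' + 2 := ⟨z - 2, by ring⟩
        simp only [Complex.add_re, Complex.re_ofNat] at h1 h2 h3
        push_cast at h2
        have hz' : z' ∉ rieszPoles n := fun h => by
          have := re_le_of_mem_rieszPoles h
          linarith
        set w : ℂ := -2 * n - (z' + 2) with hwdef
        have hw2 : w + 2 = -2 * n - z' := by rw [hwdef]; ring
        have hc : (w + 1) * (w + 1 + n) ≠ 0 := by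
          refine factor_ne_zero hw fun h => ?_
          have hre := congrArg Complex.re hw2
          simp only [h, Complex.add_re, Complex.neg_re, Complex.one_re, Complex.re_ofNat,
            Complex.sub_re, Complex.mul_re, Complex.natCast_re, Complex.natCast_im, mul_zero,
            sub_zero] at hre
          linarith
        have hs := rieszConv_extKS_shift hn ρ hw hz' hw2 φ x
        rw [hw2, ih z' (by linarith) (by linarith) (hw2 ▸ add_two_notMem_rieszPoles hw), ← hw2,
          spinorConst_add_two hw, smul_apply, smul_smul] at hs
        rw [← smul_right_inj hc, hs, smul_smul, spinorConst_add_two hz']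
        congr 1
        ring
  -- Exponents with `Re z ≤ -n - 1`: the step from `z + 2` to `z`.
  refine induction_off_poles (n := n) (p := fun z => -2 * (n : ℂ) - z ∉ rieszPoles n →
    ∀ φ : 𝓢(Euc n, S), rieszConv ρ (-2 * n - z) (extKS ρ z φ) x =
        (-(spinorConst n (-2 * n - z) * spinorConst n z)) • φ x) ?_ ?_ hz hw φ
  · intro z hz hw φ
    obtain ⟨m, hm⟩ := exists_nat_gt z.re
    exact hup m z hz (by linarith [Nat.cast_nonneg (α := ℝ) m]) hw φ
  · intro z hz hzP ih hw φ
    set w : ℂ := -2 * n - (z + 2) with hwdef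
    have hw2 : w + 2 = -2 * n - z := by rw [hwdef]; ring
    -- `Re w = -2n - 2 - Re z ≥ -n - 1`, so `w` could only be the first pole; but then `z` is
    -- the same pole.
    have hwP : w ∉ rieszPoles n := by
      intro h
      have h1 := re_le_of_mem_rieszPoles h
      have h2 := im_eq_zero_of_mem_rieszPoles h
      have hre := congrArg Complex.re hw2
      have him := congrArg Complex.im hw2
      simp only [Complex.add_re, Complex.re_ofNat, Complex.sub_re, Complex.mul_re, Complex.neg_re,
        Complex.natCast_re, Complex.natCast_im, mul_zero, sub_zero] at hre
      simp only [h2, Complex.add_im, Complex.im_ofNat, Complex.sub_im, Complex.mul_im,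
        Complex.neg_im, Complex.natCast_re, Complex.natCast_im, mul_zero, neg_zero,
        zero_mul, add_zero, zero_sub] at him
      refine hzP ⟨0, Complex.ext ?_ ?_⟩
      · simp
        linarith
      · simp
        linarith
    have hc : (z + 1) * (z + 1 + n) ≠ 0 := factor_ne_zero hzP fun h => by
      simp only [h, Complex.neg_re, Complex.one_re] at hz
      linarith
    have hs := rieszConv_extKS_shift hn ρ hwP hzP hw2 (((z + 1) * (z + 1 + n))⁻¹ • φ) x
    rw [smul_inv_smul₀ hc, ih hwP, smul_apply, smul_smul, smul_smul] at hs
    rw [← hw2, ← hs, spinorConst_add_two hwP, spinorConst_add_two hzP]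
    congr 1
    generalize (z + 1) * (z + 1 + n) = c at hc ⊢
    field_simp

lemma coordLaplacian_coord_smul_extKS (hn : 0 < n) (ρ : CliffordRep n S) (k : Fin n) {z : ℂ}
    (hz : z ∉ rieszPoles n) (φ : 𝓢(Euc n, S)) :
    coordLaplacian (fun x => x k • extKS ρ z φ x) = extKS ρ z (weightedOp ρ k z φ) := by
  ext x
  have hχ : ContDiff ℝ ∞ fun x : Euc n => x k := (EuclideanSpace.proj k : Euc n →L[ℝ] ℝ).contDiff
  have hd : ∀ y v : Euc n, fderiv ℝ (fun x : Euc n => x k) y v = v k := fun y v => by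
    rw [show (fun x : Euc n => x k) = (EuclideanSpace.proj k : Euc n →L[ℝ] ℝ) from rfl,
      ContinuousLinearMap.fderiv]
    rfl
  rw [coordLaplacian_smul hχ (contDiff_extKS hn ρ hz φ), coordLaplacian_extKS hn ρ hz,
    ← coord_smul_extKS_laplacian hn ρ k hz]
  congr 1
  simp only [hd, fderiv_fun_const, Pi.zero_apply, zero_apply, zero_smul, add_zero,
    fderiv_extKS hn ρ hz]
  rw [Finset.sum_eq_single k]
  · rw [← Complex.coe_smul]
    simp [e]
  · intro j _ hj
    simp [e, hj.symm]
  · simp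

/-- The composition of the two Riesz convolutions of exponents `z` and `-2n - 2 - z`, with the
multiplication by a coordinate in between, is a second order differential operator. -/
lemma rieszConv_coord_smul_extKS (hn : 0 < n) (ρ : CliffordRep n S) (k : Fin n) {w z : ℂ}
    (hwz : w = -2 * n - 2 - z) (hz : z ∉ rieszPoles n) (hw : w ∉ rieszPoles n) (φ : 𝓢(Euc n, S))
    (x : Euc n) :
    rieszConv ρ w (fun y => y k • extKS ρ z φ y) x =
      (spinorConst n w * spinorConst n z) • weightedOp ρ k z φ x := by
  have hn0 : (0 : ℝ) < n := by exact_mod_cast hn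
  have hz2 := add_two_notMem_rieszPoles hz
  by_cases h1 : z = -1
  · -- The functional equation degenerates at the inner exponent, and is used for the outer one.
    have hw2 : w + 2 = -2 * n - z := by rw [hwz]; ring
    have hre : w.re + z.re = -2 * n - 2 := by
      have := congrArg Complex.re hwz
      simp only [Complex.sub_re, Complex.mul_re, Complex.neg_re, Complex.re_ofNat,
        Complex.natCast_re, Complex.natCast_im, mul_zero, sub_zero] at this
      linarith
    have hw1 : w ≠ -1 := by
      intro h
      rw [h, h1] at hre
      simp only [Complex.neg_re, Complex.one_re] at hre
      linarith
    have hc := factor_ne_zero hw hw1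
    have hlap := coordLaplacian_coord_smul_extKS hn ρ k hz φ
    have hχ : ContDiff ℝ ∞ fun x : Euc n => x k :=
      (EuclideanSpace.proj k : Euc n →L[ℝ] ℝ).contDiff
    have hsm := contDiff_extKS hn ρ hz φ
    have hfd : ∀ j, HasDecay (fun y => fderiv ℝ (fun y => y k • extKS ρ z φ y) y (e j))
        (z.re + 1) := by
      intro j
      have : (fun y => fderiv ℝ (fun y => y k • extKS ρ z φ y) y (e j)) = fun y =>
          y k • fderiv ℝ (extKS ρ z φ) y (e j) + ((e j : Euc n) k : ℂ) • extKS ρ z φ y := by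
        ext y
        rw [fderiv_smul_apply' hχ hsm, Complex.coe_smul]
        congr 2
        rw [show (fun x : Euc n => x k) = (EuclideanSpace.proj k : Euc n →L[ℝ] ℝ) from rfl,
          ContinuousLinearMap.fderiv]
        rfl
      rw [this]
      exact ((hasDecay_fderiv_extKS hn ρ hz φ (e j)).coord_smul k).add
        (((hasDecay_extKS hn ρ hz φ).mono (by linarith)).const_smul _)
    have key := rieszConv_coordLaplacian hn ρ (f := fun y => y k • extKS ρ z φ y) (hχ.smul hsm)
      ((hasDecay_extKS hn ρ hz φ).coord_smul k) hfd (β := z.re)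
      (hlap ▸ hasDecay_extKS hn ρ hz _) hw (by linarith) (by linarith) x
    rw [hlap, hw2, rieszConv_inversion hn ρ hz (hw2 ▸ add_two_notMem_rieszPoles hw), ← hw2,
      spinorConst_add_two hw] at key
    rw [← smul_right_inj hc, key, smul_smul]
    congr 1
    ring
  · -- The functional equation raises the exponent `z` to `z + 2 = -2n - w`.
    have hc := factor_ne_zero hz h1
    have hf : (fun y => y k • extKS ρ z φ y) =
        extKS ρ (z + 2) (((z + 1) * (z + 1 + n))⁻¹ • weightedOp ρ k z φ) := by
      ext y
      rw [extKS_smul ρ hz2, ← coord_smul_extKS hn ρ k hz, inv_smul_smul₀ hc]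
    have hw2 : w = -2 * n - (z + 2) := by rw [hwz]; ring
    rw [hf, hw2, rieszConv_inversion hn ρ hz2 (hw2 ▸ hw), spinorConst_add_two hz, smul_apply,
      smul_smul]
    congr 1
    generalize (z + 1) * (z + 1 + n) = c at hc ⊢
    field_simp

end Complete

/-! ### The order of the differential operator -/

/-- The coefficients of the second order operator `c · weightedOp ρ k z`. -/
def weightedOpCoeff (ρ : CliffordRep n S) (k : Fin n) (c z : ℂ) :
    (m : ℕ) → (Fin m → Fin n) → Euc n → (S →L[ℂ] S)
  | 1, I, _ => (if I 0 = k then (c * (z + n + 3)) • ContinuousLinearMap.id ℂ S else 0) +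
      c • (cl ρ (e (I 0))).comp (cl ρ (e k))
  | 2, I, x => if I 0 = I 1 then (c * (x k : ℂ)) • ContinuousLinearMap.id ℂ S else 0
  | _, _, _ => 0

lemma contDiff_weightedOpCoeff (ρ : CliffordRep n S) (k : Fin n) (c z : ℂ) (m : ℕ)
    (I : Fin m → Fin n) : ContDiff ℝ ∞ (weightedOpCoeff ρ k c z m I) := by
  match m, I with
  | 0, _ => exact contDiff_const
  | 1, _ => exact contDiff_const
  | 2, I =>
    change ContDiff ℝ ∞ fun x : Euc n =>
      if I 0 = I 1 then (c * (x k : ℂ)) • ContinuousLinearMap.id ℂ S else 0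
    split_ifs
    · have h1 : ContDiff ℝ ∞ fun x : Euc n => ((x k : ℝ) : ℂ) :=
        Complex.ofRealCLM.contDiff.comp (EuclideanSpace.proj k : Euc n →L[ℝ] ℝ).contDiff
      exact (contDiff_const.mul h1).smul contDiff_const
    · exact contDiff_const
  | m + 3, _ => exact contDiff_const

/-- The commutator `[Δ, x_k] = 2 ∂_k` puts the operator into the form with coefficients on
the left. -/
lemma weightedOp_apply (ρ : CliffordRep n S) (k : Fin n) (z : ℂ) (φ : 𝓢(Euc n, S)) (x : Euc n) :
    weightedOp ρ k z φ x = x k • (Δ φ : 𝓢(Euc n, S)) x +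
      (z + n + 3) • (∂_{(e k : Euc n)} φ : 𝓢(Euc n, S)) x +
      ∑ j, cl ρ (e j) (cl ρ (e k) ((∂_{(e j : Euc n)} φ : 𝓢(Euc n, S)) x)) := by
  have h : diracS ρ (clS ρ (e k) φ) x =
      ∑ j, cl ρ (e j) (cl ρ (e k) ((∂_{(e j : Euc n)} φ : 𝓢(Euc n, S)) x)) := by
    simp only [diracS, lineDerivOp_clS, sum_apply_schwartz, clS_apply]
  rw [weightedOp, laplacian_coordS, add_apply, add_apply, add_apply, h, coordS_apply, smul_apply,
    smul_apply]
  module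

lemma isDiffOpOfOrderLE_weightedOp (ρ : CliffordRep n S) (k : Fin n) (c z : ℂ)
    {P : 𝓢(Euc n, S) → Euc n → S} (hP : ∀ φ x, P φ x = c • weightedOp ρ k z φ x) :
    IsDiffOpOfOrderLE 2 P := by
  refine ⟨weightedOpCoeff ρ k c z, contDiff_weightedOpCoeff ρ k c z, fun φ x => ?_⟩
  have h1 : ∀ I : Fin 1 → Fin n, iteratedFDeriv ℝ 1 φ x (fun j => e (I j)) =
      (∂_{(e (I 0) : Euc n)} φ : 𝓢(Euc n, S)) x := fun I => by
    rw [iteratedFDeriv_one_apply, SchwartzMap.lineDerivOp_apply_eq_fderiv]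
  have h2 : ∀ I : Fin 2 → Fin n, iteratedFDeriv ℝ 2 φ x (fun j => e (I j)) =
      (∂_{(e (I 0) : Euc n)} (∂_{(e (I 1) : Euc n)} φ : 𝓢(Euc n, S)) : 𝓢(Euc n, S)) x := fun I => by
    rw [← SchwartzMap.iteratedLineDerivOp_eq_iteratedFDeriv]
    rfl
  rw [hP, Finset.sum_range_succ, Finset.sum_range_succ, Finset.sum_range_one]
  simp only [h1, h2]
  have e0 : ∑ I : Fin 0 → Fin n, weightedOpCoeff ρ k c z 0 I x
      (iteratedFDeriv ℝ 0 φ x fun j => e (I j)) = 0 := by simp [weightedOpCoeff]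
  have e1 : ∑ I : Fin 1 → Fin n, weightedOpCoeff ρ k c z 1 I x
      ((∂_{(e (I 0) : Euc n)} φ : 𝓢(Euc n, S)) x) =
      (c * (z + n + 3)) • (∂_{(e k : Euc n)} φ : 𝓢(Euc n, S)) x +
      c • ∑ j, cl ρ (e j) (cl ρ (e k) ((∂_{(e j : Euc n)} φ : 𝓢(Euc n, S)) x)) := by
    rw [← (Equiv.funUnique (Fin 1) (Fin n)).symm.sum_comp]
    simp only [weightedOpCoeff, add_apply, Finset.sum_add_distrib, Finset.smul_sum]
    congr 1
    rw [Finset.sum_eq_single k]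
    · simp
    · intro j _ hj
      simp [hj]
    · simp
  have e2 : ∑ I : Fin 2 → Fin n, weightedOpCoeff ρ k c z 2 I x
      ((∂_{(e (I 0) : Euc n)} (∂_{(e (I 1) : Euc n)} φ : 𝓢(Euc n, S)) : 𝓢(Euc n, S)) x) =
      (c * (x k : ℂ)) • (Δ φ : 𝓢(Euc n, S)) x := by
    rw [← (finTwoArrowEquiv (Fin n)).symm.sum_comp, Fintype.sum_prod_type, laplacian_eq_sum_e,
      sum_apply_schwartz, Finset.smul_sum]
    refine Finset.sum_congr rfl fun i _ => ?_
    rw [Finset.sum_eq_single i]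
    · simp [weightedOpCoeff]
    · intro j _ hj
      simp [weightedOpCoeff, hj.symm]
    · simp
  rw [e0, e1, e2, weightedOp_apply, ← Complex.coe_smul]
  module

/-- The test field `|u - x|² v` near a point `x` with `x_k = 1` detects the second order part
`c · x_k Δ`. -/
lemma not_isDiffOpOfOrderLE_weightedOp [Nontrivial S] (ρ : CliffordRep n S) (k : Fin n) {c : ℂ}
    (hc : c ≠ 0) (z : ℂ) {P : 𝓢(Euc n, S) → Euc n → S}
    (hP : ∀ φ x, P φ x = c • weightedOp ρ k z φ x) : ¬ IsDiffOpOfOrderLE 1 P := by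
  rintro ⟨a, -, ha⟩
  obtain ⟨v, hv⟩ := exists_ne (0 : S)
  set x : Euc n := e k with hx
  set f : Euc n → S := fun u => ‖u - x‖ ^ 2 • v with hf
  have hfsm : ContDiff ℝ ∞ f := ((contDiff_id.sub contDiff_const).norm_sq ℝ).smul contDiff_const
  have hfd : ∀ y w : Euc n, fderiv ℝ f y w = (2 * inner ℝ (y - x) w) • v := by
    intro y w
    have h1 : HasFDerivAt (fun u : Euc n => u - x) (ContinuousLinearMap.id ℝ (Euc n)) y :=
      (hasFDerivAt_id y).sub_const x
    have h2 := (h1.norm_sq.smul_const v).fderiv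
    rw [hf, h2]
    simp [inner_sub_left]
  have hfdd : ∀ y w w' : Euc n, fderiv ℝ (fun y => fderiv ℝ f y w) y w' =
      (2 * inner ℝ w' w) • v := by
    intro y w w'
    have h0 : (fun y => fderiv ℝ f y w) = fun y => (2 * inner ℝ (y - x) w) • v :=
      funext fun y => hfd y w
    have h1 : HasFDerivAt (fun u : Euc n => u - x) (ContinuousLinearMap.id ℝ (Euc n)) y :=
      (hasFDerivAt_id y).sub_const x
    have h2 := (((h1.inner ℝ (hasFDerivAt_const w y)).const_mul 2).smul_const v).fderiv
    rw [h0, h2]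
    simp
  obtain ⟨φ, hφ⟩ := exists_schwartz_eq_on_ball hfsm x
  have hev : (φ : Euc n → S) =ᶠ[𝓝 x] f := by
    filter_upwards [Metric.ball_mem_nhds x two_pos] with u hu
    exact hφ u hu
  have hφ0 : φ x = 0 := by
    rw [hev.eq_of_nhds, hf]
    simp
  have hφ1 : ∀ w : Euc n, fderiv ℝ φ x w = 0 := fun w => by
    rw [hev.fderiv_eq, hfd]
    simp
  have hφ2 : (Δ φ : 𝓢(Euc n, S)) x = (2 * n : ℝ) • v := by
    rw [laplacian_apply_eq_coordLaplacian, coordLaplacian_congr hev, coordLaplacian]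
    simp only [hfdd]
    rw [← Finset.sum_smul]
    congr 1
    have : ∀ j : Fin n, (2 : ℝ) * inner ℝ (e j : Euc n) (e j) = 2 := fun j => by
      simp [e]
    simp only [this]
    simp [mul_comm]
  have hW : weightedOp ρ k z φ x = (2 * n : ℝ) • v := by
    rw [weightedOp_apply, hφ2]
    simp only [SchwartzMap.lineDerivOp_apply_eq_fderiv, hφ1]
    simp [hx, e]
  have h := ha φ x
  rw [hP, hW, Finset.sum_range_succ, Finset.sum_range_one] at h
  have e0 : ∀ I : Fin 0 → Fin n, iteratedFDeriv ℝ 0 φ x (fun j => e (I j)) = 0 := fun I => hφ0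
  have e1 : ∀ I : Fin 1 → Fin n, iteratedFDeriv ℝ 1 φ x (fun j => e (I j)) = 0 := fun I => by
    rw [iteratedFDeriv_one_apply, hφ1]
  simp only [e0, e1, map_zero, Finset.sum_const_zero, add_zero] at h
  have hn0 : (2 * n : ℝ) ≠ 0 := by
    have : 0 < n := k.pos
    positivity
  exact (smul_ne_zero hc (smul_ne_zero hn0 hv)) h

end SpinorKS

end

theorem theorem3p6 (n : ℕ) (hn : 0 < n)
    {S : Type*} [NormedAddCommGroup S] [NormedSpace ℂ S] [FiniteDimensional ℂ S] [Nontrivial S]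
    (ρ : SpinorKS.CliffordRep n S) (lam : ℂ)
    (h₁ : -2 * (lam + 1) ∉ SpinorKS.rieszPoles n)
    (h₂ : -2 * ((n : ℂ) - lam) ∉ SpinorKS.rieszPoles n) :
    (∀ φ : 𝓢(SpinorKS.Euc n, S),
      (∀ x, SpinorKS.KnappSteinDefinedAt ρ ((n : ℂ) - lam) φ x) ∧
      ContDiff ℝ ∞ (SpinorKS.knappStein ρ ((n : ℂ) - lam) φ) ∧
      (∀ x, SpinorKS.KnappSteinDefinedAt ρ (lam + 1)
        (SpinorKS.mulLast hn (SpinorKS.knappStein ρ ((n : ℂ) - lam) φ)) x) ∧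
      ∀ x, SpinorKS.compositeOp hn ρ lam φ x =
        (SpinorKS.spinorConst n (-2 * lam - 2) * SpinorKS.spinorConst n (2 * lam - 2 * n)) •
          ((2 * lam - n + 1) • fderiv ℝ φ x (SpinorKS.e (SpinorKS.lastIdx n hn)) +
            SpinorKS.dirac ρ
              (fun y => SpinorKS.cl ρ (SpinorKS.e (SpinorKS.lastIdx n hn)) (φ y)) x +
            Laplacian.laplacian (SpinorKS.mulLast hn φ) x)) ∧
    SpinorKS.IsDiffOpOfOrderLE 2
      (fun φ : 𝓢(SpinorKS.Euc n, S) => SpinorKS.compositeOp hn ρ lam φ) ∧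
    (SpinorKS.spinorConst n (-2 * lam - 2) * SpinorKS.spinorConst n (2 * lam - 2 * n) ≠ 0 →
      ¬ SpinorKS.IsDiffOpOfOrderLE 1
        (fun φ : 𝓢(SpinorKS.Euc n, S) => SpinorKS.compositeOp hn ρ lam φ)) := by
  have : CompleteSpace S := FiniteDimensional.complete ℂ S
  have hn0 : (0 : ℝ) < n := by exact_mod_cast hn
  set k := SpinorKS.lastIdx n hn with hk
  set z : ℂ := -2 * ((n : ℂ) - lam) with hz
  -- The two exponents `z = 2 lam - 2n` and `-2 lam - 2` have the sum `-2n - 2`.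
  have hw : -2 * (lam + 1) = -2 * n - 2 - z := by rw [hz]; ring
  have hKS : ∀ φ : 𝓢(SpinorKS.Euc n, S),
      SpinorKS.knappStein ρ ((n : ℂ) - lam) φ = SpinorKS.extKS ρ z φ :=
    fun φ => SpinorKS.rieszConv_schwartz hn ρ φ h₂
  have hmul : ∀ φ : 𝓢(SpinorKS.Euc n, S),
      SpinorKS.mulLast hn (SpinorKS.knappStein ρ ((n : ℂ) - lam) φ) =
        fun y => y k • SpinorKS.extKS ρ z φ y := fun φ => by
    rw [hKS]
    rfl
  -- The outer convolution converges at infinity: its integrand is `O(|y|^(-2n-1))`.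
  have hre : (-2 * (lam + 1)).re + (z.re + 1) < -n := by
    have := congrArg Complex.re hw
    simp only [Complex.sub_re, Complex.mul_re, Complex.neg_re, Complex.re_ofNat,
      Complex.neg_im, Complex.im_ofNat, Complex.natCast_re, Complex.natCast_im, mul_zero,
      sub_zero] at this ⊢
    linarith
  have hsm : ∀ φ : 𝓢(SpinorKS.Euc n, S), ContDiff ℝ ∞ fun y => y k • SpinorKS.extKS ρ z φ y :=
    fun φ => (EuclideanSpace.proj k : SpinorKS.Euc n →L[ℝ] ℝ).contDiff.smul
      (SpinorKS.contDiff_extKS hn ρ h₂ φ)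
  have c1 : SpinorKS.spinorConst n (-2 * lam - 2) = SpinorKS.spinorConst n (-2 * (lam + 1)) := by
    congr 1
    ring
  have c2 : SpinorKS.spinorConst n (2 * lam - 2 * n) = SpinorKS.spinorConst n z := by
    congr 1
    rw [hz]
    ring
  have hmain : ∀ (φ : 𝓢(SpinorKS.Euc n, S)) x, SpinorKS.compositeOp hn ρ lam φ x =
      (SpinorKS.spinorConst n (-2 * lam - 2) * SpinorKS.spinorConst n (2 * lam - 2 * n)) •
        SpinorKS.weightedOp ρ k z φ x := fun φ x => by
    rw [c1, c2, ← SpinorKS.rieszConv_coord_smul_extKS hn ρ k hw h₂ h₁ φ x, ← hmul]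
    rfl
  refine ⟨fun φ => ⟨fun x => ?_, ?_, fun x => ?_, fun x => ?_⟩,
    SpinorKS.isDiffOpOfOrderLE_weightedOp ρ k _ z hmain,
    fun hc => SpinorKS.not_isDiffOpOfOrderLE_weightedOp ρ k hc z hmain⟩
  · exact SpinorKS.hasRegularizedIntegral_of_hasDecay hn ρ (φ.smooth ⊤)
      (SpinorKS.hasDecay_schwartz φ (-n - 1 - z.re)) (by rw [← hz]; linarith) x
  · rw [hKS]
    exact SpinorKS.contDiff_extKS hn ρ h₂ φ
  · rw [hmul]
    exact SpinorKS.hasRegularizedIntegral_of_hasDecay hn ρ (hsm φ)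
      ((SpinorKS.hasDecay_extKS hn ρ h₂ φ).coord_smul k) hre x
  · have hL : (SpinorKS.mulLast hn φ : SpinorKS.Euc n → S) = SpinorKS.coordS k φ := by
      ext y
      rw [SpinorKS.coordS_apply]
      rfl
    have hD : SpinorKS.dirac ρ (fun y => SpinorKS.cl ρ (SpinorKS.e k) (φ y)) x =
        SpinorKS.diracS ρ (SpinorKS.clS ρ (SpinorKS.e k) φ) x :=
          (SpinorKS.diracS_apply ρ (SpinorKS.clS ρ (SpinorKS.e k) φ) x).symm
    have hc : z + n + 1 = 2 * lam - n + 1 := by rw [hz]; ring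
    rw [hmain, hD, hL, ← SchwartzMap.laplacian_apply, SpinorKS.weightedOp, hc,
      ← SchwartzMap.lineDerivOp_apply_eq_fderiv]
    congr 1
    simp only [add_apply, smul_apply]
    abel
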